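/- Let $\Omega\subset\mathbb R^2$ be a bounded polygonal domain (open, connected, non-empty, with closure exactly covered by a finite conforming triangulation) with Lipschitz boundary. Let $\partial\Omega_D\subset\partial\Omega$ be relatively closed with positive length, and let $\partial\Omega_N=\partial\Omega\setminus\partial\Omega_D$. Let $V=H^1(\Omega;\mathbb C)$ with $\|\zeta\|_V^2=\|\zeta\|_{L^2(\Omega)}^2+\|\nabla\zeta\|_{L^2(\Omega)}^2$, and let $V_0=\{\zeta\in V:\zeta=0\text{ on }\partial\Omega_D\}$ in the sense of traces. The space $H^{1/2}(\partial\Omega_D;\mathbb R)$ consists of the restrictions to $\partial\Omega_D$ of the functions in $H^{1/2}(\partial\Omega;\mathbb R)$ and carries the quotient norm (the infimum of the norms of all extensions), where $$\|w\|_{H^{1/2}(\partial\Omega)}^2=\int_{\partial\Omega}|w|^2\,ds+\int_{\partial\Omega}\int_{\partial\Omega}\frac{|w(x)-w(y)|^2}{|x-y|^2}\,ds(x)\,ds(y).$$ For $\alpha\le 0\le\beta$ put $\mu_1(t)=\cos t-\alpha\sin t$, $\mu_2(t)=\cos t+\beta\sin t$, $\Gamma_{12}=-\mu_1'/\mu_2$,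 $\Gamma_{21}=\mu_2'/\mu_1$. For $\xi^-\in[-\frac\pi2,0]$ and $\xi^+\in[0,\frac\pi2]$ let $\widehat{\Gamma_{ij}}(t)$ be $\Gamma_{ij}(\xi^+)$ if $t\ge\xi^+$, $\Gamma_{ij}(\xi^-)$ if $t\le\xi^-$, and $\Gamma_{ij}(t)$ otherwise, and let $$\hat B(t)=\begin{pmatrix}-\widehat{\Gamma_{21}}(t)&0\\0&\widehat{\Gamma_{12}}(t)\end{pmatrix}.$$ There are constants $C,C_{tr}>0$, depending only on $\Omega$ and $\partial\Omega_D$, such that the following holds. Let $\alpha\le 0\le\beta$, $\xi^-$, $\xi^+$ be as above and let $M>0$ be such that the entries of $\hat B(t)$ are bounded by $M$ in absolute value for all $t\in\mathbb R$. Let $\xi_D\in H^{1/2}(\partial\Omega_D;\mathbb R)$, $g\in L^2(\partial\Omega_N;\mathbb R)$, $\xi\in L^2(\Omega;\mathbb R)$ and $\varepsilon>0$. Then there is a unique $$\zeta_\varepsilon\in V_D:=\{\zeta\in V:\ \Re\zeta=\xi_D\text{ and }\Im\zeta=0\text{ on }\partial\Omega_D\}$$ such that $$\int_\Omega(\hat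 B(\xi)+i\varepsilon I)\nabla\zeta_\varepsilon\cdot\overline{\nabla\tilde\zeta}\,dx=\int_{\partial\Omega_N}g\,\overline{\tilde\zeta}\,ds\qquad\text{for all }\tilde\zeta\in V_0,$$ and it satisfies $$\|\zeta_\varepsilon\|_V\le\Big(\frac{M\sqrt{1+C}}{\varepsilon}+1\Big)C_{tr}\,\|\xi_D\|_{H^{1/2}(\partial\Omega_D;\mathbb R)}+\frac{\sqrt{1+C}}{\varepsilon}\,\|g\|_{L^2(\partial\Omega_N;\mathbb R)}.$$ -/

import Mathlib

open MeasureTheory Filter Topology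
open scoped ENNReal NNReal ContDiff Matrix

noncomputable section

namespace Kirigami

/-- The Euclidean plane. -/
abbrev Plane : Type := EuclideanSpace ℝ (Fin 2)

/-! ### The domain -/

/-- Every boundary point has a neighbourhood in which, in suitable orthonormal coordinates, `Ω` is
the strict epigraph of a Lipschitz function of one variable. -/
def HasLipschitzBoundary (Ω : Set Plane) : Prop :=
  ∀ x ∈ frontier Ω, ∃ (L : Plane ≃ₗᵢ[ℝ] Plane) (f : ℝ → ℝ) (K : ℝ≥0) (r : ℝ),
    LipschitzWith K f ∧ 0 < r ∧ ∀ y ∈ Metric.ball x r, (y ∈ Ω ↔ f (L y 0) < L y 1)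

/-- The closure of `Ω` is exactly covered by a finite conforming triangulation.
(If `Ω` is open, its closure is then the union of the 2-dimensional faces, i.e. of triangles.) -/
def FittedByTriangularMesh (Ω : Set Plane) : Prop :=
  ∃ T : Geometry.SimplicialComplex ℝ Plane, T.faces.Finite ∧ T.space = closure Ω

/-- Bounded polygonal domains with Lipschitz boundary ("domain": open, connected, non-empty). -/
structure IsPolygonalDomain (Ω : Set Plane) : Prop where
  isOpen : IsOpen Ω
  isConnected : IsConnected Ω
  isBounded : Bornology.IsBounded Ω
  fitted : FittedByTriangularMesh Ω
  lipschitz : HasLipschitzBoundary Ω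

/-- The arc-length measure on a subset `S` of the plane (used for subsets of the boundary). -/
def arcLength (S : Set Plane) : Measure Plane :=
  (Measure.hausdorffMeasure 1 : Measure Plane).restrict S

/-! ### The Sobolev space `H¹(Ω; ℂ)` -/

/-- The `j`-th classical partial derivative. -/
def partialDeriv {F : Type*} [NormedAddCommGroup F] [NormedSpace ℝ F]
    (j : Fin 2) (φ : Plane → F) (x : Plane) : F :=
  fderiv ℝ φ x (EuclideanSpace.single j 1)

/-- `G` is the weak gradient of `u` in `Ω`. -/
def IsWeakGradient (Ω : Set Plane) (u : Plane → ℂ) (G : Plane → EuclideanSpace ℂ (Fin 2)) : Prop :=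
  ∀ φ : Plane → ℝ, ContDiff ℝ ∞ φ → HasCompactSupport φ → tsupport φ ⊆ Ω → ∀ j : Fin 2,
    ∫ x in Ω, partialDeriv j φ x • u x = -∫ x in Ω, φ x • G x j

/-- `L²(Ω; ℂ) × L²(Ω; ℂ²)` with the Hilbert norm `(‖u‖² + ‖G‖²)^(1/2)`. -/
abbrev L2Pair (Ω : Set Plane) : Type :=
  WithLp 2 (Lp ℂ 2 ((volume : Measure Plane).restrict Ω) ×
    Lp (EuclideanSpace ℂ (Fin 2)) 2 ((volume : Measure Plane).restrict Ω))

lemma integrable_smul_of_lp {F : Type*} [NormedAddCommGroup F] [NormedSpace ℝ F] {Ω : Set Plane}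
    (u : Lp F 2 ((volume : Measure Plane).restrict Ω)) {φ : Plane → ℝ} (hc : Continuous φ)
    (hs : HasCompactSupport φ) : Integrable (fun x => φ x • u x) (volume.restrict Ω) :=
  ((Lp.memLp u).locallyIntegrable one_le_two).integrable_smul_left_of_hasCompactSupport hc hs

lemma continuous_partialDeriv {φ : Plane → ℝ} (h : ContDiff ℝ ∞ φ) (j : Fin 2) :
    Continuous (partialDeriv j φ) :=
  (h.continuous_fderiv (by simp)).clm_apply continuous_const

lemma hasCompactSupport_partialDeriv {φ : Plane → ℝ} (h : HasCompactSupport φ) (j : Fin 2) :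
    HasCompactSupport (partialDeriv j φ) :=
  h.fderiv_apply (𝕜 := ℝ) _

lemma integrable_smul_coord {Ω : Set Plane}
    (G : Lp (EuclideanSpace ℂ (Fin 2)) 2 ((volume : Measure Plane).restrict Ω))
    {φ : Plane → ℝ} (hc : Continuous φ) (hs : HasCompactSupport φ) (j : Fin 2) :
    Integrable (fun x => φ x • G x j) (volume.restrict Ω) := by
  have := ((EuclideanSpace.proj j : EuclideanSpace ℂ (Fin 2) →L[ℂ] ℂ).restrictScalars ℝ).integrable_comp
    (integrable_smul_of_lp G hc hs)
  simpa using this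

/-- `V = H¹(Ω; ℂ)`: the pairs `(u, ∇u)` with `u, ∇u ∈ L²(Ω)`, where `∇u` is the weak gradient of
`u` (and so is determined by `u`); the norm is `(‖u‖² + ‖∇u‖²)^(1/2)`. -/
def H1 (Ω : Set Plane) : Submodule ℂ (L2Pair Ω) where
  carrier := {p | IsWeakGradient Ω p.fst p.snd}
  zero_mem' := by
    intro φ _ _ _ j
    have h1 := Lp.coeFn_zero ℂ 2 ((volume : Measure Plane).restrict Ω)
    have h2 := Lp.coeFn_zero (EuclideanSpace ℂ (Fin 2)) 2 ((volume : Measure Plane).restrict Ω)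
    have e1 : ∫ x in Ω, partialDeriv j φ x • (0 : L2Pair Ω).fst x = 0 := by
      apply integral_eq_zero_of_ae
      filter_upwards [h1] with x hx
      rw [WithLp.zero_fst, hx]
      simp
    have e2 : ∫ x in Ω, φ x • (0 : L2Pair Ω).snd x j = 0 := by
      apply integral_eq_zero_of_ae
      filter_upwards [h2] with x hx
      rw [WithLp.zero_snd, hx]
      simp
    rw [e1, e2, neg_zero]
  add_mem' := by
    intro p q hp hq φ h1 h2 h3 j
    have e1 : ∫ x in Ω, partialDeriv j φ x • (p + q).fst x =
        (∫ x in Ω, partialDeriv j φ x • p.fst x) + ∫ x in Ω, partialDeriv j φ x • q.fst x := by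
      rw [← integral_add
        (integrable_smul_of_lp _ (continuous_partialDeriv h1 j) (hasCompactSupport_partialDeriv h2 j))
        (integrable_smul_of_lp _ (continuous_partialDeriv h1 j) (hasCompactSupport_partialDeriv h2 j))]
      apply integral_congr_ae
      filter_upwards [Lp.coeFn_add p.fst q.fst] with x hx
      rw [WithLp.add_fst, hx]
      simp
    have e2 : ∫ x in Ω, φ x • (p + q).snd x j =
        (∫ x in Ω, φ x • p.snd x j) + ∫ x in Ω, φ x • q.snd x j := by
      rw [← integral_add (integrable_smul_coord _ h1.continuous h2 j)
        (integrable_smul_coord _ h1.continuous h2 j)]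
      apply integral_congr_ae
      filter_upwards [Lp.coeFn_add p.snd q.snd] with x hx
      rw [WithLp.add_snd, hx]
      simp
    rw [e1, e2, hp φ h1 h2 h3 j, hq φ h1 h2 h3 j]
    ring
  smul_mem' := by
    intro c p hp φ h1 h2 h3 j
    have e1 : ∫ x in Ω, partialDeriv j φ x • (c • p).fst x =
        c * ∫ x in Ω, partialDeriv j φ x • p.fst x := by
      rw [← integral_const_mul]
      apply integral_congr_ae
      filter_upwards [Lp.coeFn_smul c p.fst] with x hx
      rw [WithLp.smul_fst, hx]
      simp only [Pi.smul_apply, smul_eq_mul, Complex.real_smul]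
      ring
    have e2 : ∫ x in Ω, φ x • (c • p).snd x j = c * ∫ x in Ω, φ x • p.snd x j := by
      rw [← integral_const_mul]
      apply integral_congr_ae
      filter_upwards [Lp.coeFn_smul c p.snd] with x hx
      rw [WithLp.smul_snd, hx]
      simp only [Pi.smul_apply, PiLp.smul_apply, smul_eq_mul, Complex.real_smul]
      ring
    rw [e1, e2, hp φ h1 h2 h3 j]
    ring

/-- The weak gradient of an element of `H¹(Ω; ℂ)`. -/
def grad {Ω : Set Plane} (u : H1 Ω) : Lp (EuclideanSpace ℂ (Fin 2)) 2 (volume.restrict Ω) :=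
  (u : L2Pair Ω).snd

/-- `w ∈ L²(∂Ω; ℂ)` is the boundary trace of `u ∈ H¹(Ω; ℂ)`: there are functions `φ n`, `C¹` up to
the boundary, which converge to `u` in `H¹(Ω)` and whose restrictions to `∂Ω` converge to `w` in
`L²(∂Ω)`. On a bounded Lipschitz domain every `u ∈ H¹(Ω)` has exactly one trace in this sense. -/
def IsTrace {Ω : Set Plane} (u : H1 Ω) (w : Lp ℂ 2 (arcLength (frontier Ω))) : Prop :=
  ∃ φ : ℕ → Plane → ℂ, (∀ n, ContDiff ℝ 1 (φ n)) ∧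
    Tendsto (fun n => eLpNorm (fun x => φ n x - (u : L2Pair Ω).fst x) 2 (volume.restrict Ω))
      atTop (𝓝 0) ∧
    (∀ j : Fin 2, Tendsto
      (fun n => eLpNorm (fun x => partialDeriv j (φ n) x - grad u x j) 2 (volume.restrict Ω))
      atTop (𝓝 0)) ∧
    Tendsto (fun n => eLpNorm (fun x => φ n x - w x) 2 (arcLength (frontier Ω))) atTop (𝓝 0)

/-- The space `V_D`: the real part of the trace is `ξD` and its imaginary part is `0` on `ΓD`. -/
def VD (Ω ΓD : Set Plane) (ξD : Plane → ℝ) : Set (H1 Ω) :=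
  {ζ | ∃ w, IsTrace ζ w ∧ ∀ᵐ x ∂arcLength ΓD, (w x).re = ξD x ∧ (w x).im = 0}

/-! ### The space `H^{1/2}` on the Dirichlet boundary -/

/-- The Sobolev–Slobodeckij norm of `H^{1/2}(∂Ω; ℝ)`, with values in `[0, ∞]`:
`‖w‖² = ∫ |w|² + ∫∫ |w(x) - w(y)|² / |x - y|²` (integrals over `∂Ω`). -/
def slobodeckijNorm (Ω : Set Plane) (w : Plane → ℝ) : ℝ≥0∞ :=
  ((∫⁻ x, ‖w x‖ₑ ^ 2 ∂arcLength (frontier Ω)) +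
    ∫⁻ x, ∫⁻ y, ‖w x - w y‖ₑ ^ 2 / edist x y ^ 2
      ∂arcLength (frontier Ω) ∂arcLength (frontier Ω)) ^ (1 / 2 : ℝ)

/-- The norm of `H^{1/2}(ΓD; ℝ)`, the space of restrictions to `ΓD ⊆ ∂Ω` of the elements of
`H^{1/2}(∂Ω; ℝ)`: the infimum of the norms of all extensions, `∞` if there is none. -/
def hHalfENorm (Ω ΓD : Set Plane) (v : Plane → ℝ) : ℝ≥0∞ :=
  ⨅ (w : Plane → ℝ) (_ : AEStronglyMeasurable w (arcLength (frontier Ω)))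
    (_ : w =ᵐ[arcLength ΓD] v), slobodeckijNorm Ω w

/-- `v ∈ H^{1/2}(ΓD; ℝ)`. -/
def MemHHalf (Ω ΓD : Set Plane) (v : Plane → ℝ) : Prop := hHalfENorm Ω ΓD v < ⊤

/-- The norm of `H^{1/2}(ΓD; ℝ)` as a real number (meaningful if `MemHHalf Ω ΓD v`). -/
def hHalfNorm (Ω ΓD : Set Plane) (v : Plane → ℝ) : ℝ := (hHalfENorm Ω ΓD v).toReal

/-! ### The coefficients of the rhombi-slit kirigami -/

def mu1 (α t : ℝ) : ℝ := Real.cos t - α * Real.sin t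

def mu2 (β t : ℝ) : ℝ := Real.cos t + β * Real.sin t

def Gamma12 (α β t : ℝ) : ℝ := -(deriv (mu1 α) t / mu2 β t)

def Gamma21 (α β t : ℝ) : ℝ := deriv (mu2 β) t / mu1 α t

/-- The cut-off of a function `Γ`, frozen at its values at `ξm` and `ξp` outside `(ξm, ξp)`. -/
def cutOff (ξm ξp : ℝ) (Γ : ℝ → ℝ) (t : ℝ) : ℝ :=
  if ξp ≤ t then Γ ξp else if t ≤ ξm then Γ ξm else Γ t

/-- The cut-off coefficient matrix `B̂`. -/
def Bhat (α β ξm ξp t : ℝ) : Matrix (Fin 2) (Fin 2) ℝ :=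
  !![-cutOff ξm ξp (Gamma21 α β) t, 0; 0, cutOff ξm ξp (Gamma12 α β) t]

/-- The admissible parameters `α, β, ξ⁻, ξ⁺`, together with a uniform bound `M > 0` for `B̂`. As
`B̂` is diagonal, its operator norm is the largest modulus of an entry. The bound excludes zeros of
the denominators in `[ξ⁻, ξ⁺]`, since numerators and denominators have no common zero. -/
structure Admissible (α β ξm ξp M : ℝ) : Prop where
  alpha_nonpos : α ≤ 0
  beta_nonneg : 0 ≤ β
  xim_mem : ξm ∈ Set.Icc (-(Real.pi / 2)) 0
  xip_mem : ξp ∈ Set.Icc 0 (Real.pi / 2)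
  M_pos : 0 < M
  bound : ∀ (t : ℝ) (i j : Fin 2), |Bhat α β ξm ξp t i j| ≤ M

/-! ### The regularized linear problem -/

/-- `a_ε(ξ; ζ, η) = ∫_Ω (B̂(ξ) + iεI) ∇ζ · conj(∇η)`. -/
def aEps {Ω : Set Plane} (α β ξm ξp ε : ℝ) (ξ : Lp ℝ 2 ((volume : Measure Plane).restrict Ω))
    (ζ η : H1 Ω) : ℂ :=
  ∫ x in Ω, (((Bhat α β ξm ξp (ξ x)).map Complex.ofReal +
      (Complex.I * (ε : ℂ)) • (1 : Matrix (Fin 2) (Fin 2) ℂ)) *ᵥ (grad ζ x).ofLp) ⬝ᵥ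
    star (grad η x).ofLp

/-- `l(η) = ∫_{∂Ω \ ΓD} g · conj(η)`, as a function of the trace `w` of `η`. -/
def linForm {Ω ΓD : Set Plane} (g : Lp ℝ 2 (arcLength (frontier Ω \ ΓD)))
    (w : Lp ℂ 2 (arcLength (frontier Ω))) : ℂ :=
  ∫ x, (g x : ℂ) * star (w x) ∂arcLength (frontier Ω \ ΓD)

/-- `ζ ∈ V_D` and `a_ε(ξ; ζ, η) = l(η)` for all `η ∈ V₀`, i.e. for all `η ∈ H¹(Ω; ℂ)` whose
trace `w` vanishes on `ΓD`. -/
def IsSolution {Ω ΓD : Set Plane} (α β ξm ξp ε : ℝ)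
    (ξ : Lp ℝ 2 ((volume : Measure Plane).restrict Ω)) (ξD : Plane → ℝ)
    (g : Lp ℝ 2 (arcLength (frontier Ω \ ΓD))) (ζ : H1 Ω) : Prop :=
  ζ ∈ VD Ω ΓD ξD ∧
    ∀ (η : H1 Ω) (w : Lp ℂ 2 (arcLength (frontier Ω))), IsTrace η w →
      (∀ᵐ x ∂arcLength ΓD, w x = 0) →
        aEps α β ξm ξp ε ξ ζ η = linForm g w

end Kirigami

end

noncomputable section

namespace Kirigami

/-! ### Elementary inequalities for lower integrals -/

/-! The matrix `B̂(ξ)` may be indefinite, but it is real and diagonal, so the imaginary part of the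
form at `(ζ, ζ)` is exactly `ε‖∇ζ‖²` (`Admissible.im_inner_coeffOp`). Where the trace on `ΓD`
vanishes, a Friedrichs inequality turns this into coercivity. Lax–Milgram is then applied to the
imaginary part as a real bilinear form, and testing with `i • v` recovers the real part
(`exists_of_coercive_im`). Inhomogeneous Dirichlet data are removed by subtracting a lifting;
uniqueness and the a priori bound come from testing with the difference and taking imaginary parts.

The work takes place in `traceGraph Ω`, the closure in `L² × L² × L²(∂Ω)` of the triples (value,
gradient, boundary value) of `C¹` functions. Having trace `w` in the sense of `IsTrace` is the same
as lying in this graph (`isTrace_iff`), so every inequality needs proof only for `C¹` functions and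
passes to the closure; neither the density of smooth functions in `H¹` nor a trace for every `H¹`
function is needed.

Two analytic facts carry the proof. The first is `exists_norm_sq_le`: on the graph, the full norm is
bounded by the trace on `Γ` and the gradient. In a Lipschitz chart, integration along vertical lines
links the boundary, a rectangle inside `Ω` (the core) and the adjacent part of `Ω`. Control starts
at a core next to `Γ`, spreads over `Ω` through the Poincaré inequality on convex sets and
connectedness, and reaches the boundary by compactness (`controlled_self`, `exists_trace_le`).

The second is `exists_lifting_traceGraph`, a bounded lifting of `H^{1/2}` data. The data are
averaged over `∂Ω` with a kernel whose width is a smoothed distance to the boundary, kept at least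
`δ`. The resulting `C¹` functions have Dirichlet energy bounded by the Slobodeckij seminorm
uniformly in `δ`, and their boundary values approach the data as `δ → 0` (`exists_lifting`). Convex
combinations of this bounded sequence converge in the graph (`exists_limit_of_bounded`). -/

lemma sq_lintegral_mul_le {X : Type*} [MeasurableSpace X] (μ : Measure X) {f g : X → ℝ≥0∞}
    (hf : AEMeasurable f μ) (hg : AEMeasurable g μ) :
    (∫⁻ x, f x * g x ∂μ) ^ 2 ≤ (∫⁻ x, f x ^ 2 ∂μ) * ∫⁻ x, g x ^ 2 ∂μ := by
  have h := ENNReal.lintegral_mul_le_Lp_mul_Lq μ Real.HolderConjugate.two_two hf hg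
  have h2 := pow_le_pow_left' h 2
  simp only [Pi.mul_apply] at h2
  refine h2.trans (le_of_eq ?_)
  have e (a : ℝ≥0∞) : (a ^ (1 / 2 : ℝ)) ^ 2 = a := by
    rw [← ENNReal.rpow_natCast, ← ENNReal.rpow_mul]; norm_num
  rw [mul_pow, e, e]
  simp only [ENNReal.rpow_ofNat]

lemma sq_lintegral_le {X : Type*} [MeasurableSpace X] (μ : Measure X) {f : X → ℝ≥0∞}
    (hf : AEMeasurable f μ) :
    (∫⁻ x, f x ∂μ) ^ 2 ≤ μ Set.univ * ∫⁻ x, f x ^ 2 ∂μ := by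
  have h := sq_lintegral_mul_le μ (f := fun _ => 1) (g := f) aemeasurable_const hf
  simpa using h

lemma ennreal_add_sq_le (a b : ℝ≥0∞) : (a + b) ^ 2 ≤ 2 * a ^ 2 + 2 * b ^ 2 := by
  have h := ENNReal.rpow_add_le_mul_rpow_add_rpow a b (p := 2) (by norm_num)
  have e : (2 : ℝ≥0∞) ^ ((2 : ℝ) - 1) = 2 := by norm_num
  rw [e, mul_add] at h
  simpa only [ENNReal.rpow_ofNat] using h

lemma enorm_sq_le {F : Type*} [NormedAddCommGroup F] (a b : F) :
    ‖a‖ₑ ^ 2 ≤ 2 * ‖b‖ₑ ^ 2 + 2 * ‖a - b‖ₑ ^ 2 := by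
  have h : ‖a‖ₑ ≤ ‖b‖ₑ + ‖a - b‖ₑ := by
    calc ‖a‖ₑ = ‖b + (a - b)‖ₑ := by rw [add_sub_cancel]
      _ ≤ _ := enorm_add_le _ _
  exact (pow_le_pow_left' h 2).trans (ennreal_add_sq_le _ _)

/-- A one-dimensional Poincaré inequality. -/
lemma enorm_sub_sq_le_lintegral_deriv {F : Type*} [NormedAddCommGroup F] [NormedSpace ℝ F]
    [CompleteSpace F] {v : ℝ → F} (hv : ContDiff ℝ 1 v) {p q t τ : ℝ}
    (ht : t ∈ Set.Icc p q) (hτ : τ ∈ Set.Icc p q) :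
    ‖v t - v τ‖ₑ ^ 2 ≤ ENNReal.ofReal (q - p) * ∫⁻ s in Set.Ioo p q, ‖deriv v s‖ₑ ^ 2 := by
  have hc : Continuous (deriv v) := hv.continuous_deriv le_rfl
  have e : ∫ s in τ..t, deriv v s = v t - v τ := by
    apply intervalIntegral.integral_eq_sub_of_hasDerivAt
    · intro x _
      exact ((hv.differentiable one_ne_zero) x).hasDerivAt
    · exact hc.intervalIntegrable _ _
  have h1 : ‖v t - v τ‖ₑ ≤ ∫⁻ s in Set.Ioo p q, ‖deriv v s‖ₑ := by
    rw [← e, ← ofReal_norm, intervalIntegral.norm_integral_eq_norm_integral_uIoc,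
      ofReal_norm]
    refine (enorm_integral_le_lintegral_enorm _).trans ?_
    rw [Measure.restrict_congr_set (Ioo_ae_eq_Icc (μ := volume) (a := p) (b := q))]
    apply lintegral_mono_set
    refine Set.uIoc_subset_uIcc.trans ?_
    exact Set.uIcc_subset_Icc hτ ht
  refine (pow_le_pow_left' h1 2).trans ?_
  refine (sq_lintegral_le _ hc.enorm.measurable.aemeasurable).trans (le_of_eq ?_)
  rw [Measure.restrict_apply_univ, Real.volume_Ioo]

/-! ### The Poincaré inequality on convex sets -/

lemma lintegral_comp_add_smul {H : Plane → ℝ≥0∞} (hH : Measurable H) (c : Plane) {t : ℝ}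
    (ht : t ≠ 0) :
    ∫⁻ y, H (c + t • y) = ENNReal.ofReal ((t ^ 2)⁻¹) * ∫⁻ y, H y := by
  have h1 : ∫⁻ y, H (c + t • y) = ∫⁻ z, H (c + z) ∂(Measure.map (fun y : Plane => t • y) volume) := by
    rw [lintegral_map (by fun_prop) (by fun_prop)]
  rw [h1, Measure.map_addHaar_smul _ ht, lintegral_smul_measure, lintegral_add_left_eq_self]
  simp [abs_of_nonneg (sq_nonneg t)]

/-- Convexity keeps the point inside `B`, and the dilation `y ↦ (1 - t) x + t y` of the plane has
Jacobian `t² ≥ 1/4`, whence the factor 4. A bound on `t` from below is essential here. -/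
lemma lintegral_comp_segment_le {B : Set Plane} (hB : Convex ℝ B) (hm : MeasurableSet B)
    {G : Plane → ℝ≥0∞} (hG : Measurable G) {t : ℝ} (ht : t ∈ Set.Icc (1 / 2 : ℝ) 1) {x : Plane}
    (hx : x ∈ B) :
    ∫⁻ y in B, G ((1 - t) • x + t • y) ≤ 4 * ∫⁻ y in B, G y := by
  have h0 : 0 < t := by linarith [ht.1]
  calc ∫⁻ y in B, G ((1 - t) • x + t • y)
      ≤ ∫⁻ y in B, B.indicator G ((1 - t) • x + t • y) := by
        apply setLIntegral_mono' hm
        intro y hy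
        have : (1 - t) • x + t • y ∈ B := hB hx hy (by linarith [ht.2]) h0.le (by ring)
        rw [Set.indicator_of_mem this]
    _ ≤ ∫⁻ y, B.indicator G ((1 - t) • x + t • y) := setLIntegral_le_lintegral _ _
    _ = ENNReal.ofReal ((t ^ 2)⁻¹) * ∫⁻ y, B.indicator G y :=
        lintegral_comp_add_smul (hG.indicator hm) _ h0.ne'
    _ ≤ 4 * ∫⁻ y in B, G y := by
        rw [lintegral_indicator hm]
        gcongr
        rw [ENNReal.ofReal_le_iff_le_toReal (by simp)]
        simp only [ENNReal.toReal_ofNat]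
        rw [inv_le_comm₀ (by positivity) (by norm_num)]
        nlinarith [ht.1]

/-- The double integral is symmetric under exchanging `x`, `y` and `t`, `1 - t`, so one may always
assume `t ≥ 1/2` and avoid the degenerate dilation near `t = 0`. -/
lemma lintegral_lintegral_segment_le {B : Set Plane} (hB : Convex ℝ B) (hm : MeasurableSet B)
    {G : Plane → ℝ≥0∞} (hG : Measurable G) {t : ℝ} (ht : t ∈ Set.Icc (0 : ℝ) 1) :
    ∫⁻ x in B, ∫⁻ y in B, G ((1 - t) • x + t • y) ≤ volume B * (4 * ∫⁻ y in B, G y) := by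
  have key : ∀ s ∈ Set.Icc (1 / 2 : ℝ) 1,
      ∫⁻ x in B, ∫⁻ y in B, G ((1 - s) • x + s • y) ≤ volume B * (4 * ∫⁻ y in B, G y) := by
    intro s hs
    calc ∫⁻ x in B, ∫⁻ y in B, G ((1 - s) • x + s • y)
        ≤ ∫⁻ _ in B, 4 * ∫⁻ y in B, G y :=
          setLIntegral_mono' hm fun x hx => lintegral_comp_segment_le hB hm hG hs hx
      _ = _ := by rw [setLIntegral_const, mul_comm]
  rcases le_total (1 / 2) t with h | h
  · exact key t ⟨h, ht.2⟩
  · have := key (1 - t) ⟨by linarith, by linarith [ht.1]⟩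
    rw [lintegral_lintegral_swap (by fun_prop)]
    simpa [add_comm] using this

lemma measurable_enorm_fderiv_sq {φ : Plane → ℂ} (hφ : ContDiff ℝ 1 φ) :
    Measurable fun x => ‖fderiv ℝ φ x‖ₑ ^ 2 := by
  have := (hφ.continuous_fderiv one_ne_zero).measurable
  fun_prop

lemma enorm_sub_sq_le_segment {φ : Plane → ℂ} (hφ : ContDiff ℝ 1 φ) (x y : Plane) :
    ‖φ x - φ y‖ₑ ^ 2 ≤
      edist x y ^ 2 * ∫⁻ t in Set.Ioo (0 : ℝ) 1, ‖fderiv ℝ φ ((1 - t) • x + t • y)‖ₑ ^ 2 := by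
  have hd : ∀ t : ℝ, HasDerivAt (fun t : ℝ => φ ((1 - t) • x + t • y))
      (fderiv ℝ φ ((1 - t) • x + t • y) (y - x)) t := by
    intro t
    have h1 : HasDerivAt (fun t : ℝ => (1 - t) • x + t • y) (y - x) t := by
      have := (((hasDerivAt_id t).const_sub 1).smul_const x).add ((hasDerivAt_id t).smul_const y)
      refine HasDerivAt.congr_deriv this ?_
      rw [neg_one_smul, one_smul, neg_add_eq_sub]
    exact ((hφ.differentiable one_ne_zero _).hasFDerivAt).comp_hasDerivAt t h1
  have hv : ContDiff ℝ 1 (fun t : ℝ => φ ((1 - t) • x + t • y)) := by fun_prop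
  have h := enorm_sub_sq_le_lintegral_deriv hv (p := 0) (q := 1) (t := 0) (τ := 1)
    (by simp) (by simp)
  simp only [sub_zero, one_smul, zero_smul, add_zero, sub_self, zero_add, ENNReal.ofReal_one,
    one_mul] at h
  refine h.trans ?_
  have hm : Measurable fun t : ℝ => ‖fderiv ℝ φ ((1 - t) • x + t • y)‖ₑ ^ 2 :=
    (measurable_enorm_fderiv_sq hφ).comp (by fun_prop)
  rw [← lintegral_const_mul _ hm]
  apply lintegral_mono
  intro t
  beta_reduce
  rw [(hd t).deriv, ← mul_pow, edist_comm, edist_eq_enorm_sub, mul_comm]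
  gcongr
  exact ContinuousLinearMap.le_opENorm _ _

lemma measurable_lintegral_segment {G : Plane → ℝ≥0∞} (hG : Measurable G) :
    Measurable fun p : Plane × Plane =>
      ∫⁻ t in Set.Ioo (0 : ℝ) 1, G ((1 - t) • p.1 + t • p.2) := by
  have hm3 : Measurable fun p : (Plane × Plane) × ℝ =>
      G ((1 - p.2) • p.1.1 + p.2 • p.1.2) := by
    refine hG.comp ?_
    fun_prop
  exact hm3.lintegral_prod_right'

lemma lintegral_segment_le {B : Set Plane} (hB : Convex ℝ B) (hm : MeasurableSet B)
    {G : Plane → ℝ≥0∞} (hG : Measurable G) :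
    ∫⁻ x in B, ∫⁻ y in B, ∫⁻ t in Set.Ioo (0 : ℝ) 1, G ((1 - t) • x + t • y) ≤
      volume B * (4 * ∫⁻ y in B, G y) := by
  have hm3 : Measurable fun p : (Plane × ℝ) × Plane =>
      G ((1 - p.1.2) • p.1.1 + p.1.2 • p.2) := by
    refine hG.comp ?_
    fun_prop
  calc ∫⁻ x in B, ∫⁻ y in B, ∫⁻ t in Set.Ioo (0 : ℝ) 1, G ((1 - t) • x + t • y)
      = ∫⁻ x in B, ∫⁻ t in Set.Ioo (0 : ℝ) 1, ∫⁻ y in B, G ((1 - t) • x + t • y) := by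
        refine lintegral_congr fun x => lintegral_lintegral_swap ?_
        refine (hG.comp ?_).aemeasurable
        fun_prop
    _ = ∫⁻ t in Set.Ioo (0 : ℝ) 1, ∫⁻ x in B, ∫⁻ y in B, G ((1 - t) • x + t • y) :=
        lintegral_lintegral_swap (hm3.lintegral_prod_right').aemeasurable
    _ ≤ ∫⁻ _ in Set.Ioo (0 : ℝ) 1, volume B * (4 * ∫⁻ y in B, G y) :=
        setLIntegral_mono' measurableSet_Ioo fun t ht =>
          lintegral_lintegral_segment_le hB hm hG ⟨ht.1.le, ht.2.le⟩
    _ = _ := by simp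

lemma lintegral_lintegral_const_mul {X : Type*} [MeasurableSpace X] {μ ν : Measure X} [SFinite ν]
    {F : X × X → ℝ≥0∞} (hF : Measurable F) (c : ℝ≥0∞) :
    ∫⁻ x, ∫⁻ y, c * F (x, y) ∂ν ∂μ = c * ∫⁻ x, ∫⁻ y, F (x, y) ∂ν ∂μ := by
  rw [← lintegral_const_mul _ hF.lintegral_prod_right']
  exact lintegral_congr fun x => lintegral_const_mul _ (hF.comp measurable_prodMk_left)

lemma lintegral_lintegral_sub_sq_le {B : Set Plane} (hB : Convex ℝ B) (hm : MeasurableSet B)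
    {φ : Plane → ℂ} (hφ : ContDiff ℝ 1 φ) :
    ∫⁻ x in B, ∫⁻ y in B, ‖φ x - φ y‖ₑ ^ 2 ≤
      Metric.ediam B ^ 2 * (volume B * (4 * ∫⁻ x in B, ‖fderiv ℝ φ x‖ₑ ^ 2)) := by
  have hG := measurable_enorm_fderiv_sq hφ
  calc ∫⁻ x in B, ∫⁻ y in B, ‖φ x - φ y‖ₑ ^ 2
      ≤ ∫⁻ x in B, ∫⁻ y in B, Metric.ediam B ^ 2 *
          ∫⁻ t in Set.Ioo (0 : ℝ) 1, ‖fderiv ℝ φ ((1 - t) • x + t • y)‖ₑ ^ 2 := by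
        refine setLIntegral_mono' hm fun x hx => setLIntegral_mono' hm fun y hy => ?_
        refine (enorm_sub_sq_le_segment hφ x y).trans (mul_le_mul_left ?_ _)
        exact pow_le_pow_left' (Metric.edist_le_ediam_of_mem hx hy) 2
    _ = _ := lintegral_lintegral_const_mul (measurable_lintegral_segment hG) _
    _ ≤ _ := mul_le_mul_right (lintegral_segment_le hB hm hG) _

/-- Average `|φ(x)|² ≤ 2|φ(y)|² + 2|φ(x) - φ(y)|²` over `y ∈ b`; the last term is enlarged to `y ∈
B`, where the segment estimate bounds it by the gradient. -/
lemma measure_mul_lintegral_sq_le {B b : Set Plane} (hB : Convex ℝ B) (hm : MeasurableSet B)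
    (hb : b ⊆ B) {φ : Plane → ℂ} (hφ : ContDiff ℝ 1 φ) :
    volume b * ∫⁻ x in B, ‖φ x‖ₑ ^ 2 ≤
      2 * volume B * (∫⁻ x in b, ‖φ x‖ₑ ^ 2) +
        2 * (Metric.ediam B ^ 2 * (volume B * (4 * ∫⁻ x in B, ‖fderiv ℝ φ x‖ₑ ^ 2))) := by
  have hmeas : Measurable φ := hφ.continuous.measurable
  have hm1 : Measurable fun y => ‖φ y‖ₑ ^ 2 := by fun_prop
  have hm2 : Measurable fun p : Plane × Plane => ‖φ p.1 - φ p.2‖ₑ ^ 2 := by fun_prop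
  calc volume b * ∫⁻ x in B, ‖φ x‖ₑ ^ 2 = ∫⁻ x in B, ∫⁻ _ in b, ‖φ x‖ₑ ^ 2 := by
        rw [← lintegral_const_mul _ hm1]
        refine lintegral_congr fun x => ?_
        rw [setLIntegral_const, mul_comm]
    _ ≤ ∫⁻ x in B, ∫⁻ y in b, (2 * ‖φ y‖ₑ ^ 2 + 2 * ‖φ x - φ y‖ₑ ^ 2) :=
        lintegral_mono fun x => lintegral_mono fun y => enorm_sq_le _ _
    _ = ∫⁻ x in B, (2 * (∫⁻ y in b, ‖φ y‖ₑ ^ 2) + ∫⁻ y in b, 2 * ‖φ x - φ y‖ₑ ^ 2) := by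
        refine lintegral_congr fun x => ?_
        rw [lintegral_add_left (hm1.const_mul _), lintegral_const_mul _ hm1]
    _ = 2 * (∫⁻ y in b, ‖φ y‖ₑ ^ 2) * volume B +
          ∫⁻ x in B, ∫⁻ y in b, 2 * ‖φ x - φ y‖ₑ ^ 2 := by
        rw [lintegral_add_left measurable_const, setLIntegral_const]
    _ ≤ 2 * (∫⁻ y in b, ‖φ y‖ₑ ^ 2) * volume B +
          ∫⁻ x in B, ∫⁻ y in B, 2 * ‖φ x - φ y‖ₑ ^ 2 :=
        add_le_add le_rfl (lintegral_mono fun x => lintegral_mono_set hb)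
    _ = 2 * volume B * (∫⁻ y in b, ‖φ y‖ₑ ^ 2) +
          2 * ∫⁻ x in B, ∫⁻ y in B, ‖φ x - φ y‖ₑ ^ 2 := by
        rw [lintegral_lintegral_const_mul hm2 2]
        congr 1
        ring
    _ ≤ _ := add_le_add le_rfl (mul_le_mul_right (lintegral_lintegral_sub_sq_le hB hm hφ) _)

/-- The Poincaré inequality on a bounded convex set: the `L²` norm is controlled by the `L²` norm
on a subset of positive measure and by the gradient. -/
theorem Convex.exists_lintegral_sq_le {B b : Set Plane} (hB : Convex ℝ B) (hm : MeasurableSet B)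
    (hbd : Bornology.IsBounded B) (hb : b ⊆ B) (hpos : volume b ≠ 0) :
    ∃ C : ℝ≥0, ∀ φ : Plane → ℂ, ContDiff ℝ 1 φ →
      ∫⁻ x in B, ‖φ x‖ₑ ^ 2 ≤
        C * ((∫⁻ x in b, ‖φ x‖ₑ ^ 2) + ∫⁻ x in B, ‖fderiv ℝ φ x‖ₑ ^ 2) := by
  have hfin : volume b ≠ ⊤ := ((measure_mono hb).trans_lt hbd.measure_lt_top).ne
  have hBfin : volume B ≠ ⊤ := hbd.measure_lt_top.ne
  have hdiam : Metric.ediam B ≠ ⊤ := hbd.ediam_ne_top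
  set K : ℝ≥0∞ := (volume b)⁻¹ * (2 * volume B + 2 * (Metric.ediam B ^ 2 * (volume B * 4)))
  have hK : K ≠ ⊤ := by
    apply ENNReal.mul_ne_top (ENNReal.inv_ne_top.2 hpos)
    finiteness
  refine ⟨K.toNNReal, fun φ hφ => ?_⟩
  rw [ENNReal.coe_toNNReal hK]
  have hmeas : Measurable φ := hφ.continuous.measurable
  set I := ∫⁻ x in b, ‖φ x‖ₑ ^ 2
  set J := ∫⁻ x in B, ‖fderiv ℝ φ x‖ₑ ^ 2
  have h1 := measure_mul_lintegral_sq_le hB hm hb hφ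
  calc ∫⁻ x in B, ‖φ x‖ₑ ^ 2 = (volume b)⁻¹ * (volume b * ∫⁻ x in B, ‖φ x‖ₑ ^ 2) := by
        rw [← mul_assoc, ENNReal.inv_mul_cancel hpos hfin, one_mul]
    _ ≤ (volume b)⁻¹ * (2 * volume B * I + 2 * (Metric.ediam B ^ 2 * (volume B * (4 * J)))) := by
        gcongr
    _ ≤ (volume b)⁻¹ * (2 * volume B * (I + J) +
          2 * (Metric.ediam B ^ 2 * (volume B * (4 * (I + J))))) := by
        gcongr
        · exact le_self_add
        · exact le_add_self
    _ = K * (I + J) := by ring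

/-! ### Graph charts at the boundary -/

/-- A chart in which `Ω` is locally the strict epigraph of a Lipschitz function `f`, over an
interval of radius `a` and with vertical extent `h`. -/
structure GraphChart (Ω : Set Plane) where
  L : Plane ≃ₗᵢ[ℝ] Plane
  f : ℝ → ℝ
  K : ℝ≥0
  s₀ : ℝ
  a : ℝ
  h : ℝ
  lip : LipschitzWith K f
  a_pos : 0 < a
  h_pos : 0 < h
  slope : 2 * (K * a) < h
  mem_iff : ∀ s t, |s - s₀| < a → |t - f s| < h → (L.symm !₂[s, t] ∈ Ω ↔ f s < t)

lemma norm_vec_le (s t : ℝ) : ‖(!₂[s, t] : Plane)‖ ≤ |s| + |t| := by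
  rw [EuclideanSpace.norm_eq, Fin.sum_univ_two]
  apply Real.sqrt_le_iff.2 ⟨by positivity, ?_⟩
  simp only [Real.norm_eq_abs]
  change |s| ^ 2 + |t| ^ 2 ≤ _
  nlinarith [abs_nonneg s, abs_nonneg t]

lemma abs_coord_le_norm (y : Plane) (i : Fin 2) : |y i| ≤ ‖y‖ := by
  simpa using PiLp.norm_apply_le y i

lemma vec_eta (y : Plane) : (!₂[y 0, y 1] : Plane) = y := by
  ext i
  fin_cases i <;> rfl

namespace GraphChart

variable {Ω : Set Plane} (c : GraphChart Ω)

/-- The point of the plane with chart coordinates `(s, t)`. -/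
def point (p : ℝ × ℝ) : Plane := c.L.symm !₂[p.1, p.2]

/-- The parametrization of the graph. -/
def curve (s : ℝ) : Plane := c.point (s, c.f s)

/-- The neighbourhood covered by the chart. -/
def nhd : Set Plane := {y | |c.L y 0 - c.s₀| < c.a ∧ |c.L y 1 - c.f (c.L y 0)| < c.h}

/-- A rectangle in `Ω` above the graph. -/
def core : Set Plane := {y | |c.L y 0 - c.s₀| < c.a ∧
  c.L y 1 ∈ Set.Ioo (c.f c.s₀ + c.K * c.a) (c.f c.s₀ + c.h - c.K * c.a)}

def base : Set ℝ := Set.Ioo (c.s₀ - c.a) (c.s₀ + c.a)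

def top : Set ℝ := Set.Ioo (c.f c.s₀ + c.K * c.a) (c.f c.s₀ + c.h - c.K * c.a)

lemma mem_base {s : ℝ} : s ∈ c.base ↔ |s - c.s₀| < c.a := by
  rw [abs_lt, base, Set.mem_Ioo]
  constructor <;> rintro ⟨h1, h2⟩ <;> constructor <;> linarith

@[simp] lemma L_point_zero (p : ℝ × ℝ) : c.L (c.point p) 0 = p.1 := by simp [point]

@[simp] lemma L_point_one (p : ℝ × ℝ) : c.L (c.point p) 1 = p.2 := by simp [point]

lemma point_eta (y : Plane) : c.point (c.L y 0, c.L y 1) = y := by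
  simp [point, vec_eta]

lemma continuous_coord (i : Fin 2) : Continuous fun y => c.L y i :=
  (EuclideanSpace.proj i : Plane →L[ℝ] ℝ).continuous.comp c.L.continuous

lemma isOpen_nhd : IsOpen c.nhd := by
  have h0 := c.continuous_coord 0
  have h1 := c.continuous_coord 1
  have hf := c.lip.continuous
  exact (isOpen_lt (h0.sub continuous_const).abs continuous_const).inter
    (isOpen_lt (h1.sub (hf.comp h0)).abs continuous_const)

lemma isOpen_core : IsOpen c.core := by
  have h0 := c.continuous_coord 0
  have h1 := c.continuous_coord 1
  exact (isOpen_lt (h0.sub continuous_const).abs continuous_const).inter (isOpen_Ioo.preimage h1)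

lemma measurePreserving_point : MeasurePreserving c.point volume volume := by
  have h1 := (volume_preserving_finTwoArrow ℝ).symm (MeasurableEquiv.finTwoArrow)
  have h2 := (PiLp.volume_preserving_toLp (Fin 2)).comp h1
  have h3 := c.L.symm.measurePreserving.comp h2
  convert! h3 using 1

lemma mem_Ω_iff {y : Plane} (hy : y ∈ c.nhd) : y ∈ Ω ↔ c.f (c.L y 0) < c.L y 1 := by
  have := c.mem_iff (c.L y 0) (c.L y 1) hy.1 hy.2
  rwa [vec_eta, LinearIsometryEquiv.symm_apply_apply] at this

lemma point_mem_nhd {s t : ℝ} (hs : |s - c.s₀| < c.a) (ht : |t - c.f s| < c.h) :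
    c.point (s, t) ∈ c.nhd := by
  simp [nhd, hs, ht]

lemma measurable_point : Measurable c.point := c.measurePreserving_point.measurable

lemma continuous_point : Continuous c.point := by
  refine c.L.symm.continuous.comp ((PiLp.continuous_toLp 2 _).comp ?_)
  refine continuous_pi fun i => ?_
  fin_cases i
  · exact continuous_fst
  · exact continuous_snd

lemma continuous_curve : Continuous c.curve :=
  c.continuous_point.comp (continuous_id.prodMk c.lip.continuous)

lemma dist_point_le (p q : ℝ × ℝ) : dist (c.point p) (c.point q) ≤ |p.1 - q.1| + |p.2 - q.2| := by
  have : c.point p - c.point q = c.L.symm !₂[p.1 - q.1, p.2 - q.2] := by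
    rw [point, point, ← map_sub]
    congr 1
    ext i
    fin_cases i <;> rfl
  rw [dist_eq_norm, this, LinearIsometryEquiv.norm_map]
  exact norm_vec_le _ _

lemma lipschitz_curve : LipschitzWith (1 + c.K) c.curve := by
  apply LipschitzWith.of_dist_le_mul
  intro s s'
  refine (c.dist_point_le _ _).trans ?_
  have := c.lip.dist_le_mul s s'
  rw [Real.dist_eq, Real.dist_eq] at this
  push_cast
  rw [add_mul, one_mul, Real.dist_eq]
  exact add_le_add le_rfl this

/-- The first chart coordinate recovers the parameter and does not increase distances. -/
lemma antilipschitz_curve : AntilipschitzWith 1 c.curve := by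
  apply AntilipschitzWith.of_le_mul_dist
  intro s s'
  have h := abs_coord_le_norm (c.L (c.curve s - c.curve s')) 0
  rw [LinearIsometryEquiv.norm_map, ← dist_eq_norm, map_sub, PiLp.sub_apply] at h
  simpa [curve, Real.dist_eq] using h

/-- In the chart, the boundary is the graph. -/
lemma mem_frontier_iff (hΩ : IsOpen Ω) {y : Plane} (hy : y ∈ c.nhd) :
    y ∈ frontier Ω ↔ c.f (c.L y 0) = c.L y 1 := by
  have h0 := c.continuous_coord 0
  have h1 := c.continuous_coord 1
  have hf := c.lip.continuous
  rw [hΩ.frontier_eq, Set.mem_sdiff, c.mem_Ω_iff hy, not_lt]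
  constructor
  · rintro ⟨hcl, hle⟩
    by_contra hne
    have hlt : c.L y 1 < c.f (c.L y 0) := lt_of_le_of_ne hle (Ne.symm hne)
    -- A point strictly below the graph has a whole neighbourhood below it, which misses `Ω`.
    have hU : IsOpen (c.nhd ∩ {z | c.L z 1 < c.f (c.L z 0)}) :=
      c.isOpen_nhd.inter (isOpen_lt h1 (by fun_prop))
    obtain ⟨z, ⟨hz1, hz2⟩, hz3⟩ := mem_closure_iff.1 hcl _ hU ⟨hy, hlt⟩
    exact absurd ((c.mem_Ω_iff hz1).1 hz3) (not_lt.2 (le_of_lt hz2))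
  · intro heq
    refine ⟨?_, heq.ge⟩
    -- Conversely, a point of the graph is approached vertically from above by points of `Ω`.
    have hlim : Tendsto (fun n : ℕ => c.point (c.L y 0, c.L y 1 + 1 / ((n : ℝ) + 1))) atTop
        (𝓝 y) := by
      have h2 : Tendsto (fun n : ℕ => (c.L y 0, c.L y 1 + 1 / ((n : ℝ) + 1))) atTop
          (𝓝 (c.L y 0, c.L y 1 + 0)) :=
        tendsto_const_nhds.prodMk_nhds
          (tendsto_const_nhds.add tendsto_one_div_add_atTop_nhds_zero_nat)
      have h3 := (c.continuous_point.tendsto _).comp h2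
      rwa [add_zero, c.point_eta] at h3
    refine mem_closure_of_tendsto hlim ?_
    filter_upwards [hlim.eventually (c.isOpen_nhd.mem_nhds hy)] with n hn
    rw [c.mem_Ω_iff hn, L_point_zero, L_point_one, heq]
    have : (0 : ℝ) < 1 / ((n : ℝ) + 1) := by positivity
    simpa using this

/-- Over the base, `f` differs from `f s₀` by at most `K a`, so one fixed window `top` lies in every
vertical fibre of `Ω`. The condition `slope` is what makes this window non-empty. -/
lemma top_subset {s : ℝ} (hs : |s - c.s₀| < c.a) : c.top ⊆ Set.Ioo (c.f s) (c.f s + c.h) := by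
  rintro t ⟨h1, h2⟩
  have h := c.lip.dist_le_mul s c.s₀
  rw [Real.dist_eq, Real.dist_eq] at h
  have h' : (c.K : ℝ) * |s - c.s₀| ≤ c.K * c.a := by gcongr
  have := abs_le.1 (h.trans h')
  constructor <;> linarith [this.1, this.2]

lemma core_subset : c.core ⊆ c.nhd ∩ Ω := by
  rintro y ⟨h1, h2⟩
  have h3 := c.top_subset h1 h2
  have h4 : y ∈ c.nhd := ⟨h1, by rw [abs_lt]; constructor <;> linarith [h3.1, h3.2, c.h_pos]⟩
  exact ⟨h4, (c.mem_Ω_iff h4).2 h3.1⟩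

lemma convex_core : Convex ℝ c.core := by
  have : c.core = (fun y => c.L y 0) ⁻¹' Set.Ioo (c.s₀ - c.a) (c.s₀ + c.a) ∩
      (fun y => c.L y 1) ⁻¹' c.top := by
    ext y
    constructor
    · exact fun hy => ⟨c.mem_base.2 hy.1, hy.2⟩
    · exact fun hy => ⟨c.mem_base.1 hy.1, hy.2⟩
  rw [this]
  have hl (i : Fin 2) : IsLinearMap ℝ (fun y => c.L y i) :=
    ⟨fun x y => by simp, fun r x => by simp⟩
  exact ((convex_Ioo _ _).is_linear_preimage (hl 0)).inter
    ((convex_Ioo _ _).is_linear_preimage (hl 1))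

lemma volume_top_pos : 0 < volume c.top := by
  rw [top, Real.volume_Ioo, ENNReal.ofReal_pos]
  linarith [c.slope]

lemma volume_top_ne_top : volume c.top ≠ ⊤ := by
  rw [top, Real.volume_Ioo]; exact ENNReal.ofReal_ne_top

lemma nonempty_core : c.core.Nonempty := by
  have h := c.slope
  refine ⟨c.point (c.s₀, c.f c.s₀ + c.h / 2), by simpa using c.a_pos, ?_⟩
  rw [L_point_one]
  constructor <;> linarith

/-! #### Comparison of arc length with the length of the parameter interval -/

lemma volume_preimage_curve_le (S : Set Plane) :
    volume (c.curve ⁻¹' S) ≤ (Measure.hausdorffMeasure 1 : Measure Plane) S := by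
  have := c.antilipschitz_curve.hausdorffMeasure_preimage_le (d := 1) zero_le_one S
  rwa [hausdorffMeasure_real, ENNReal.coe_one, ENNReal.one_rpow, one_mul] at this

lemma hausdorffMeasure_image_curve_le (S : Set ℝ) :
    (Measure.hausdorffMeasure 1 : Measure Plane) (c.curve '' S) ≤ (1 + c.K : ℝ≥0) * volume S := by
  have := c.lipschitz_curve.hausdorffMeasure_image_le (d := 1) zero_le_one S
  rwa [hausdorffMeasure_real, ENNReal.rpow_one] at this

lemma mem_image_curve (hΩ : IsOpen Ω) {y : Plane} (hy : y ∈ c.nhd ∩ frontier Ω) :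
    c.L y 0 ∈ c.base ∧ c.curve (c.L y 0) = y := by
  refine ⟨c.mem_base.2 hy.1.1, ?_⟩
  rw [curve, (c.mem_frontier_iff hΩ hy.1).1 hy.2, c.point_eta]

lemma curve_mem (hΩ : IsOpen Ω) {s : ℝ} (hs : s ∈ c.base) : c.curve s ∈ c.nhd ∩ frontier Ω := by
  have h : c.curve s ∈ c.nhd := c.point_mem_nhd (c.mem_base.1 hs) (by simpa using c.h_pos)
  exact ⟨h, (c.mem_frontier_iff hΩ h).2 (by simp [curve])⟩

/-- Together with `lintegral_curve_le` this replaces an area formula: a Lipschitz map enlarges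
one-dimensional Hausdorff measure by at most its constant, and on the line that measure is Lebesgue
measure. -/
lemma arcLength_le_map (hΩ : IsOpen Ω) :
    arcLength (c.nhd ∩ frontier Ω) ≤
      ((1 + c.K : ℝ≥0) : ℝ≥0∞) • Measure.map c.curve (volume.restrict c.base) := by
  refine Measure.le_iff.2 fun S hS => ?_
  rw [arcLength, Measure.restrict_apply hS, Measure.smul_apply,
    Measure.map_apply c.continuous_curve.measurable hS,
    Measure.restrict_apply (c.continuous_curve.measurable hS), smul_eq_mul]
  refine (measure_mono ?_).trans (c.hausdorffMeasure_image_curve_le _)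
  rintro y ⟨hyS, hy⟩
  obtain ⟨h1, h2⟩ := c.mem_image_curve hΩ hy
  exact ⟨c.L y 0, ⟨by rwa [Set.mem_preimage, h2], h1⟩, h2⟩

lemma arcLength_nhd_lt_top (hΩ : IsOpen Ω) : arcLength (frontier Ω) c.nhd < ⊤ := by
  rw [arcLength, Measure.restrict_apply c.isOpen_nhd.measurableSet]
  refine lt_of_le_of_lt (measure_mono fun y hy => ?_) (lt_of_le_of_lt
    (c.hausdorffMeasure_image_curve_le c.base) (ENNReal.mul_lt_top ENNReal.coe_lt_top
      (by rw [base, Real.volume_Ioo]; exact ENNReal.ofReal_lt_top)))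
  obtain ⟨h1, h2⟩ := c.mem_image_curve hΩ hy
  exact ⟨_, h1, h2⟩

lemma lintegral_curve_le {F : Plane → ℝ≥0∞} (hF : Measurable F) {S : Set Plane}
    (hS : MeasurableSet S) :
    ∫⁻ s in c.curve ⁻¹' S, F (c.curve s) ≤ ∫⁻ y, F y ∂arcLength S := by
  rw [← setLIntegral_map hS hF c.continuous_curve.measurable]
  refine lintegral_mono' (Measure.restrict_mono le_rfl ?_) le_rfl
  refine Measure.le_iff.2 fun T hT => ?_
  rw [Measure.map_apply c.continuous_curve.measurable hT]
  exact c.volume_preimage_curve_le T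

end GraphChart

lemma HasLipschitzBoundary.exists_chart {Ω : Set Plane} (hL : HasLipschitzBoundary Ω)
    (hΩ : IsOpen Ω) {x : Plane} (hx : x ∈ frontier Ω) : ∃ c : GraphChart Ω, x ∈ c.nhd := by
  obtain ⟨L, f, K, r, hf, hr, hiff⟩ := hL x hx
  -- The centre lies on the graph: not above it, since it is outside the open set `Ω`, and not
  -- strictly below it, since it is in the closure.
  have hfx : f (L x 0) = L x 1 := by
    have hxΩ : x ∉ Ω := by
      rw [hΩ.frontier_eq] at hx
      exact hx.2
    have h1 : L x 1 ≤ f (L x 0) := by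
      rw [hiff x (Metric.mem_ball_self hr)] at hxΩ
      exact not_lt.1 hxΩ
    refine le_antisymm ?_ h1
    have hc0 : Continuous fun y : Plane => L y 0 :=
      (EuclideanSpace.proj 0 : Plane →L[ℝ] ℝ).continuous.comp L.continuous
    have hc1 : Continuous fun y : Plane => L y 1 :=
      (EuclideanSpace.proj 1 : Plane →L[ℝ] ℝ).continuous.comp L.continuous
    have hcf := hf.continuous
    by_contra! hlt
    have hU : IsOpen (Metric.ball x r ∩ {z : Plane | L z 1 < f (L z 0)}) :=
      Metric.isOpen_ball.inter (isOpen_lt hc1 (by fun_prop))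
    obtain ⟨z, ⟨hz1, hz2⟩, hz3⟩ := mem_closure_iff.1 (frontier_subset_closure hx) _ hU
      ⟨Metric.mem_ball_self hr, hlt⟩
    exact absurd ((hiff z hz1).1 hz3) (not_lt.2 (le_of_lt hz2))
  have hK : (0 : ℝ) < 1 + K := by positivity
  have ha : 0 < r / (8 * (1 + K)) := by positivity
  have hKa : K * (r / (8 * (1 + K))) ≤ r / 8 := by
    rw [mul_div_assoc', div_le_div_iff₀ (by positivity) (by positivity)]
    nlinarith [K.coe_nonneg]
  have ha8 : r / (8 * (1 + K)) ≤ r / 8 := by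
    apply div_le_div_of_nonneg_left hr.le (by norm_num)
    linarith [K.coe_nonneg]
  -- With this half-width both `a` and `K a` are at most `r / 8`. The chart region stays in the ball
  -- because `a + h + K a ≤ 3r / 4 < r`, and `2 K a ≤ r / 4 < h`.
  refine ⟨⟨L, f, K, L x 0, r / (8 * (1 + K)), r / 2, hf, ha, by positivity, by linarith, ?_⟩, ?_⟩
  · intro s t hs ht
    have hb : L.symm !₂[s, t] ∈ Metric.ball x r := by
      have e : L.symm !₂[s, t] - x = L.symm !₂[s - L x 0, t - L x 1] := by
        apply L.injective
        rw [map_sub, L.apply_symm_apply, L.apply_symm_apply]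
        ext i
        fin_cases i <;> rfl
      rw [Metric.mem_ball, dist_eq_norm, e, LinearIsometryEquiv.norm_map]
      refine (norm_vec_le _ _).trans_lt ?_
      have h1 := hf.dist_le_mul s (L x 0)
      rw [Real.dist_eq, Real.dist_eq] at h1
      have h2 : (K : ℝ) * |s - L x 0| ≤ K * (r / (8 * (1 + K))) := by gcongr
      have h3 : |t - L x 1| ≤ |t - f s| + |f s - f (L x 0)| := by
        rw [← hfx]; exact abs_sub_le _ _ _
      linarith
    rw [hiff _ hb]
    simp
  · constructor
    · simpa using ha
    · simp only [hfx, sub_self, abs_zero]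
      positivity

/-- The constant is explicit in `v`, `A`, `B` alone, so it can be fixed by unification before the
test function is introduced, which gives the required uniformity. -/
lemma ennreal_le_const_mul_add {v A B X I J : ℝ≥0∞} (hv : v ≠ 0) (hv' : v ≠ ⊤) (hA : A ≠ ⊤)
    (hB : B ≠ ⊤) (h : v * X ≤ A * I + B * J) :
    X ≤ ((v⁻¹ * (A + B)).toNNReal : ℝ≥0) * (I + J) := by
  have hC : v⁻¹ * (A + B) ≠ ⊤ :=
    ENNReal.mul_ne_top (ENNReal.inv_ne_top.2 hv) (ENNReal.add_ne_top.2 ⟨hA, hB⟩)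
  rw [ENNReal.coe_toNNReal hC]
  calc X = v⁻¹ * (v * X) := by rw [← mul_assoc, ENNReal.inv_mul_cancel hv hv', one_mul]
    _ ≤ v⁻¹ * (A * I + B * J) := by gcongr
    _ ≤ v⁻¹ * (A * (I + J) + B * (I + J)) := by
        gcongr
        · exact le_self_add
        · exact le_add_self
    _ = _ := by ring

lemma measurable_enorm_sq {X : Type*} [TopologicalSpace X] [MeasurableSpace X]
    [OpensMeasurableSpace X] {φ : X → ℂ} (hφ : Continuous φ) : Measurable fun y => ‖φ y‖ₑ ^ 2 :=
  hφ.enorm.measurable.pow_const 2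

namespace GraphChart

variable {Ω : Set Plane} (c : GraphChart Ω)

/-! #### Integration along the vertical lines of a chart -/

/-- Tonelli in chart coordinates, for sets described fibre by fibre; the chart is an isometry, so
there is no Jacobian. -/
lemma setLIntegral_eq {S : Set Plane} (hS : MeasurableSet S) {A : Set ℝ} (hA : MeasurableSet A)
    {J : ℝ → Set ℝ} (hJ : ∀ s, MeasurableSet (J s))
    (h : ∀ s t, c.point (s, t) ∈ S ↔ s ∈ A ∧ t ∈ J s) {F : Plane → ℝ≥0∞} (hF : Measurable F) :
    ∫⁻ y in S, F y = ∫⁻ s in A, ∫⁻ t in J s, F (c.point (s, t)) := by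
  rw [← lintegral_indicator hS,
    ← c.measurePreserving_point.lintegral_comp (hF.indicator hS), Measure.volume_eq_prod,
    lintegral_prod (fun p => S.indicator F (c.point p))
      ((hF.indicator hS).comp c.measurable_point).aemeasurable,
    ← lintegral_indicator hA]
  refine lintegral_congr fun s => ?_
  by_cases hs : s ∈ A
  · rw [Set.indicator_of_mem hs, ← lintegral_indicator (hJ s)]
    refine lintegral_congr fun t => ?_
    by_cases ht : t ∈ J s
    · rw [Set.indicator_of_mem ((h s t).2 ⟨hs, ht⟩), Set.indicator_of_mem ht]
    · rw [Set.indicator_of_notMem (fun h' => ht ((h s t).1 h').2), Set.indicator_of_notMem ht]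
  · rw [Set.indicator_of_notMem hs]
    simp only [Set.indicator_of_notMem (fun h' => hs ((h s _).1 h').1), lintegral_zero]

lemma measurableSet_base : MeasurableSet c.base := measurableSet_Ioo

lemma measurableSet_top : MeasurableSet c.top := measurableSet_Ioo

lemma point_mem_nhd_inter_iff (s t : ℝ) :
    c.point (s, t) ∈ c.nhd ∩ Ω ↔ s ∈ c.base ∧ t ∈ Set.Ioo (c.f s) (c.f s + c.h) := by
  rw [c.mem_base]
  constructor
  · rintro ⟨h1, h2⟩
    rw [c.mem_Ω_iff h1] at h2
    have h3 := h1.1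
    have h4 := h1.2
    simp only [L_point_zero, L_point_one] at h2 h3 h4
    exact ⟨h3, h2, by linarith [(abs_lt.1 h4).2]⟩
  · rintro ⟨h1, h2, h3⟩
    have h4 : c.point (s, t) ∈ c.nhd :=
      c.point_mem_nhd h1 (by rw [abs_lt]; constructor <;> linarith [c.h_pos])
    refine ⟨h4, (c.mem_Ω_iff h4).2 (by simpa using h2)⟩

lemma point_mem_core_iff (s t : ℝ) : c.point (s, t) ∈ c.core ↔ s ∈ c.base ∧ t ∈ c.top := by
  rw [c.mem_base]
  simp [core, top]

/-- The energy of `φ` along the vertical segment over `s`. -/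
def fiberEnergy (φ : Plane → ℂ) (s : ℝ) : ℝ≥0∞ :=
  ∫⁻ t in Set.Ioo (c.f s) (c.f s + c.h), ‖fderiv ℝ φ (c.point (s, t))‖ₑ ^ 2

lemma lintegral_fiberEnergy (hΩ : IsOpen Ω) {φ : Plane → ℂ} (hφ : ContDiff ℝ 1 φ) :
    ∫⁻ s in c.base, c.fiberEnergy φ s = ∫⁻ y in c.nhd ∩ Ω, ‖fderiv ℝ φ y‖ₑ ^ 2 :=
  (c.setLIntegral_eq (c.isOpen_nhd.inter hΩ).measurableSet c.measurableSet_base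
    (fun _ => measurableSet_Ioo) c.point_mem_nhd_inter_iff (measurable_enorm_fderiv_sq hφ)).symm

lemma hasDerivAt_point (s t : ℝ) :
    HasDerivAt (fun t => c.point (s, t)) (c.L.symm !₂[0, 1]) t := by
  have e : (fun t => c.point (s, t)) = fun t => c.point (s, 0) + t • c.L.symm !₂[0, 1] := by
    ext1 t
    rw [point, point, ← map_smul, ← map_add]
    congr 1
    ext i
    fin_cases i <;> simp
  rw [e]
  have := ((hasDerivAt_id t).smul_const (c.L.symm !₂[(0 : ℝ), 1])).const_add (c.point (s, 0))
  rwa [one_smul] at this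

lemma contDiff_point (s : ℝ) : ContDiff ℝ 1 fun t => c.point (s, t) := by
  rw [contDiff_one_iff_deriv]
  refine ⟨fun t => (c.hasDerivAt_point s t).differentiableAt, ?_⟩
  rw [show deriv (fun t => c.point (s, t)) = fun _ => c.L.symm !₂[0, 1] from
    funext fun t => (c.hasDerivAt_point s t).deriv]
  exact continuous_const

/-- The one-dimensional estimate on a single fibre. The closed interval includes the graph point `t
= f s`, so the same bound serves interior and boundary values. -/
lemma vertical_estimate {φ : Plane → ℂ} (hφ : ContDiff ℝ 1 φ) {s t τ : ℝ}
    (ht : t ∈ Set.Icc (c.f s) (c.f s + c.h)) (hτ : τ ∈ Set.Icc (c.f s) (c.f s + c.h)) :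
    ‖φ (c.point (s, t))‖ₑ ^ 2 ≤
      2 * ‖φ (c.point (s, τ))‖ₑ ^ 2 + 2 * (ENNReal.ofReal c.h * c.fiberEnergy φ s) := by
  refine (enorm_sq_le _ (φ (c.point (s, τ)))).trans (add_le_add le_rfl (mul_le_mul_right ?_ _))
  have h := enorm_sub_sq_le_lintegral_deriv (hφ.comp (c.contDiff_point s)) ht hτ
  rw [add_sub_cancel_left] at h
  refine h.trans (mul_le_mul_right (lintegral_mono fun t => ?_) _)
  have hd : HasDerivAt (φ ∘ fun t => c.point (s, t))
      (fderiv ℝ φ (c.point (s, t)) (c.L.symm !₂[0, 1])) t :=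
    ((hφ.differentiable one_ne_zero _).hasFDerivAt).comp_hasDerivAt t (c.hasDerivAt_point s t)
  rw [hd.deriv]
  refine pow_le_pow_left' ((ContinuousLinearMap.le_opENorm _ _).trans (le_of_eq ?_)) 2
  have : ‖c.L.symm !₂[(0 : ℝ), 1]‖ₑ = 1 := by
    rw [← ofReal_norm, LinearIsometryEquiv.norm_map, EuclideanSpace.norm_eq, Fin.sum_univ_two]
    simp
  rw [this, mul_one]

lemma measurable_enorm_point {φ : Plane → ℂ} (hφ : Continuous φ) :
    Measurable fun p : ℝ × ℝ => ‖φ (c.point p)‖ₑ ^ 2 :=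
  measurable_enorm_sq (hφ.comp c.continuous_point)

/-- Averaging `vertical_estimate` over `τ` in the window, so that the reference value is replaced by
an `L²` norm over the part of the core above `s`. -/
lemma vertical_average {φ : Plane → ℂ} (hφ : ContDiff ℝ 1 φ) {s t : ℝ} (hs : s ∈ c.base)
    (ht : t ∈ Set.Icc (c.f s) (c.f s + c.h)) :
    volume c.top * ‖φ (c.point (s, t))‖ₑ ^ 2 ≤
      2 * (∫⁻ τ in c.top, ‖φ (c.point (s, τ))‖ₑ ^ 2) +
        volume c.top * (2 * (ENNReal.ofReal c.h * c.fiberEnergy φ s)) := by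
  have hm : Measurable fun τ : ℝ => ‖φ (c.point (s, τ))‖ₑ ^ 2 :=
    (c.measurable_enorm_point hφ.continuous).comp measurable_prodMk_left
  calc volume c.top * ‖φ (c.point (s, t))‖ₑ ^ 2
      = ∫⁻ _ in c.top, ‖φ (c.point (s, t))‖ₑ ^ 2 := by rw [setLIntegral_const, mul_comm]
    _ ≤ ∫⁻ τ in c.top, (2 * ‖φ (c.point (s, τ))‖ₑ ^ 2 +
          2 * (ENNReal.ofReal c.h * c.fiberEnergy φ s)) :=
        setLIntegral_mono' c.measurableSet_top fun τ hτ =>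
          c.vertical_estimate hφ ht (Set.Ioo_subset_Icc_self (c.top_subset (c.mem_base.1 hs) hτ))
    _ = _ := by
        rw [lintegral_add_left (hm.const_mul _), lintegral_const_mul _ hm, setLIntegral_const,
          mul_comm (volume c.top)]

lemma lintegral_core {φ : Plane → ℂ} (hφ : ContDiff ℝ 1 φ) :
    ∫⁻ y in c.core, ‖φ y‖ₑ ^ 2 =
      ∫⁻ s in c.base, ∫⁻ τ in c.top, ‖φ (c.point (s, τ))‖ₑ ^ 2 :=
  c.setLIntegral_eq c.isOpen_core.measurableSet c.measurableSet_base
    (fun _ => c.measurableSet_top) c.point_mem_core_iff (measurable_enorm_sq hφ.continuous)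

/-- The right-hand side of `vertical_average`, integrated over the base. It does not involve `t`, so
it bounds both the bulk integral near the boundary and the boundary integral. -/
lemma lintegral_base_average (hΩ : IsOpen Ω) {φ : Plane → ℂ} (hφ : ContDiff ℝ 1 φ) :
    ∫⁻ s in c.base, (2 * (∫⁻ τ in c.top, ‖φ (c.point (s, τ))‖ₑ ^ 2) +
        volume c.top * (2 * (ENNReal.ofReal c.h * c.fiberEnergy φ s))) ≤
      2 * (∫⁻ y in c.core, ‖φ y‖ₑ ^ 2) +
        volume c.top * (2 * ENNReal.ofReal c.h) * ∫⁻ y in Ω, ‖fderiv ℝ φ y‖ₑ ^ 2 := by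
  have hm : Measurable fun s : ℝ => ∫⁻ τ in c.top, ‖φ (c.point (s, τ))‖ₑ ^ 2 :=
    (c.measurable_enorm_point hφ.continuous).lintegral_prod_right'
  rw [lintegral_add_left (hm.const_mul _), lintegral_const_mul _ hm, ← c.lintegral_core hφ]
  refine add_le_add le_rfl ?_
  simp only [← mul_assoc]
  rw [lintegral_const_mul' _ _ (by have := c.volume_top_ne_top; finiteness),
    c.lintegral_fiberEnergy hΩ hφ]
  gcongr
  exact Set.inter_subset_right

/-- Near a boundary point, the `L²` norm is controlled by the `L²` norm on the core and the
gradient. -/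
theorem exists_lintegral_nhd_le (hΩ : IsOpen Ω) :
    ∃ C : ℝ≥0, ∀ φ : Plane → ℂ, ContDiff ℝ 1 φ →
      ∫⁻ y in c.nhd ∩ Ω, ‖φ y‖ₑ ^ 2 ≤
        C * ((∫⁻ y in c.core, ‖φ y‖ₑ ^ 2) + ∫⁻ y in Ω, ‖fderiv ℝ φ y‖ₑ ^ 2) := by
  have htop := c.volume_top_ne_top
  refine ⟨_, fun φ hφ => ennreal_le_const_mul_add c.volume_top_pos.ne' htop
    (A := ENNReal.ofReal c.h * 2) (by finiteness)
    (B := ENNReal.ofReal c.h * (volume c.top * (2 * ENNReal.ofReal c.h))) (by finiteness) ?_⟩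
  rw [c.setLIntegral_eq (c.isOpen_nhd.inter hΩ).measurableSet c.measurableSet_base
    (fun _ => measurableSet_Ioo) c.point_mem_nhd_inter_iff (measurable_enorm_sq hφ.continuous),
    ← lintegral_const_mul' _ _ htop, mul_assoc, mul_assoc, ← mul_add]
  refine le_trans ?_ (mul_le_mul_right (c.lintegral_base_average hΩ hφ) _)
  rw [← lintegral_const_mul' _ _ ENNReal.ofReal_ne_top]
  refine setLIntegral_mono' c.measurableSet_base fun s hs => ?_
  rw [← lintegral_const_mul' _ _ htop]
  refine (setLIntegral_mono' measurableSet_Ioo fun t ht =>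
    c.vertical_average hφ hs (Set.Ioo_subset_Icc_self ht)).trans (le_of_eq ?_)
  rw [setLIntegral_const, Real.volume_Ioo, add_sub_cancel_left, mul_comm]

/-- Near a boundary point, the `L²` norm on the boundary is controlled by the `L²` norm on the core
and the gradient. -/
theorem exists_lintegral_boundary_le (hΩ : IsOpen Ω) :
    ∃ C : ℝ≥0, ∀ φ : Plane → ℂ, ContDiff ℝ 1 φ →
      ∫⁻ y, ‖φ y‖ₑ ^ 2 ∂arcLength (c.nhd ∩ frontier Ω) ≤
        C * ((∫⁻ y in c.core, ‖φ y‖ₑ ^ 2) + ∫⁻ y in Ω, ‖fderiv ℝ φ y‖ₑ ^ 2) := by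
  have htop := c.volume_top_ne_top
  have hm {φ : Plane → ℂ} (hφ : ContDiff ℝ 1 φ) : Measurable fun y => ‖φ y‖ₑ ^ 2 :=
    (measurable_enorm_sq hφ.continuous)
  refine ⟨_, fun φ hφ => ennreal_le_const_mul_add c.volume_top_pos.ne' htop
    (A := ((1 + c.K : ℝ≥0) : ℝ≥0∞) * 2) (by finiteness)
    (B := ((1 + c.K : ℝ≥0) : ℝ≥0∞) * (volume c.top * (2 * ENNReal.ofReal c.h)))
      (by finiteness) ?_⟩
  rw [mul_assoc, mul_assoc, ← mul_add]
  refine (mul_le_mul_right (lintegral_mono' (c.arcLength_le_map hΩ) le_rfl) _).trans ?_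
  rw [lintegral_smul_measure, smul_eq_mul, ← mul_assoc, mul_comm (volume c.top), mul_assoc,
    lintegral_map (hm hφ) c.continuous_curve.measurable, ← lintegral_const_mul' _ _ htop]
  refine mul_le_mul_right (le_trans ?_ (c.lintegral_base_average hΩ hφ)) _
  refine setLIntegral_mono' c.measurableSet_base fun s hs => c.vertical_average hφ hs ?_
  exact ⟨le_rfl, by linarith [c.h_pos]⟩

/-- If a piece of the boundary of positive length lies in the chart, then the `L²` norm on some
subset of the core of positive measure is controlled by this piece and the gradient. -/
theorem exists_subset_core_lintegral_le (hΩ : IsOpen Ω) {Γ : Set Plane} (hΓ : IsClosed Γ)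
    (hsub : Γ ⊆ frontier Ω) (hpos : arcLength Γ c.nhd ≠ 0) :
    ∃ b ⊆ c.core, volume b ≠ 0 ∧ ∃ C : ℝ≥0, ∀ φ : Plane → ℂ, ContDiff ℝ 1 φ →
      ∫⁻ y in b, ‖φ y‖ₑ ^ 2 ≤
        C * ((∫⁻ y, ‖φ y‖ₑ ^ 2 ∂arcLength Γ) + ∫⁻ y in Ω, ‖fderiv ℝ φ y‖ₑ ^ 2) := by
  have htop := c.volume_top_ne_top
  set A : Set ℝ := c.base ∩ c.curve ⁻¹' Γ with hA
  have hAm : MeasurableSet A :=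
    c.measurableSet_base.inter (hΓ.preimage c.continuous_curve).measurableSet
  have hApos : volume A ≠ 0 := by
    intro h0
    -- If the set of parameters were null, its image under the Lipschitz curve would have zero
    -- length, and this image covers the part of `Γ` in the chart.
    apply hpos
    rw [arcLength, Measure.restrict_apply c.isOpen_nhd.measurableSet]
    refine le_antisymm ((measure_mono ?_).trans
      ((c.hausdorffMeasure_image_curve_le A).trans (by rw [h0, mul_zero]))) bot_le
    rintro y ⟨hy1, hy2⟩
    obtain ⟨h1, h2⟩ := c.mem_image_curve hΩ ⟨hy1, hsub hy2⟩
    exact ⟨_, ⟨h1, by rwa [Set.mem_preimage, h2]⟩, h2⟩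
  -- The part of the core lying above `Γ`: there every point is joined to `Γ` by a vertical segment.
  set b : Set Plane := c.core ∩ (fun y => c.L y 0) ⁻¹' A with hb
  have hbm : MeasurableSet b :=
    c.isOpen_core.measurableSet.inter ((c.continuous_coord 0).measurable hAm)
  have hbmem : ∀ s t, c.point (s, t) ∈ b ↔ s ∈ A ∧ t ∈ c.top := by
    intro s t
    rw [hb, Set.mem_inter_iff, c.point_mem_core_iff, Set.mem_preimage, L_point_zero]
    exact ⟨fun h => ⟨h.2, h.1.2⟩, fun h => ⟨⟨h.1.1, h.2⟩, h.1⟩⟩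
  refine ⟨b, Set.inter_subset_left, ?_, _, fun φ hφ => ennreal_le_const_mul_add (v := 1) one_ne_zero
    ENNReal.one_ne_top (A := volume c.top * 2) (by finiteness)
    (B := volume c.top * (2 * ENNReal.ofReal c.h)) (by finiteness) ?_⟩
  · have := c.setLIntegral_eq hbm hAm (fun _ => c.measurableSet_top) hbmem (F := fun _ => 1)
      measurable_const
    simp only [setLIntegral_const, one_mul] at this
    rw [this]
    exact mul_ne_zero c.volume_top_pos.ne' hApos
  · have hm : Measurable fun y => ‖φ y‖ₑ ^ 2 := (measurable_enorm_sq hφ.continuous)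
    rw [one_mul, c.setLIntegral_eq hbm hAm (fun _ => c.measurableSet_top) hbmem hm]
    calc ∫⁻ s in A, ∫⁻ t in c.top, ‖φ (c.point (s, t))‖ₑ ^ 2
        ≤ ∫⁻ s in A, ∫⁻ _ in c.top, (2 * ‖φ (c.curve s)‖ₑ ^ 2 +
            2 * (ENNReal.ofReal c.h * c.fiberEnergy φ s)) := by
          refine setLIntegral_mono' hAm fun s hs => setLIntegral_mono' c.measurableSet_top
            fun t ht => c.vertical_estimate hφ ?_ ⟨le_rfl, by linarith [c.h_pos]⟩
          exact Set.Ioo_subset_Icc_self (c.top_subset (c.mem_base.1 hs.1) ht)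
      _ = volume c.top * ∫⁻ s in A, (2 * ‖φ (c.curve s)‖ₑ ^ 2 +
            2 * (ENNReal.ofReal c.h * c.fiberEnergy φ s)) := by
          simp only [setLIntegral_const]
          rw [lintegral_mul_const' _ _ htop, mul_comm]
      _ = volume c.top * (2 * (∫⁻ s in A, ‖φ (c.curve s)‖ₑ ^ 2) +
            2 * ENNReal.ofReal c.h * ∫⁻ s in A, c.fiberEnergy φ s) := by
          have hm' : Measurable fun s => ‖φ (c.curve s)‖ₑ ^ 2 :=
            hm.comp c.continuous_curve.measurable
          rw [lintegral_add_left (hm'.const_mul _), lintegral_const_mul _ hm']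
          simp only [← mul_assoc]
          rw [lintegral_const_mul' _ _ (by finiteness)]
      _ ≤ volume c.top * (2 * (∫⁻ y, ‖φ y‖ₑ ^ 2 ∂arcLength Γ) +
            2 * ENNReal.ofReal c.h * ∫⁻ y in Ω, ‖fderiv ℝ φ y‖ₑ ^ 2) := by
          refine mul_le_mul_right (add_le_add (mul_le_mul_right ?_ _) (mul_le_mul_right ?_ _)) _
          · exact (lintegral_mono_set Set.inter_subset_right).trans
              (c.lintegral_curve_le hm hΓ.measurableSet)
          · refine (lintegral_mono_set Set.inter_subset_left).trans ?_
            rw [c.lintegral_fiberEnergy hΩ hφ]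
            exact lintegral_mono_set Set.inter_subset_right
      _ = _ := by ring

end GraphChart

/-! ### The Poincaré and trace inequalities for `C¹` functions -/

/-- The `L²` norm on the boundary part `Γ` together with the Dirichlet energy. -/
def energy (Ω Γ : Set Plane) (φ : Plane → ℂ) : ℝ≥0∞ :=
  (∫⁻ y, ‖φ y‖ₑ ^ 2 ∂arcLength Γ) + ∫⁻ y in Ω, ‖fderiv ℝ φ y‖ₑ ^ 2

/-- The `L²(S)` norm of `C¹` functions is controlled by `energy Ω Γ`. -/
def Controlled (Ω Γ S : Set Plane) : Prop :=
  ∃ C : ℝ≥0, ∀ φ : Plane → ℂ, ContDiff ℝ 1 φ → ∫⁻ y in S, ‖φ y‖ₑ ^ 2 ≤ C * energy Ω Γ φ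

lemma lintegral_fderiv_le_energy (Ω Γ : Set Plane) (φ : Plane → ℂ) :
    ∫⁻ y in Ω, ‖fderiv ℝ φ y‖ₑ ^ 2 ≤ energy Ω Γ φ := le_add_self

lemma Controlled.mono {Ω Γ S T : Set Plane} (h : Controlled Ω Γ T) (hST : S ⊆ T) :
    Controlled Ω Γ S := by
  obtain ⟨C, hC⟩ := h
  exact ⟨C, fun φ hφ => (lintegral_mono_set hST).trans (hC φ hφ)⟩

lemma Controlled.union {Ω Γ S T : Set Plane} (hS : Controlled Ω Γ S) (hT : Controlled Ω Γ T) :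
    Controlled Ω Γ (S ∪ T) := by
  obtain ⟨C, hC⟩ := hS
  obtain ⟨C', hC'⟩ := hT
  refine ⟨C + C', fun φ hφ => (lintegral_union_le _ _ _).trans ?_⟩
  rw [ENNReal.coe_add, add_mul]
  exact add_le_add (hC φ hφ) (hC' φ hφ)

lemma Controlled.of_core {Ω Γ b S : Set Plane} (hb : Controlled Ω Γ b)
    (h : ∃ C : ℝ≥0, ∀ φ : Plane → ℂ, ContDiff ℝ 1 φ → ∫⁻ y in S, ‖φ y‖ₑ ^ 2 ≤
      C * ((∫⁻ y in b, ‖φ y‖ₑ ^ 2) + ∫⁻ y in Ω, ‖fderiv ℝ φ y‖ₑ ^ 2)) :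
    Controlled Ω Γ S := by
  obtain ⟨C, hC⟩ := hb
  obtain ⟨C', hC'⟩ := h
  refine ⟨C' * (C + 1), fun φ hφ => (hC' φ hφ).trans ?_⟩
  rw [ENNReal.coe_mul, mul_assoc, ENNReal.coe_add, add_mul, ENNReal.coe_one, one_mul]
  exact mul_le_mul_right (add_le_add (hC φ hφ) (lintegral_fderiv_le_energy _ _ _)) _

lemma Controlled.of_convex {Ω Γ b B : Set Plane} (hb : Controlled Ω Γ b) (hB : Convex ℝ B)
    (hm : MeasurableSet B) (hbd : Bornology.IsBounded B) (hBΩ : B ⊆ Ω) (hbB : b ⊆ B)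
    (hpos : volume b ≠ 0) : Controlled Ω Γ B := by
  refine hb.of_core ?_
  obtain ⟨C, hC⟩ := Convex.exists_lintegral_sq_le hB hm hbd hbB hpos
  exact ⟨C, fun φ hφ => (hC φ hφ).trans
    (mul_le_mul_right (add_le_add le_rfl (lintegral_mono_set hBΩ)) _)⟩

lemma IsPolygonalDomain.isCompact_frontier {Ω : Set Plane} (hΩ : IsPolygonalDomain Ω) :
    IsCompact (frontier Ω) :=
  hΩ.isBounded.isCompact_closure.of_isClosed_subset isClosed_frontier frontier_subset_closure

lemma IsPolygonalDomain.arcLength_lt_top {Ω : Set Plane} (hΩ : IsPolygonalDomain Ω) :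
    arcLength (frontier Ω) Set.univ < ⊤ := by
  rw [arcLength, Measure.restrict_apply_univ, ← Measure.restrict_apply_self]
  refine hΩ.isCompact_frontier.measure_lt_top_of_nhdsWithin fun x hx => ?_
  obtain ⟨c, hc⟩ := hΩ.lipschitz.exists_chart hΩ.isOpen hx
  exact ⟨c.nhd, mem_nhdsWithin_of_mem_nhds (c.isOpen_nhd.mem_nhds hc),
    c.arcLength_nhd_lt_top hΩ.isOpen⟩

lemma exists_chart_of_arcLength_pos {Ω : Set Plane} (hΩ : IsPolygonalDomain Ω) {Γ : Set Plane}
    (hsub : Γ ⊆ frontier Ω) (hpos : 0 < arcLength Γ Set.univ) :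
    ∃ c : GraphChart Ω, arcLength Γ c.nhd ≠ 0 := by
  by_contra! h
  refine hpos.ne' ?_
  rw [arcLength, Measure.restrict_apply_univ, ← Measure.restrict_apply_self]
  refine measure_null_of_locally_null _ fun x hx => ?_
  obtain ⟨c, hc⟩ := hΩ.lipschitz.exists_chart hΩ.isOpen (hsub hx)
  exact ⟨c.nhd, mem_nhdsWithin_of_mem_nhds (c.isOpen_nhd.mem_nhds hc), h c⟩

lemma GraphChart.isBounded_core {Ω : Set Plane} (c : GraphChart Ω)
    (hb : Bornology.IsBounded Ω) : Bornology.IsBounded c.core :=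
  hb.subset (c.core_subset.trans Set.inter_subset_right)

lemma exists_controlled_core {Ω : Set Plane} (hΩ : IsPolygonalDomain Ω) {Γ : Set Plane}
    (hΓ : IsClosed Γ) (hsub : Γ ⊆ frontier Ω) (hpos : 0 < arcLength Γ Set.univ) :
    ∃ c : GraphChart Ω, Controlled Ω Γ c.core := by
  obtain ⟨c, hc⟩ := exists_chart_of_arcLength_pos hΩ hsub hpos
  obtain ⟨b, hb, hb0, hbC⟩ := c.exists_subset_core_lintegral_le hΩ.isOpen hΓ hsub hc
  refine ⟨c, Controlled.of_convex (b := b) hbC c.convex_core c.isOpen_core.measurableSet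
    (c.isBounded_core hΩ.isBounded) (c.core_subset.trans Set.inter_subset_right) hb hb0⟩

/-- Control propagates along the connected set `Ω`. -/
lemma exists_controlled_ball {Ω : Set Plane} (hΩ : IsPolygonalDomain Ω) {Γ : Set Plane}
    (hΓ : IsClosed Γ) (hsub : Γ ⊆ frontier Ω) (hpos : 0 < arcLength Γ Set.univ) {x : Plane}
    (hx : x ∈ Ω) : ∃ r > 0, Controlled Ω Γ (Metric.ball x r) := by
  set S : Set Plane := {x | ∃ r > 0, Controlled Ω Γ (Metric.ball x r)} with hS
  have hmem : ∀ {U : Set Plane}, IsOpen U → Controlled Ω Γ U → U ⊆ S := by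
    intro U hU hC y hy
    obtain ⟨r, hr, hrU⟩ := Metric.isOpen_iff.1 hU y hy
    exact ⟨r, hr, hC.mono hrU⟩
  have hopen : IsOpen S := by
    refine isOpen_iff_forall_mem_open.2 fun y ⟨r, hr, hC⟩ => ?_
    exact ⟨_, hmem Metric.isOpen_ball hC, Metric.isOpen_ball, Metric.mem_ball_self hr⟩
  obtain ⟨c, hc⟩ := exists_controlled_core hΩ hΓ hsub hpos
  obtain ⟨z, hz⟩ := c.nonempty_core
  -- It remains to see that `S` is closed relative to `Ω`. A ball in `Ω` around a limit point
  -- overlaps some controlled ball in a non-empty open set, and the convex Poincaré inequality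
  -- extends control from the overlap to the whole ball.
  refine hΩ.isConnected.isPreconnected.subset_of_closure_inter_subset hopen
    ⟨z, (c.core_subset hz).2, hmem c.isOpen_core hc hz⟩ ?_ hx
  rintro y ⟨hycl, hyΩ⟩
  obtain ⟨r, hr, hrΩ⟩ := Metric.isOpen_iff.1 hΩ.isOpen y hyΩ
  obtain ⟨y', hy', r', hr', hC'⟩ := mem_closure_iff.1 hycl _ Metric.isOpen_ball
    (Metric.mem_ball_self hr)
  refine ⟨r, hr, (hC'.mono (Set.inter_subset_left (t := Metric.ball y r))).of_convex
    (convex_ball _ _) measurableSet_ball Metric.isBounded_ball hrΩ Set.inter_subset_right ?_⟩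
  exact ((Metric.isOpen_ball.inter Metric.isOpen_ball).measure_pos _
    ⟨y', Metric.mem_ball_self hr', hy'⟩).ne'

/-- The Poincaré (Friedrichs) inequality for `C¹` functions. -/
theorem controlled_self {Ω : Set Plane} (hΩ : IsPolygonalDomain Ω) {Γ : Set Plane}
    (hΓ : IsClosed Γ) (hsub : Γ ⊆ frontier Ω) (hpos : 0 < arcLength Γ Set.univ) :
    Controlled Ω Γ Ω := by
  have h : Controlled Ω Γ (closure Ω ∩ Ω) := by
    -- Compactness of the closure leaves finitely many neighbourhoods: balls at interior points,
    -- charts at boundary points.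
    refine hΩ.isBounded.isCompact_closure.induction_on
      (p := fun t => Controlled Ω Γ (t ∩ Ω)) ?_ ?_ ?_ ?_
    · exact ⟨0, fun φ _ => by simp⟩
    · exact fun s t hst ht => ht.mono (Set.inter_subset_inter_left _ hst)
    · intro s t hs ht
      rw [Set.union_inter_distrib_right]
      exact hs.union ht
    · intro x hx
      by_cases hxΩ : x ∈ Ω
      · obtain ⟨r, hr, hC⟩ := exists_controlled_ball hΩ hΓ hsub hpos hxΩ
        exact ⟨_, mem_nhdsWithin_of_mem_nhds (Metric.ball_mem_nhds x hr),
          hC.mono Set.inter_subset_left⟩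
      · have hxf : x ∈ frontier Ω := by
          rw [hΩ.isOpen.frontier_eq]
          exact ⟨hx, hxΩ⟩
        obtain ⟨c, hc⟩ := hΩ.lipschitz.exists_chart hΩ.isOpen hxf
        refine ⟨c.nhd, mem_nhdsWithin_of_mem_nhds (c.isOpen_nhd.mem_nhds hc),
          Controlled.of_core ?_ (c.exists_lintegral_nhd_le hΩ.isOpen)⟩
        -- Control passes from a ball about a core point to the core by convexity, and from the core
        -- to the chart along vertical lines.
        obtain ⟨z, hz⟩ := c.nonempty_core
        obtain ⟨r, hr, hC⟩ := exists_controlled_ball hΩ hΓ hsub hpos (c.core_subset hz).2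
        refine (hC.mono (Set.inter_subset_left (t := c.core))).of_convex c.convex_core
          c.isOpen_core.measurableSet (c.isBounded_core hΩ.isBounded)
          (c.core_subset.trans Set.inter_subset_right) Set.inter_subset_right ?_
        exact ((Metric.isOpen_ball.inter c.isOpen_core).measure_pos _
          ⟨z, Metric.mem_ball_self hr, hz⟩).ne'
  exact h.mono (Set.subset_inter subset_closure subset_rfl)

/-- The trace inequality for `C¹` functions. -/
theorem exists_trace_le {Ω : Set Plane} (hΩ : IsPolygonalDomain Ω) :
    ∃ C : ℝ≥0, ∀ φ : Plane → ℂ, ContDiff ℝ 1 φ →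
      ∫⁻ y, ‖φ y‖ₑ ^ 2 ∂arcLength (frontier Ω) ≤
        C * ((∫⁻ y in Ω, ‖φ y‖ₑ ^ 2) + ∫⁻ y in Ω, ‖fderiv ℝ φ y‖ₑ ^ 2) := by
  have h : ∃ C : ℝ≥0, ∀ φ : Plane → ℂ, ContDiff ℝ 1 φ →
      ∫⁻ y, ‖φ y‖ₑ ^ 2 ∂arcLength (frontier Ω ∩ frontier Ω) ≤
        C * ((∫⁻ y in Ω, ‖φ y‖ₑ ^ 2) + ∫⁻ y in Ω, ‖fderiv ℝ φ y‖ₑ ^ 2) := by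
    refine hΩ.isCompact_frontier.induction_on
      (p := fun t => ∃ C : ℝ≥0, ∀ φ : Plane → ℂ, ContDiff ℝ 1 φ →
        ∫⁻ y, ‖φ y‖ₑ ^ 2 ∂arcLength (t ∩ frontier Ω) ≤
          C * ((∫⁻ y in Ω, ‖φ y‖ₑ ^ 2) + ∫⁻ y in Ω, ‖fderiv ℝ φ y‖ₑ ^ 2)) ?_ ?_ ?_ ?_
    · exact ⟨0, fun φ _ => by simp [arcLength]⟩
    · rintro s t hst ⟨C, hC⟩
      exact ⟨C, fun φ hφ => (lintegral_mono_set (Set.inter_subset_inter_left _ hst)).trans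
        (hC φ hφ)⟩
    · rintro s t ⟨C, hC⟩ ⟨C', hC'⟩
      refine ⟨C + C', fun φ hφ => ?_⟩
      rw [Set.union_inter_distrib_right]
      refine (lintegral_union_le _ _ _).trans ?_
      rw [ENNReal.coe_add, add_mul]
      exact add_le_add (hC φ hφ) (hC' φ hφ)
    · intro x hx
      obtain ⟨c, hc⟩ := hΩ.lipschitz.exists_chart hΩ.isOpen hx
      obtain ⟨C, hC⟩ := c.exists_lintegral_boundary_le hΩ.isOpen
      exact ⟨c.nhd, mem_nhdsWithin_of_mem_nhds (c.isOpen_nhd.mem_nhds hc), C, fun φ hφ =>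
        (hC φ hφ).trans (mul_le_mul_right (add_le_add (lintegral_mono_set
          (c.core_subset.trans Set.inter_subset_right)) le_rfl) _)⟩
  rwa [Set.inter_self] at h

/-! ### Lower regularity of the arc length of the boundary -/

/-- The curve has Lipschitz constant `1 + K`, so a parameter interval of length `r / (1 + K)` stays
in the ball of radius `r` about its starting point, and arc length is at least parameter length. -/
lemma GraphChart.exists_arcLength_ball_ge {Ω : Set Plane} (c : GraphChart Ω) (hΩ : IsOpen Ω)
    {R : ℝ} (hR : 0 < R) {x : Plane} (hx : x ∈ c.nhd) :
    ∃ U ∈ 𝓝 x, ∃ k > 0, ∀ y ∈ U ∩ frontier Ω, ∀ r, 0 < r → r ≤ R →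
      ENNReal.ofReal (k * r) ≤ arcLength (frontier Ω) (Metric.ball y r) := by
  obtain ⟨ρ, hρ, hsub⟩ := Metric.isOpen_iff.1 c.isOpen_nhd x hx
  have hK : (0 : ℝ) < 1 + c.K := by positivity
  have key : ∀ y ∈ Metric.ball x (ρ / 2) ∩ frontier Ω, ∀ r, 0 < r → r ≤ ρ / 2 →
      ENNReal.ofReal (r / (1 + c.K)) ≤ arcLength (frontier Ω) (Metric.ball y r) := by
    rintro y ⟨hy, hyf⟩ r hr hrρ
    have hball : Metric.ball y r ⊆ c.nhd := by
      refine (Metric.ball_subset_ball' ?_).trans hsub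
      linarith [Metric.mem_ball.1 hy]
    obtain ⟨-, hcy⟩ := c.mem_image_curve hΩ ⟨hball (Metric.mem_ball_self hr), hyf⟩
    set s := c.L y 0
    rw [arcLength, Measure.restrict_apply measurableSet_ball]
    refine le_trans ?_ (c.volume_preimage_curve_le _)
    have hsubset : Set.Ioo s (s + r / (1 + c.K)) ⊆
        c.curve ⁻¹' (Metric.ball y r ∩ frontier Ω) := by
      intro s' hs'
      have h1 : c.curve s' ∈ Metric.ball y r := by
        rw [Metric.mem_ball, ← hcy]
        refine (c.lipschitz_curve.dist_le_mul s' s).trans_lt ?_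
        rw [Real.dist_eq, abs_of_pos (by linarith [hs'.1])]
        push_cast
        calc (1 + (c.K : ℝ)) * (s' - s) < (1 + c.K) * (r / (1 + c.K)) := by
              gcongr
              linarith [hs'.2]
          _ = r := by field_simp
      have h2 : s' ∈ c.base := by
        have := (hball h1).1
        rw [curve, L_point_zero] at this
        exact c.mem_base.2 this
      exact ⟨h1, (c.curve_mem hΩ h2).2⟩
    refine le_trans (le_of_eq ?_) (measure_mono hsubset)
    rw [Real.volume_Ioo, add_sub_cancel_left]
  -- For radii beyond `ρ / 2` the smaller ball is used; since `r ≤ R`, this costs only a factor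
  -- depending on `ρ` and `R`.
  refine ⟨Metric.ball x (ρ / 2), Metric.ball_mem_nhds x (by positivity),
    min (ρ / 2) R / (R * (1 + c.K)), by positivity, fun y hy r hr hrR => ?_⟩
  have hmin : min (ρ / 2) R * r ≤ R * min (ρ / 2) r := by
    rcases le_total (ρ / 2) r with h | h
    · rw [min_eq_left h, min_eq_left (h.trans hrR)]
      nlinarith
    · rw [min_eq_right h]
      nlinarith [min_le_right (ρ / 2) R]
  calc ENNReal.ofReal (min (ρ / 2) R / (R * (1 + c.K)) * r)
      ≤ ENNReal.ofReal (min (ρ / 2) r / (1 + c.K)) := by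
        apply ENNReal.ofReal_le_ofReal
        rw [div_mul_eq_mul_div, div_le_div_iff₀ (by positivity) hK]
        nlinarith
    _ ≤ arcLength (frontier Ω) (Metric.ball y (min (ρ / 2) r)) :=
        key y hy _ (by positivity) (min_le_left _ _)
    _ ≤ _ := measure_mono (Metric.ball_subset_ball (min_le_right _ _))

theorem exists_arcLength_ball_ge {Ω : Set Plane} (hΩ : IsPolygonalDomain Ω) {R : ℝ}
    (hR : 0 < R) :
    ∃ k > 0, ∀ y ∈ frontier Ω, ∀ r, 0 < r → r ≤ R →
      ENNReal.ofReal (k * r) ≤ arcLength (frontier Ω) (Metric.ball y r) := by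
  have h : ∃ k > 0, ∀ y ∈ frontier Ω ∩ frontier Ω, ∀ r, 0 < r → r ≤ R →
      ENNReal.ofReal (k * r) ≤ arcLength (frontier Ω) (Metric.ball y r) := by
    refine hΩ.isCompact_frontier.induction_on
      (p := fun t => ∃ k > 0, ∀ y ∈ t ∩ frontier Ω, ∀ r, 0 < r → r ≤ R →
        ENNReal.ofReal (k * r) ≤ arcLength (frontier Ω) (Metric.ball y r)) ?_ ?_ ?_ ?_
    · exact ⟨1, one_pos, fun y hy => by simp at hy⟩
    · rintro s t hst ⟨k, hk, h⟩
      exact ⟨k, hk, fun y hy => h y ⟨hst hy.1, hy.2⟩⟩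
    · rintro s t ⟨k, hk, h⟩ ⟨k', hk', h'⟩
      refine ⟨min k k', lt_min hk hk', fun y hy r hr hrR => ?_⟩
      rcases hy with ⟨hy | hy, hyf⟩
      · refine le_trans (ENNReal.ofReal_le_ofReal ?_) (h y ⟨hy, hyf⟩ r hr hrR)
        gcongr
        exact min_le_left _ _
      · refine le_trans (ENNReal.ofReal_le_ofReal ?_) (h' y ⟨hy, hyf⟩ r hr hrR)
        gcongr
        exact min_le_right _ _
    · intro x hx
      obtain ⟨c, hc⟩ := hΩ.lipschitz.exists_chart hΩ.isOpen hx
      obtain ⟨U, hU, h⟩ := c.exists_arcLength_ball_ge hΩ.isOpen hR hc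
      exact ⟨U, mem_nhdsWithin_of_mem_nhds hU, h⟩
  rwa [Set.inter_self] at h

/-! ### A smoothed distance function -/

/-- Mollifying the distance at scale `δ` moves it by at most `δ` and keeps the Lipschitz constant 1.
Adding `2 * δ` makes the result exceed the distance by an amount between `δ` and `3 * δ`, so it is
bounded below even on `F`. -/
lemma exists_contDiff_dist (F : Set Plane) {δ : ℝ} (hδ : 0 < δ) :
    ∃ D : Plane → ℝ, ContDiff ℝ 1 D ∧ LipschitzWith 1 D ∧
      ∀ x, Metric.infDist x F + δ ≤ D x ∧ D x ≤ Metric.infDist x F + 3 * δ := by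
  let ρ : ContDiffBump (0 : Plane) := ⟨δ / 2, δ, by positivity, by linarith⟩
  set g : Plane → ℝ := fun x => Metric.infDist x F with hg
  have hgl : LipschitzWith 1 g := Metric.lipschitz_infDist_pt F
  have hgc : Continuous g := hgl.continuous
  set I : Plane → ℝ := MeasureTheory.convolution (ρ.normed volume) g
    (ContinuousLinearMap.lsmul ℝ ℝ) volume with hI
  have hex : ConvolutionExists (ρ.normed volume) g (ContinuousLinearMap.lsmul ℝ ℝ) volume :=
    ρ.hasCompactSupport_normed.convolutionExists_left (L := ContinuousLinearMap.lsmul ℝ ℝ)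
      ρ.continuous_normed hgc.locallyIntegrable
  have hsmooth : ContDiff ℝ 1 I :=
    ρ.hasCompactSupport_normed.contDiff_convolution_left (ContinuousLinearMap.lsmul ℝ ℝ)
      ρ.contDiff_normed hgc.locallyIntegrable
  have hclose : ∀ x, dist (I x) (g x) ≤ δ := by
    intro x
    refine ρ.dist_normed_convolution_le hgc.aestronglyMeasurable fun y hy => ?_
    have := hgl.dist_le_mul y x
    rw [NNReal.coe_one, one_mul] at this
    exact this.trans (Metric.mem_ball.1 hy).le
  refine ⟨fun x => I x + 2 * δ, hsmooth.add contDiff_const, ?_, fun x => ?_⟩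
  · refine LipschitzWith.of_dist_le_mul fun x x' => ?_
    rw [dist_add_right, NNReal.coe_one, one_mul, Real.dist_eq, hI, MeasureTheory.convolution,
      MeasureTheory.convolution, ← integral_sub (hex x) (hex x')]
    have hle : ∀ t, ‖(ContinuousLinearMap.lsmul ℝ ℝ (ρ.normed volume t)) (g (x - t)) -
        (ContinuousLinearMap.lsmul ℝ ℝ (ρ.normed volume t)) (g (x' - t))‖ ≤
        ρ.normed volume t * dist x x' := by
      intro t
      rw [← map_sub, ContinuousLinearMap.lsmul_apply, norm_smul,
        Real.norm_of_nonneg (ρ.nonneg_normed t)]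
      refine mul_le_mul_of_nonneg_left ?_ (ρ.nonneg_normed t)
      have := hgl.dist_le_mul (x - t) (x' - t)
      rw [NNReal.coe_one, one_mul, dist_sub_right] at this
      exact this
    calc |∫ t, _| ≤ ∫ t, ρ.normed volume t * dist x x' :=
          norm_integral_le_of_norm_le (ρ.integrable_normed.mul_const _)
            (Eventually.of_forall hle)
      _ = dist x x' := by rw [integral_mul_const, ρ.integral_normed, one_mul]
  · have := abs_le.1 (hclose x)
    constructor <;> linarith [this.1, this.2]

/-! ### Differentiation of parametric integrals -/

lemma hasFDerivAt_integral_kernel {σ : Measure Plane} [IsFiniteMeasure σ] {k : Plane → Plane → ℝ}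
    {k' : Plane → Plane → Plane →L[ℝ] ℝ} (hk : ∀ x y, HasFDerivAt (fun x => k x y) (k' x y) x)
    (hkc : ∀ x, Continuous (k x)) (hkdr : ∀ x, Continuous (k' x)) {B : ℝ}
    (hB : ∀ x y, |k x y| ≤ B) (hB' : ∀ x y, ‖k' x y‖ ≤ B) {v : Plane → ℝ} (hv : Integrable v σ)
    (x : Plane) :
    HasFDerivAt (fun x => ∫ y, k x y * v y ∂σ) (∫ y, v y • k' x y ∂σ) x := by
  refine hasFDerivAt_integral_of_dominated_of_fderiv_le (𝕜 := ℝ) (μ := σ)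
    (F := fun x y => k x y * v y) (F' := fun x y => v y • k' x y) (s := Set.univ)
    (bound := fun y => B * ‖v y‖) univ_mem ?_ ?_ ?_ ?_ ?_ ?_
  · exact Eventually.of_forall fun x => (hkc x).aestronglyMeasurable.mul hv.1
  · exact hv.bdd_mul (c := B) (hkc x).aestronglyMeasurable (Eventually.of_forall (hB x))
  · exact hv.1.smul (hkdr x).aestronglyMeasurable
  · refine Eventually.of_forall fun y x _ => ?_
    rw [norm_smul, mul_comm]
    exact mul_le_mul_of_nonneg_right (hB' x y) (norm_nonneg _)
  · exact hv.norm.const_mul B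
  · refine Eventually.of_forall fun y x _ => ?_
    exact (hk x y).mul_const (v y)

lemma contDiff_integral_kernel {σ : Measure Plane} [IsFiniteMeasure σ] {k : Plane → Plane → ℝ}
    {k' : Plane → Plane → Plane →L[ℝ] ℝ} (hk : ∀ x y, HasFDerivAt (fun x => k x y) (k' x y) x)
    (hkc : ∀ x, Continuous (k x)) (hkdr : ∀ x, Continuous (k' x))
    (hkdl : ∀ y, Continuous fun x => k' x y) {B : ℝ}
    (hB : ∀ x y, |k x y| ≤ B) (hB' : ∀ x y, ‖k' x y‖ ≤ B) {v : Plane → ℝ} (hv : Integrable v σ) :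
    ContDiff ℝ 1 fun x => ∫ y, k x y * v y ∂σ := by
  have hd := hasFDerivAt_integral_kernel hk hkc hkdr hB hB' hv
  rw [contDiff_one_iff_fderiv]
  refine ⟨fun x => (hd x).differentiableAt, ?_⟩
  rw [show fderiv ℝ (fun x => ∫ y, k x y * v y ∂σ) = fun x => ∫ y, v y • k' x y ∂σ from
    funext fun x => (hd x).fderiv]
  refine continuous_of_dominated (bound := fun y => B * ‖v y‖) ?_ ?_ ?_ ?_
  · exact fun x => hv.1.smul (hkdr x).aestronglyMeasurable
  · refine fun x => Eventually.of_forall fun y => ?_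
    rw [norm_smul, mul_comm]
    exact mul_le_mul_of_nonneg_right (hB' x y) (norm_nonneg _)
  · exact hv.norm.const_mul B
  · exact Eventually.of_forall fun y => (hkdl y).const_smul (v y)

/-! ### The averaging kernel -/

/-- The unnormalized kernel `(D(x)² + |x - y|²)⁻²`. -/
def kernel (D : Plane → ℝ) (x y : Plane) : ℝ := ((D x ^ 2 + ‖x - y‖ ^ 2) ^ 2)⁻¹

/-- The derivative of `kernel D` in its first variable. -/
def kernelDeriv (D : Plane → ℝ) (x y : Plane) : Plane →L[ℝ] ℝ :=
  (-4 * ((D x ^ 2 + ‖x - y‖ ^ 2) ^ 3)⁻¹) • (D x • fderiv ℝ D x + innerSL ℝ (x - y))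

section Kernel

variable {D : Plane → ℝ} {δ : ℝ}

lemma kernel_den_pos (hδ : 0 < δ) (hD : ∀ x, δ ≤ D x) (x y : Plane) :
    0 < D x ^ 2 + ‖x - y‖ ^ 2 := by
  have : 0 < D x := hδ.trans_le (hD x)
  positivity

lemma kernel_pos (hδ : 0 < δ) (hD : ∀ x, δ ≤ D x) (x y : Plane) : 0 < kernel D x y := by
  have := kernel_den_pos hδ hD x y
  unfold kernel
  positivity

lemma hasFDerivAt_kernel (hδ : 0 < δ) (hD : ∀ x, δ ≤ D x) (hDc : ContDiff ℝ 1 D) (x y : Plane) :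
    HasFDerivAt (fun x => kernel D x y) (kernelDeriv D x y) x := by
  have hq := (kernel_den_pos hδ hD x y).ne'
  have h1 : HasFDerivAt D (fderiv ℝ D x) x := (hDc.differentiable one_ne_zero x).hasFDerivAt
  have h2 : HasFDerivAt (fun x => ‖x - y‖ ^ 2) (2 • (innerSL ℝ (x - y))) x := by
    have := ((hasFDerivAt_id x).sub_const y).norm_sq
    simpa using this
  have h3 : HasFDerivAt (fun x => D x ^ 2 + ‖x - y‖ ^ 2)
      ((2 : ℝ) • (D x • fderiv ℝ D x + innerSL ℝ (x - y))) x := by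
    refine ((h1.pow 2).add h2).congr_fderiv ?_
    ext v
    simp
    ring
  have h4 := (hasDerivAt_inv (pow_ne_zero 2 hq)).comp_hasFDerivAt x (h3.pow 2)
  refine h4.congr_fderiv ?_
  ext v
  simp [kernelDeriv]
  field_simp
  ring

lemma continuous_kernel_right (hδ : 0 < δ) (hD : ∀ x, δ ≤ D x) (x : Plane) :
    Continuous (kernel D x) := by
  unfold kernel
  refine Continuous.inv₀ (by fun_prop) fun y => (pow_pos (kernel_den_pos hδ hD x y) 2).ne'

lemma continuous_kernelDeriv_right (hδ : 0 < δ) (hD : ∀ x, δ ≤ D x) (x : Plane) :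
    Continuous (kernelDeriv D x) := by
  have h := fun y => (pow_pos (kernel_den_pos hδ hD x y) 3).ne'
  unfold kernelDeriv
  refine Continuous.smul (continuous_const.mul (Continuous.inv₀ (by fun_prop) h)) (by fun_prop)

lemma continuous_kernelDeriv_left (hδ : 0 < δ) (hD : ∀ x, δ ≤ D x) (hDc : ContDiff ℝ 1 D)
    (y : Plane) : Continuous fun x => kernelDeriv D x y := by
  have h := fun x => (pow_pos (kernel_den_pos hδ hD x y) 3).ne'
  have h1 := hDc.continuous
  have h2 := hDc.continuous_fderiv one_ne_zero
  unfold kernelDeriv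
  refine Continuous.smul (continuous_const.mul (Continuous.inv₀ (by fun_prop) h)) (by fun_prop)

/-- The logarithmic derivative is of order `1 / D`: the inner factor is at most `D + |x - y|`, and
`D (D + |x - y|) ≤ 2 (D² + |x - y|²)` absorbs one power of the denominator. -/
lemma norm_kernelDeriv_le (hδ : 0 < δ) (hD : ∀ x, δ ≤ D x) (hDl : LipschitzWith 1 D)
    (x y : Plane) : ‖kernelDeriv D x y‖ ≤ 8 / D x * kernel D x y := by
  have hq := kernel_den_pos hδ hD x y
  have hDx : 0 < D x := hδ.trans_le (hD x)
  have h1 : ‖D x • fderiv ℝ D x + innerSL ℝ (x - y)‖ ≤ D x + ‖x - y‖ := by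
    refine (norm_add_le _ _).trans (add_le_add ?_ (innerSL_apply_norm ℝ _).le)
    rw [norm_smul, Real.norm_of_nonneg hDx.le]
    have := norm_fderiv_le_of_lipschitz ℝ hDl (x₀ := x)
    rw [NNReal.coe_one] at this
    nlinarith
  rw [kernelDeriv, norm_smul, kernel]
  set q := D x ^ 2 + ‖x - y‖ ^ 2 with hqdef
  have h2 : ‖-4 * (q ^ 3)⁻¹‖ = 4 * (q ^ 3)⁻¹ := by
    rw [norm_mul, Real.norm_of_nonneg (by positivity : 0 ≤ (q ^ 3)⁻¹)]
    norm_num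
  rw [h2]
  have h3 : D x * (D x + ‖x - y‖) ≤ 2 * q := by
    rw [hqdef]; nlinarith [sq_nonneg (D x - ‖x - y‖), sq_nonneg (D x)]
  calc 4 * (q ^ 3)⁻¹ * ‖D x • fderiv ℝ D x + innerSL ℝ (x - y)‖
      ≤ 4 * (q ^ 3)⁻¹ * (D x + ‖x - y‖) := by gcongr
    _ = 4 * (q ^ 3)⁻¹ / D x * (D x * (D x + ‖x - y‖)) := by field_simp
    _ ≤ 4 * (q ^ 3)⁻¹ / D x * (2 * q) := by gcongr
    _ = _ := by field_simp; ring

lemma kernel_le (hδ : 0 < δ) (hD : ∀ x, δ ≤ D x) (x y : Plane) : kernel D x y ≤ (δ ^ 4)⁻¹ := by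
  unfold kernel
  apply inv_anti₀ (by positivity)
  have h1 : δ ^ 2 ≤ D x ^ 2 + ‖x - y‖ ^ 2 := by
    have := pow_le_pow_left₀ hδ.le (hD x) 2
    nlinarith [sq_nonneg ‖x - y‖]
  calc δ ^ 4 = (δ ^ 2) ^ 2 := by ring
    _ ≤ _ := pow_le_pow_left₀ (by positivity) h1 2

/-- The normalization of the kernel. -/
def kernelMass (σ : Measure Plane) (D : Plane → ℝ) (x : Plane) : ℝ := ∫ y, kernel D x y ∂σ

/-- The average of `w` with respect to the kernel. -/
def average (σ : Measure Plane) (D : Plane → ℝ) (w : Plane → ℝ) (x : Plane) : ℝ :=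
  (∫ y, kernel D x y * w y ∂σ) / kernelMass σ D x

lemma integrable_kernel_mul {σ : Measure Plane} {w : Plane → ℝ} (hδ : 0 < δ) (hD : ∀ x, δ ≤ D x) (hw : Integrable w σ) (x : Plane) :
    Integrable (fun y => kernel D x y * w y) σ :=
  hw.bdd_mul (c := (δ ^ 4)⁻¹) (continuous_kernel_right hδ hD x).aestronglyMeasurable
    (Eventually.of_forall fun y => by
      rw [Real.norm_of_nonneg (kernel_pos hδ hD x y).le]; exact kernel_le hδ hD x y)

variable {σ : Measure Plane} [IsFiniteMeasure σ] {w : Plane → ℝ}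

lemma integrable_kernel (hδ : 0 < δ) (hD : ∀ x, δ ≤ D x) (x : Plane) :
    Integrable (kernel D x) σ :=
  Integrable.of_bound (continuous_kernel_right hδ hD x).aestronglyMeasurable (δ ^ 4)⁻¹
    (Eventually.of_forall fun y => by
      rw [Real.norm_of_nonneg (kernel_pos hδ hD x y).le]; exact kernel_le hδ hD x y)

lemma kernelMass_pos (hσ : σ ≠ 0) (hδ : 0 < δ) (hD : ∀ x, δ ≤ D x) (x : Plane) :
    0 < kernelMass σ D x := by
  unfold kernelMass
  rw [integral_pos_iff_support_of_nonneg (fun y => (kernel_pos hδ hD x y).le)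
    (integrable_kernel hδ hD x)]
  have : Function.support (kernel D x) = Set.univ :=
    Set.eq_univ_of_forall fun y => (kernel_pos hδ hD x y).ne'
  rw [this]
  exact Measure.measure_univ_pos.2 hσ

/-- The quotient rule is rearranged so that the data enter only through `w y - average`; this
cancellation of constants is what makes the seminorm, not the norm, of `w` control the gradient. The
`C¹` regularity is recorded alongside, as it rests on the same domination bounds. -/
lemma hasFDerivAt_average (hσ : σ ≠ 0) (hδ : 0 < δ) (hD : ∀ x, δ ≤ D x) (hDc : ContDiff ℝ 1 D)
    (hDl : LipschitzWith 1 D) (hw : Integrable w σ) (x : Plane) :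
    ContDiff ℝ 1 (average σ D w) ∧
    HasFDerivAt (average σ D w) ((kernelMass σ D x)⁻¹ •
      ∫ y, (w y - average σ D w x) • kernelDeriv D x y ∂σ) x := by
  set B : ℝ := max (δ ^ 4)⁻¹ (8 / δ * (δ ^ 4)⁻¹) with hBdef
  have hB : ∀ x y, |kernel D x y| ≤ B := fun x y => by
    rw [abs_of_pos (kernel_pos hδ hD x y)]
    exact (kernel_le hδ hD x y).trans (le_max_left _ _)
  have hB' : ∀ x y, ‖kernelDeriv D x y‖ ≤ B := fun x y => by
    refine (norm_kernelDeriv_le hδ hD hDl x y).trans (le_trans ?_ (le_max_right _ _))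
    have h1 := hD x
    have h2 := kernel_le hδ hD x y
    have h3 := (kernel_pos hδ hD x y).le
    gcongr
  have hk := hasFDerivAt_kernel hδ hD hDc
  have hkc := continuous_kernel_right hδ hD
  have hkdr := continuous_kernelDeriv_right hδ hD
  have hkdl := continuous_kernelDeriv_left hδ hD hDc
  have hZ : ∀ x, kernelMass σ D x ≠ 0 := fun x => (kernelMass_pos hσ hδ hD x).ne'
  have hone : Integrable (fun _ : Plane => (1 : ℝ)) σ := integrable_const 1
  have eZ : kernelMass σ D = fun x => ∫ y, kernel D x y * 1 ∂σ := by
    funext x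
    simp [kernelMass]
  have hZd : HasFDerivAt (kernelMass σ D) (∫ y, (1 : ℝ) • kernelDeriv D x y ∂σ) x := by
    rw [eZ]
    exact hasFDerivAt_integral_kernel hk hkc hkdr hB hB' hone x
  have hNd := hasFDerivAt_integral_kernel hk hkc hkdr hB hB' hw x
  have hint : ∀ {v : Plane → ℝ}, Integrable v σ →
      Integrable (fun y => v y • kernelDeriv D x y) σ := fun {v} hv => by
    refine (hv.norm.const_mul B).mono' (hv.1.smul (hkdr x).aestronglyMeasurable)
      (Eventually.of_forall fun y => ?_)
    rw [norm_smul, mul_comm]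
    exact mul_le_mul_of_nonneg_right (hB' x y) (norm_nonneg _)
  constructor
  · have hZc : ContDiff ℝ 1 (kernelMass σ D) := by
      rw [eZ]
      exact contDiff_integral_kernel hk hkc hkdr hkdl hB hB' hone
    exact (contDiff_integral_kernel hk hkc hkdr hkdl hB hB' hw).div hZc hZ
  · have hdiv := hNd.mul ((hasDerivAt_inv (hZ x)).comp_hasFDerivAt x hZd)
    refine HasFDerivAt.congr_fderiv (f := average σ D w) hdiv ?_
    have e : ∫ y, (w y - average σ D w x) • kernelDeriv D x y ∂σ =
        (∫ y, w y • kernelDeriv D x y ∂σ) -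
          average σ D w x • ∫ y, (1 : ℝ) • kernelDeriv D x y ∂σ := by
      have h2 : Integrable (fun y => average σ D w x • (1 : ℝ) • kernelDeriv D x y) σ :=
        (hint hone).smul (average σ D w x)
      rw [← integral_smul, ← integral_sub (hint hw) h2]
      refine integral_congr_ae (Eventually.of_forall fun y => ?_)
      ext v
      simp only [smul_apply, sub_apply, smul_eq_mul]
      ring
    rw [e]
    set N' := ∫ y, w y • kernelDeriv D x y ∂σ
    set Z' := ∫ y, (1 : ℝ) • kernelDeriv D x y ∂σ
    have hZx := hZ x
    ext v
    simp only [average, Function.comp_apply, add_apply,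
      smul_apply, sub_apply, smul_eq_mul]
    field_simp
    ring

end Kernel

/-! ### Lifting of boundary data of class `H^{1/2}` -/

/-- Jensen's inequality for the square: Cauchy–Schwarz for the measure with density `p`, whose total
mass is at most 1. -/
lemma sq_lintegral_weight_mul_le {X : Type*} [MeasurableSpace X] (μ : Measure X) {p g : X → ℝ≥0∞}
    (hp : Measurable p) (hg : Measurable g) (hp1 : ∫⁻ x, p x ∂μ ≤ 1) :
    (∫⁻ x, p x * g x ∂μ) ^ 2 ≤ ∫⁻ x, p x * g x ^ 2 ∂μ := by
  have h := sq_lintegral_le (μ.withDensity p) hg.aemeasurable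
  rw [lintegral_withDensity_eq_lintegral_mul _ hp hg,
    lintegral_withDensity_eq_lintegral_mul _ hp (hg.pow_const 2),
    withDensity_apply _ MeasurableSet.univ, Measure.restrict_univ] at h
  exact h.trans ((mul_le_mul_left hp1 _).trans (one_mul _).le)

section Kernel

variable {D : Plane → ℝ} {δ : ℝ} {σ : Measure Plane} [IsFiniteMeasure σ] {w : Plane → ℝ}

/-- The normalized kernel. -/
def weight (σ : Measure Plane) (D : Plane → ℝ) (x y : Plane) : ℝ≥0∞ :=
  ENNReal.ofReal (kernel D x y / kernelMass σ D x)

lemma measurable_weight {σ : Measure Plane} (hδ : 0 < δ) (hD : ∀ x, δ ≤ D x) (x : Plane) :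
    Measurable (weight σ D x) :=
  ((continuous_kernel_right hδ hD x).measurable.div_const _).ennreal_ofReal

lemma lintegral_weight (hσ : σ ≠ 0) (hδ : 0 < δ) (hD : ∀ x, δ ≤ D x) (x : Plane) :
    ∫⁻ y, weight σ D x y ∂σ = 1 := by
  have hZ := kernelMass_pos hσ hδ hD x
  unfold weight
  rw [← ofReal_integral_eq_lintegral_ofReal ((integrable_kernel hδ hD x).div_const _)
    (Eventually.of_forall fun y => div_nonneg (kernel_pos hδ hD x y).le hZ.le),
    integral_div, ← kernelMass, div_self hZ.ne', ENNReal.ofReal_one]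

/-- The weights have total mass 1, so `a - average` is the weighted mean of `a - w y`; then Jensen.
-/
lemma enorm_sub_average_sq_le (hσ : σ ≠ 0) (hδ : 0 < δ) (hD : ∀ x, δ ≤ D x) (hw : Integrable w σ)
    (hwm : Measurable w) (a : ℝ) (x : Plane) :
    ‖a - average σ D w x‖ₑ ^ 2 ≤ ∫⁻ y, weight σ D x y * ‖a - w y‖ₑ ^ 2 ∂σ := by
  have hZ := kernelMass_pos hσ hδ hD x
  have e : a - average σ D w x = ∫ y, kernel D x y / kernelMass σ D x * (a - w y) ∂σ := by
    have h1 : ∀ y, kernel D x y / kernelMass σ D x * (a - w y) =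
        (kernelMass σ D x)⁻¹ * (kernel D x y * a - kernel D x y * w y) := fun y => by
      rw [div_eq_inv_mul]; ring
    simp only [h1]
    rw [integral_const_mul, integral_sub ((integrable_kernel hδ hD x).mul_const a)
      (integrable_kernel_mul hδ hD hw x), integral_mul_const, ← kernelMass, average]
    field_simp
  have hle : ‖a - average σ D w x‖ₑ ≤ ∫⁻ y, weight σ D x y * ‖a - w y‖ₑ ∂σ := by
    rw [e]
    refine (enorm_integral_le_lintegral_enorm _).trans (le_of_eq (lintegral_congr fun y => ?_))
    rw [enorm_mul, weight, Real.enorm_of_nonneg (div_nonneg (kernel_pos hδ hD x y).le hZ.le)]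
  refine (pow_le_pow_left' hle 2).trans ?_
  exact sq_lintegral_weight_mul_le σ (measurable_weight hδ hD x)
    (by fun_prop) (lintegral_weight hσ hδ hD x).le

/-- After the kernel derivative is bounded by `8 / D` times the kernel, Jensen is used twice: for
the mean over `y`, and for the average hidden in `w y - average`. -/
lemma enorm_fderiv_average_sq_le (hσ : σ ≠ 0) (hδ : 0 < δ) (hD : ∀ x, δ ≤ D x)
    (hDc : ContDiff ℝ 1 D) (hDl : LipschitzWith 1 D) (hw : Integrable w σ) (hwm : Measurable w)
    (x : Plane) :
    ‖fderiv ℝ (average σ D w) x‖ₑ ^ 2 ≤ ENNReal.ofReal (64 / D x ^ 2) *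
      ∫⁻ y, weight σ D x y * ∫⁻ z, weight σ D x z * ‖w y - w z‖ₑ ^ 2 ∂σ ∂σ := by
  have hZ := kernelMass_pos hσ hδ hD x
  have hDx : 0 < D x := hδ.trans_le (hD x)
  have h8 : ENNReal.ofReal (8 / D x) ^ 2 = ENNReal.ofReal (64 / D x ^ 2) := by
    rw [← ENNReal.ofReal_pow (by positivity), div_pow]
    norm_num
  have hle : ‖fderiv ℝ (average σ D w) x‖ₑ ≤
      ENNReal.ofReal (8 / D x) * ∫⁻ y, weight σ D x y * ‖w y - average σ D w x‖ₑ ∂σ := by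
    rw [(hasFDerivAt_average hσ hδ hD hDc hDl hw x).2.fderiv, ← integral_smul,
      ← lintegral_const_mul' _ _ ENNReal.ofReal_ne_top]
    refine (enorm_integral_le_lintegral_enorm _).trans (lintegral_mono fun y => ?_)
    rw [enorm_smul, enorm_smul, Real.enorm_of_nonneg (inv_nonneg.2 hZ.le)]
    have h1 : ‖kernelDeriv D x y‖ₑ ≤ ENNReal.ofReal (8 / D x * kernel D x y) := by
      rw [← ofReal_norm]
      exact ENNReal.ofReal_le_ofReal (norm_kernelDeriv_le hδ hD hDl x y)
    calc ENNReal.ofReal (kernelMass σ D x)⁻¹ *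
          (‖w y - average σ D w x‖ₑ * ‖kernelDeriv D x y‖ₑ)
        ≤ ENNReal.ofReal (kernelMass σ D x)⁻¹ *
          (‖w y - average σ D w x‖ₑ * ENNReal.ofReal (8 / D x * kernel D x y)) := by gcongr
      _ = _ := by
        rw [weight, div_eq_mul_inv (kernel D x y), ENNReal.ofReal_mul (by positivity),
          ENNReal.ofReal_mul (kernel_pos hδ hD x y).le]
        ring
  refine (pow_le_pow_left' hle 2).trans ?_
  rw [mul_pow, h8]
  refine mul_le_mul_right ?_ _
  refine (sq_lintegral_weight_mul_le σ (measurable_weight hδ hD x)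
    (by fun_prop) (lintegral_weight hσ hδ hD x).le).trans (lintegral_mono fun y => ?_)
  exact mul_le_mul_right (enorm_sub_average_sq_le hσ hδ hD hw hwm (w y) x) _

/-- Points of the ball of radius `D x` about `y₀` are within `2 D x` of `x`, where the kernel is at
least `1 / (25 D⁴)`, with `25 = (1 + 2²)²`. The mass of that ball is at least `κ D x`. -/
lemma kernelMass_ge (hδ : 0 < δ) (hD : ∀ x, δ ≤ D x) {x y₀ : Plane} (hx : dist x y₀ ≤ D x) {κ : ℝ}
    (hκ : ENNReal.ofReal (κ * D x) ≤ σ (Metric.ball y₀ (D x))) :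
    κ / 25 / D x ^ 3 ≤ kernelMass σ D x := by
  have hDx : 0 < D x := hδ.trans_le (hD x)
  have h1 : κ * D x ≤ σ.real (Metric.ball y₀ (D x)) :=
    (ENNReal.ofReal_le_iff_le_toReal (measure_ne_top _ _)).1 hκ
  calc κ / 25 / D x ^ 3 = (25 * D x ^ 4)⁻¹ * (κ * D x) := by field_simp
    _ ≤ (25 * D x ^ 4)⁻¹ * σ.real (Metric.ball y₀ (D x)) := by gcongr
    _ = ∫ _ in Metric.ball y₀ (D x), (25 * D x ^ 4)⁻¹ ∂σ := by
        rw [setIntegral_const, smul_eq_mul, mul_comm]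
    _ ≤ ∫ y in Metric.ball y₀ (D x), kernel D x y ∂σ := by
        refine setIntegral_mono_on (integrable_const _) (integrable_kernel hδ hD x).integrableOn
          measurableSet_ball fun y hy => ?_
        unfold kernel
        have hq := kernel_den_pos hδ hD x y
        refine inv_anti₀ (by positivity) ?_
        have h2 : ‖x - y‖ ≤ 2 * D x := by
          rw [← dist_eq_norm]
          have := dist_triangle x y₀ y
          rw [Metric.mem_ball, dist_comm] at hy
          linarith
        have h3 : D x ^ 2 + ‖x - y‖ ^ 2 ≤ 5 * D x ^ 2 := by nlinarith [norm_nonneg (x - y)]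
        calc (D x ^ 2 + ‖x - y‖ ^ 2) ^ 2 ≤ (5 * D x ^ 2) ^ 2 := by gcongr
          _ = _ := by ring
    _ ≤ kernelMass σ D x :=
        setIntegral_le_integral (integrable_kernel hδ hD x)
          (Eventually.of_forall fun y => (kernel_pos hδ hD x y).le)

lemma weight_le {σ : Measure Plane} (hδ : 0 < δ) (hD : ∀ x, δ ≤ D x) {x : Plane} {c : ℝ} (hc : 0 < c)
    (hZ : c / D x ^ 3 ≤ kernelMass σ D x) (y : Plane) :
    weight σ D x y ≤ ENNReal.ofReal (D x ^ 3 / c * kernel D x y) := by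
  have hDx : 0 < D x := hδ.trans_le (hD x)
  have hk := (kernel_pos hδ hD x y).le
  apply ENNReal.ofReal_le_ofReal
  calc kernel D x y / kernelMass σ D x ≤ kernel D x y / (c / D x ^ 3) := by gcongr
    _ = _ := by field_simp

/-- This removes `D` from the energy estimate, and with it the dependence on `δ`. One factor `D²` is
absorbed by the product of the two denominators; the triangle inequality through `x` bounds `|y - z|
+ |x - y|`, and squaring gives `81 = 9²`. -/
lemma kernel_mul_kernel_le (hδ : 0 < δ) (hD : ∀ x, δ ≤ D x) (x : Plane) {y z : Plane}
    (hyz : y ≠ z) :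
    D x ^ 4 * (kernel D x y * kernel D x z) ≤ 81 * ((‖y - z‖ + ‖x - y‖) ^ 4)⁻¹ := by
  have hρ : 0 < ‖y - z‖ := norm_pos_iff.2 (sub_ne_zero.2 hyz)
  have hqy := kernel_den_pos hδ hD x y
  have hqz := kernel_den_pos hδ hD x z
  have htri : ‖y - z‖ ≤ ‖x - y‖ + ‖x - z‖ := by
    have := dist_triangle_left y z x
    rwa [dist_eq_norm, dist_eq_norm, dist_eq_norm] at this
  unfold kernel
  set s := ‖x - y‖ with hs
  set s' := ‖x - z‖ with hs'
  have hs0 : 0 ≤ s := norm_nonneg _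
  have hs0' : 0 ≤ s' := norm_nonneg _
  have key : (‖y - z‖ + s) ^ 2 * D x ^ 2 ≤ 9 * ((D x ^ 2 + s ^ 2) * (D x ^ 2 + s' ^ 2)) := by
    have h1 : (‖y - z‖ + s) ^ 2 ≤ (2 * s + s') ^ 2 :=
      pow_le_pow_left₀ (by positivity) (by linarith) 2
    have h2 : (2 * s + s') ^ 2 ≤ 9 * (s ^ 2 + s' ^ 2) := by nlinarith [sq_nonneg (s - s')]
    have h3 : (s ^ 2 + s' ^ 2) * D x ^ 2 ≤ (D x ^ 2 + s ^ 2) * (D x ^ 2 + s' ^ 2) := by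
      nlinarith [sq_nonneg (D x ^ 2), sq_nonneg (s * s')]
    calc (‖y - z‖ + s) ^ 2 * D x ^ 2 ≤ 9 * (s ^ 2 + s' ^ 2) * D x ^ 2 := by
          gcongr
          exact h1.trans h2
      _ ≤ _ := by linarith
  have key2 := pow_le_pow_left₀ (by positivity) key 2
  rw [← mul_inv, ← div_eq_mul_inv, ← div_eq_mul_inv, div_le_div_iff₀ (by positivity) (by positivity)]
  calc D x ^ 4 * (‖y - z‖ + s) ^ 4 = ((‖y - z‖ + s) ^ 2 * D x ^ 2) ^ 2 := by ring
    _ ≤ _ := key2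
    _ = _ := by ring

/-- Scaling `x = y + ρ x'` with `ρ = |y - z|` contributes `ρ²` from the plane and `ρ⁻⁴` from the
integrand. The remaining integral converges because the exponent 4 exceeds the dimension 2. -/
lemma lintegral_inv_add_norm_pow_four_le :
    ∃ A : ℝ≥0, ∀ y z : Plane, y ≠ z →
      ∫⁻ x : Plane, ENNReal.ofReal (((‖y - z‖ + ‖x - y‖) ^ 4)⁻¹) ≤ A / edist y z ^ 2 := by
  have hfin : ∫⁻ x : Plane, ENNReal.ofReal (((1 + ‖x‖) ^ 4)⁻¹) < ⊤ := by
    have h := finite_integral_one_add_norm (E := Plane) (μ := volume) (r := 4)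
      (by rw [finrank_euclideanSpace_fin]; norm_num)
    convert h using 3 with x
    rw [Real.rpow_neg (by positivity)]
    norm_num
  refine ⟨(∫⁻ x : Plane, ENNReal.ofReal (((1 + ‖x‖) ^ 4)⁻¹)).toNNReal, fun y z hyz => ?_⟩
  rw [ENNReal.coe_toNNReal hfin.ne]
  set ρ := ‖y - z‖ with hρdef
  have hρ : 0 < ρ := norm_pos_iff.2 (sub_ne_zero.2 hyz)
  have h1 := lintegral_comp_add_smul (H := fun x : Plane =>
    ENNReal.ofReal (((ρ + ‖x - y‖) ^ 4)⁻¹)) (by fun_prop) y hρ.ne'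
  have h2 : ∀ x : Plane, ENNReal.ofReal (((ρ + ‖y + ρ • x - y‖) ^ 4)⁻¹) =
      ENNReal.ofReal ((ρ ^ 4)⁻¹) * ENNReal.ofReal (((1 + ‖x‖) ^ 4)⁻¹) := fun x => by
    rw [← ENNReal.ofReal_mul (by positivity), add_sub_cancel_left, norm_smul,
      Real.norm_of_nonneg hρ.le, ← mul_inv, ← mul_pow]
    ring_nf
  simp only [h2] at h1
  rw [lintegral_const_mul' _ _ ENNReal.ofReal_ne_top] at h1
  have he : edist y z ^ 2 = ENNReal.ofReal (ρ ^ 2) := by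
    rw [edist_dist, ← ENNReal.ofReal_pow dist_nonneg, dist_eq_norm]
  have h3 : ENNReal.ofReal (ρ ^ 2) * ENNReal.ofReal ((ρ ^ 2)⁻¹) = 1 := by
    rw [← ENNReal.ofReal_mul (by positivity), mul_inv_cancel₀ (by positivity), ENNReal.ofReal_one]
  have h4 : ENNReal.ofReal (ρ ^ 2) * ENNReal.ofReal ((ρ ^ 4)⁻¹) = (ENNReal.ofReal (ρ ^ 2))⁻¹ := by
    rw [← ENNReal.ofReal_mul (by positivity), ← ENNReal.ofReal_inv_of_pos (by positivity)]
    congr 1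
    field_simp
  rw [he]
  calc ∫⁻ x : Plane, ENNReal.ofReal (((ρ + ‖x - y‖) ^ 4)⁻¹)
      = ENNReal.ofReal (ρ ^ 2) * (ENNReal.ofReal ((ρ ^ 2)⁻¹) *
          ∫⁻ x : Plane, ENNReal.ofReal (((ρ + ‖x - y‖) ^ 4)⁻¹)) := by
        rw [← mul_assoc, h3, one_mul]
    _ = _ := by rw [← h1, ← mul_assoc, h4, div_eq_mul_inv, mul_comm]
    _ ≤ _ := le_rfl

/-- The squared Slobodeckij seminorm with respect to the measure `σ`. -/
def slobodeckijSq (σ : Measure Plane) (w : Plane → ℝ) : ℝ≥0∞ :=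
  ∫⁻ y, ∫⁻ z, ‖w y - w z‖ₑ ^ 2 / edist y z ^ 2 ∂σ ∂σ

/-- Each weight is at most `D³ / c` times the kernel, so with the factor `64 / D²` exactly `D⁴`
times two kernels remains, and `kernel_mul_kernel_le` applies. Integrating in `x` first, by Tonelli,
produces the weight `|y - z|⁻²` of the Slobodeckij seminorm. -/
lemma lintegral_fderiv_average_le {Ω : Set Plane} (hΩ : MeasurableSet Ω) {c : ℝ} (hc : 0 < c)
    {A : ℝ≥0} (hA : ∀ y z : Plane, y ≠ z →
      ∫⁻ x : Plane, ENNReal.ofReal (((‖y - z‖ + ‖x - y‖) ^ 4)⁻¹) ≤ A / edist y z ^ 2)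
    (hσ : σ ≠ 0) (hδ : 0 < δ) (hD : ∀ x, δ ≤ D x) (hDc : ContDiff ℝ 1 D)
    (hDl : LipschitzWith 1 D) (hw : Integrable w σ) (hwm : Measurable w)
    (hZ : ∀ x ∈ Ω, c / D x ^ 3 ≤ kernelMass σ D x) :
    ∫⁻ x in Ω, ‖fderiv ℝ (average σ D w) x‖ₑ ^ 2 ≤
      ENNReal.ofReal (64 * 81 / c ^ 2) * A * slobodeckijSq σ w := by
  set κ : ℝ≥0∞ := ENNReal.ofReal (64 * 81 / c ^ 2) with hκ
  set H : Plane → Plane → Plane → ℝ≥0∞ := fun x y z =>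
    ENNReal.ofReal (((‖y - z‖ + ‖x - y‖) ^ 4)⁻¹) * ‖w y - w z‖ₑ ^ 2 with hH
  have hHm : Measurable fun p : (Plane × Plane) × Plane => H p.1.1 p.1.2 p.2 := by
    simp only [hH]
    fun_prop
  have hpt : ∀ x ∈ Ω, ‖fderiv ℝ (average σ D w) x‖ₑ ^ 2 ≤ κ * ∫⁻ y, ∫⁻ z, H x y z ∂σ ∂σ := by
    intro x hx
    have hDx : 0 < D x := hδ.trans_le (hD x)
    refine (enorm_fderiv_average_sq_le hσ hδ hD hDc hDl hw hwm x).trans ?_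
    rw [← lintegral_const_mul' _ _ ENNReal.ofReal_ne_top,
      ← lintegral_const_mul' _ _ ENNReal.ofReal_ne_top]
    refine lintegral_mono fun y => ?_
    have hfin : weight σ D x y ≠ ⊤ := ENNReal.ofReal_ne_top
    rw [← lintegral_const_mul' _ _ hfin, ← lintegral_const_mul' _ _ ENNReal.ofReal_ne_top,
      ← lintegral_const_mul' _ _ ENNReal.ofReal_ne_top]
    refine lintegral_mono fun z => ?_
    by_cases hyz : y = z
    · simp [hyz, hH]
    · have hky := (kernel_pos hδ hD x y).le
      have hkz := (kernel_pos hδ hD x z).le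
      simp only [hH, ← mul_assoc]
      refine mul_le_mul_left ?_ _
      calc ENNReal.ofReal (64 / D x ^ 2) * weight σ D x y * weight σ D x z
          ≤ ENNReal.ofReal (64 / D x ^ 2) * ENNReal.ofReal (D x ^ 3 / c * kernel D x y) *
              ENNReal.ofReal (D x ^ 3 / c * kernel D x z) := by
            gcongr
            · exact weight_le hδ hD hc (hZ x hx) y
            · exact weight_le hδ hD hc (hZ x hx) z
        _ = ENNReal.ofReal (64 / c ^ 2 * (D x ^ 4 * (kernel D x y * kernel D x z))) := by
            rw [← ENNReal.ofReal_mul (by positivity), ← ENNReal.ofReal_mul (by positivity)]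
            congr 1
            field_simp
        _ ≤ ENNReal.ofReal (64 / c ^ 2 * (81 * ((‖y - z‖ + ‖x - y‖) ^ 4)⁻¹)) := by
            apply ENNReal.ofReal_le_ofReal
            exact mul_le_mul_of_nonneg_left (kernel_mul_kernel_le hδ hD x hyz) (by positivity)
        _ = κ * ENNReal.ofReal (((‖y - z‖ + ‖x - y‖) ^ 4)⁻¹) := by
            rw [hκ, ← ENNReal.ofReal_mul (by positivity)]
            congr 1
            ring
  calc ∫⁻ x in Ω, ‖fderiv ℝ (average σ D w) x‖ₑ ^ 2
      ≤ ∫⁻ x in Ω, κ * ∫⁻ y, ∫⁻ z, H x y z ∂σ ∂σ := setLIntegral_mono' hΩ hpt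
    _ ≤ ∫⁻ x, κ * ∫⁻ y, ∫⁻ z, H x y z ∂σ ∂σ := setLIntegral_le_lintegral _ _
    _ = κ * ∫⁻ x, ∫⁻ y, ∫⁻ z, H x y z ∂σ ∂σ := lintegral_const_mul' _ _ ENNReal.ofReal_ne_top
    _ = κ * ∫⁻ y, ∫⁻ x, ∫⁻ z, H x y z ∂σ ∂volume ∂σ := by
        rw [lintegral_lintegral_swap (hHm.lintegral_prod_right').aemeasurable]
    _ = κ * ∫⁻ y, ∫⁻ z, ∫⁻ x, H x y z ∂volume ∂σ ∂σ := by
        congr 1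
        refine lintegral_congr fun y => lintegral_lintegral_swap ?_
        simp only [hH]
        fun_prop
    _ ≤ κ * ∫⁻ y, ∫⁻ z, A * (‖w y - w z‖ₑ ^ 2 / edist y z ^ 2) ∂σ ∂σ := by
        refine mul_le_mul_right (lintegral_mono fun y => lintegral_mono fun z => ?_) _
        by_cases hyz : y = z
        · simp [hyz, hH]
        · simp only [hH]
          rw [lintegral_mul_const' _ _ (by finiteness)]
          refine (mul_le_mul_left (hA y z hyz) _).trans (le_of_eq ?_)
          rw [div_eq_mul_inv, div_eq_mul_inv]
          ring
    _ = _ := by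
        rw [mul_assoc, slobodeckijSq, ← lintegral_const_mul' _ _ ENNReal.coe_ne_top]
        congr 1
        exact lintegral_congr fun y => lintegral_const_mul' _ _ ENNReal.coe_ne_top

/-- The weight is bounded by `(D / c) |x - y|⁻²`. On the boundary `D` is of order `δ`, and this
factor drives the convergence of the boundary values. -/
lemma enorm_sub_average_self_sq_le {c : ℝ} (hc : 0 < c) (hσ : σ ≠ 0) (hδ : 0 < δ)
    (hD : ∀ x, δ ≤ D x) (hw : Integrable w σ) (hwm : Measurable w) {x : Plane}
    (hZ : c / D x ^ 3 ≤ kernelMass σ D x) :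
    ‖w x - average σ D w x‖ₑ ^ 2 ≤
      ENNReal.ofReal (D x / c) * ∫⁻ y, ‖w x - w y‖ₑ ^ 2 / edist x y ^ 2 ∂σ := by
  have hDx : 0 < D x := hδ.trans_le (hD x)
  refine (enorm_sub_average_sq_le hσ hδ hD hw hwm (w x) x).trans ?_
  rw [← lintegral_const_mul' _ _ ENNReal.ofReal_ne_top]
  refine lintegral_mono fun y => ?_
  by_cases hxy : x = y
  · simp [hxy]
  · have hρ : 0 < ‖x - y‖ := norm_pos_iff.2 (sub_ne_zero.2 hxy)
    have he : edist x y ^ 2 = ENNReal.ofReal (‖x - y‖ ^ 2) := by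
      rw [edist_dist, ← ENNReal.ofReal_pow dist_nonneg, dist_eq_norm]
    have h1 : D x ^ 3 / c * kernel D x y ≤ D x / c * (‖x - y‖ ^ 2)⁻¹ := by
      have hq := kernel_den_pos hδ hD x y
      have h2 : D x ^ 2 * ‖x - y‖ ^ 2 ≤ (D x ^ 2 + ‖x - y‖ ^ 2) ^ 2 := by
        nlinarith [sq_nonneg (D x ^ 2), sq_nonneg (‖x - y‖ ^ 2), sq_nonneg (D x * ‖x - y‖)]
      unfold kernel
      calc D x ^ 3 / c * ((D x ^ 2 + ‖x - y‖ ^ 2) ^ 2)⁻¹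
          ≤ D x ^ 3 / c * (D x ^ 2 * ‖x - y‖ ^ 2)⁻¹ := by gcongr
        _ = _ := by field_simp
    rw [he, div_eq_mul_inv (‖w x - w y‖ₑ ^ 2), ← ENNReal.ofReal_inv_of_pos (by positivity)]
    calc weight σ D x y * ‖w x - w y‖ₑ ^ 2
        ≤ ENNReal.ofReal (D x / c * (‖x - y‖ ^ 2)⁻¹) * ‖w x - w y‖ₑ ^ 2 :=
          mul_le_mul_left ((weight_le hδ hD hc hZ y).trans (ENNReal.ofReal_le_ofReal h1)) _
      _ = _ := by
          rw [ENNReal.ofReal_mul (by positivity)]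
          ring

end Kernel

/-- Functions of class `H^{1/2}` on the boundary are approximated by restrictions of `C¹` functions
with bounded energy. -/
theorem exists_lifting {Ω : Set Plane} (hΩ : IsPolygonalDomain Ω)
    (hne : arcLength (frontier Ω) ≠ 0) :
    ∃ C : ℝ≥0, ∀ w : Plane → ℝ, Measurable w → Integrable w (arcLength (frontier Ω)) →
      ∀ δ : ℝ, 0 < δ → δ ≤ 1 → ∃ φ : Plane → ℝ, ContDiff ℝ 1 φ ∧
        ∫⁻ x in Ω, ‖fderiv ℝ φ x‖ₑ ^ 2 ≤ C * slobodeckijSq (arcLength (frontier Ω)) w ∧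
        ∫⁻ x, ‖w x - φ x‖ₑ ^ 2 ∂arcLength (frontier Ω) ≤
          ENNReal.ofReal δ * (C * slobodeckijSq (arcLength (frontier Ω)) w) := by
  set σ := arcLength (frontier Ω) with hσdef
  have : IsFiniteMeasure σ := ⟨hΩ.arcLength_lt_top⟩
  have hFne : (frontier Ω).Nonempty := by
    by_contra h
    rw [Set.not_nonempty_iff_eq_empty] at h
    exact hne (by rw [hσdef, h, arcLength, Measure.restrict_empty])
  have hbd : Bornology.IsBounded (closure Ω) := hΩ.isBounded.closure
  -- Lower regularity is used at radius `D x`, which for `δ ≤ 1` is at most the distance to the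
  -- boundary plus 3.
  obtain ⟨k, hk, hreg⟩ := exists_arcLength_ball_ge hΩ
    (R := Metric.diam (closure Ω) + 3) (by positivity)
  obtain ⟨A, hA⟩ := lintegral_inv_add_norm_pow_four_le
  set c : ℝ := k / 25 with hcdef
  have hc : 0 < c := by positivity
  refine ⟨(64 * 81 / c ^ 2).toNNReal * A + (3 / c).toNNReal, fun w hwm hw δ hδ hδ1 => ?_⟩
  obtain ⟨D, hDc, hDl, hDb⟩ := exists_contDiff_dist (frontier Ω) hδ
  have hD : ∀ x, δ ≤ D x := fun x => by
    linarith [(hDb x).1, Metric.infDist_nonneg (x := x) (s := frontier Ω)]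
  have hZ : ∀ x ∈ closure Ω, c / D x ^ 3 ≤ kernelMass σ D x := by
    intro x hx
    obtain ⟨y₀, hy₀, hdist⟩ := hΩ.isCompact_frontier.exists_infDist_eq_dist hFne x
    have hdx : dist x y₀ ≤ Metric.diam (closure Ω) :=
      Metric.dist_le_diam_of_mem hbd hx (frontier_subset_closure hy₀)
    refine kernelMass_ge hδ hD (y₀ := y₀) (by linarith [(hDb x).1]) ?_
    exact hreg y₀ hy₀ _ (hδ.trans_le (hD x)) (by linarith [(hDb x).2])
  refine ⟨average σ D w, (hasFDerivAt_average hne hδ hD hDc hDl hw 0).1, ?_, ?_⟩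
  · refine (lintegral_fderiv_average_le hΩ.isOpen.measurableSet hc hA hne hδ hD hDc hDl hw hwm
      fun x hx => hZ x (subset_closure hx)).trans ?_
    rw [ENNReal.coe_add, ENNReal.coe_mul]
    gcongr
    exact le_self_add
  · have hmem : ∀ᵐ x ∂σ, x ∈ frontier Ω := ae_restrict_mem isClosed_frontier.measurableSet
    calc ∫⁻ x, ‖w x - average σ D w x‖ₑ ^ 2 ∂σ
        ≤ ∫⁻ x, ENNReal.ofReal (3 * δ / c) *
            ∫⁻ y, ‖w x - w y‖ₑ ^ 2 / edist x y ^ 2 ∂σ ∂σ := by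
          refine lintegral_mono_ae ?_
          filter_upwards [hmem] with x hx
          refine (enorm_sub_average_self_sq_le hc hne hδ hD hw hwm
            (hZ x (frontier_subset_closure hx))).trans ?_
          gcongr
          have := (hDb x).2
          rwa [Metric.infDist_zero_of_mem hx, zero_add] at this
      _ = ENNReal.ofReal (3 * δ / c) * slobodeckijSq σ w :=
          lintegral_const_mul' _ _ ENNReal.ofReal_ne_top
      _ = ENNReal.ofReal δ * (((3 / c).toNNReal : ℝ≥0) * slobodeckijSq σ w) := by
          rw [← mul_assoc]
          congr 1
          rw [show 3 * δ / c = δ * (3 / c) by ring, ENNReal.ofReal_mul hδ.le]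
          rfl
      _ ≤ _ := by
          rw [ENNReal.coe_add]
          gcongr
          exact le_add_self

/-! ### Hilbert space tools -/

lemma exists_norm_minimal {E : Type*} [NormedAddCommGroup E] [InnerProductSpace ℝ E]
    [CompleteSpace E] {K : Set E} (hne : K.Nonempty) (hcl : IsClosed K) (hconv : Convex ℝ K) :
    ∃ v ∈ K, ∀ x ∈ K, ‖v‖ ≤ ‖x‖ := by
  obtain ⟨v, hv, hmin⟩ := exists_norm_eq_iInf_of_complete_convex hne hcl.isComplete hconv 0
  refine ⟨v, hv, fun x hx => ?_⟩
  rw [zero_sub, norm_neg] at hmin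
  rw [hmin]
  have := ciInf_le (f := fun w : K => ‖(0 : E) - w‖)
    ⟨0, by rintro _ ⟨w, rfl⟩; exact norm_nonneg _⟩ ⟨x, hx⟩
  simpa using this

/-- A bounded sequence in a Hilbert space whose image under a continuous linear map `ℓ` converges
has suitable convex combinations which converge; the limit is mapped by `ℓ` to the given limit. -/
theorem exists_limit_of_bounded {E F : Type*} [NormedAddCommGroup E] [InnerProductSpace ℝ E]
    [CompleteSpace E] [NormedAddCommGroup F] [NormedSpace ℝ F] {T : Set E} (hT : IsClosed T)
    (hTc : Convex ℝ T) {x : ℕ → E} (hx : ∀ n, x n ∈ T) {B : ℝ} (hB : ∀ n, ‖x n‖ ≤ B)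
    (l : E →L[ℝ] F) {y : F} (hl : Tendsto (fun n => l (x n)) atTop (𝓝 y)) :
    ∃ v ∈ T, ‖v‖ ≤ B ∧ l v = y := by
  set K : ℕ → Set E := fun n => closure (convexHull ℝ (x '' Set.Ici n)) with hK
  have hKcl : ∀ n, IsClosed (K n) := fun n => isClosed_closure
  have hKconv : ∀ n, Convex ℝ (K n) := fun n => (convex_convexHull ℝ _).closure
  have hxK : ∀ n, x n ∈ K n := fun n =>
    subset_closure (subset_convexHull ℝ _ ⟨n, Set.mem_Ici.2 le_rfl, rfl⟩)
  have hanti : ∀ {n m}, n ≤ m → K m ⊆ K n := fun {n m} h =>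
    closure_mono (convexHull_mono (Set.image_mono (Set.Ici_subset_Ici.2 h)))
  have hsub : ∀ {n} {S : Set E}, IsClosed S → Convex ℝ S → (∀ m, n ≤ m → x m ∈ S) → K n ⊆ S := by
    intro n S hS hSc h
    refine closure_minimal (convexHull_min ?_ hSc) hS
    rintro _ ⟨m, hm, rfl⟩
    exact h m hm
  -- Minimal-norm points of the closed convex hulls of the tails. The hulls shrink, so the norms
  -- increase and stay bounded, and the parallelogram law makes the points a Cauchy sequence; this
  -- stands in for weak compactness.
  choose v hvK hvmin using fun n => exists_norm_minimal ⟨_, hxK n⟩ (hKcl n) (hKconv n)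
  have hvB : ∀ n, ‖v n‖ ≤ B := fun n => (hvmin n _ (hxK n)).trans (hB n)
  have hmono : Monotone fun n => ‖v n‖ ^ 2 := fun n m h =>
    pow_le_pow_left₀ (norm_nonneg _) (hvmin n _ (hanti h (hvK m))) 2
  have hbdd : BddAbove (Set.range fun n => ‖v n‖ ^ 2) := by
    refine ⟨B ^ 2, ?_⟩
    rintro _ ⟨n, rfl⟩
    exact pow_le_pow_left₀ (norm_nonneg _) (hvB n) 2
  have hconv := tendsto_atTop_ciSup hmono hbdd
  set s := ⨆ n, ‖v n‖ ^ 2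
  have hdist : ∀ n m, n ≤ m → ‖v n - v m‖ ^ 2 ≤ 2 * (s - ‖v n‖ ^ 2) := by
    intro n m h
    have hmid : (1 / 2 : ℝ) • v n + (1 / 2 : ℝ) • v m ∈ K n :=
      hKconv n (hvK n) (hanti h (hvK m)) (by norm_num) (by norm_num) (by norm_num)
    have h1 := hvmin n _ hmid
    rw [← smul_add, norm_smul] at h1
    have h2 := parallelogram_law_with_norm ℝ (v n) (v m)
    have h3 : ‖v m‖ ^ 2 ≤ s := le_ciSup hbdd m
    have h4 : 2 * ‖v n‖ ≤ ‖v n + v m‖ := by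
      norm_num at h1
      linarith
    nlinarith [norm_nonneg (v n), norm_nonneg (v n + v m)]
  have hcauchy : CauchySeq v := by
    rw [Metric.cauchySeq_iff']
    intro ε hε
    have hev := hconv.eventually (lt_mem_nhds (show s - ε ^ 2 / 2 < s by
      have := sq_pos_of_pos hε
      linarith))
    obtain ⟨N, hN⟩ := hev.exists
    refine ⟨N, fun n hn => ?_⟩
    rw [dist_comm, dist_eq_norm]
    have := hdist N n hn
    exact lt_of_pow_lt_pow_left₀ 2 hε.le (by linarith)
  obtain ⟨z, hz⟩ := cauchySeq_tendsto_of_complete hcauchy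
  refine ⟨z, ?_, ?_, ?_⟩
  · exact hT.mem_of_tendsto hz (Eventually.of_forall fun n => hsub hT hTc (fun m _ => hx m) (hvK n))
  · exact le_of_tendsto hz.norm (Eventually.of_forall hvB)
  · have hlz : Tendsto (fun n => l (v n)) atTop (𝓝 (l z)) := (l.continuous.tendsto z).comp hz
    refine tendsto_nhds_unique hlz ?_
    rw [Metric.tendsto_atTop]
    intro ε hε
    obtain ⟨N, hN⟩ := (Metric.tendsto_atTop.1 hl) (ε / 2) (by positivity)
    refine ⟨N, fun n hn => ?_⟩
    -- Preimages of closed balls are closed and convex, so if they contain a tail of the sequence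
    -- they contain its closed hull. The half radius restores strict inequality.
    have hcl : IsClosed (l ⁻¹' Metric.closedBall y (ε / 2)) :=
      Metric.isClosed_closedBall.preimage l.continuous
    have hcv : Convex ℝ (l ⁻¹' Metric.closedBall y (ε / 2)) :=
      (convex_closedBall y (ε / 2)).linear_preimage l.toLinearMap
    have := hsub hcl hcv (fun m hm => (hN m (hn.trans hm)).le) (hvK n)
    exact lt_of_le_of_lt this (by linarith)

/-- The Lax–Milgram theorem for sesquilinear forms with coercive imaginary part. -/
theorem exists_of_coercive_im {V : Type*} [NormedAddCommGroup V] [InnerProductSpace ℂ V]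
    [CompleteSpace V] (a : V → V → ℂ) (l : V → ℂ)
    (add_left : ∀ u u' v, a (u + u') v = a u v + a u' v)
    (smul_left : ∀ (c : ℂ) u v, a (c • u) v = c * a u v)
    (add_right : ∀ u v v', a u (v + v') = a u v + a u v')
    (smul_right : ∀ (c : ℂ) u v, a u (c • v) = star c * a u v)
    {M : ℝ} (bound : ∀ u v, ‖a u v‖ ≤ M * ‖u‖ * ‖v‖)
    {c : ℝ} (hc : 0 < c) (coercive : ∀ u, c * ‖u‖ ^ 2 ≤ (a u u).im)
    (l_add : ∀ v v', l (v + v') = l v + l v') (l_smul : ∀ (c : ℂ) v, l (c • v) = star c * l v)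
    {N : ℝ} (l_bound : ∀ v, ‖l v‖ ≤ N * ‖v‖) : ∃ u, ∀ v, a u v = l v := by
  let _ : InnerProductSpace ℝ V := InnerProductSpace.complexToReal
  have hsm : ∀ (r : ℝ) (v : V), r • v = (r : ℂ) • v := fun r v => (Complex.coe_smul r v).symm
  -- Over the reals the imaginary part of a sesquilinear form is bilinear and here coercive, so the
  -- real Lax–Milgram theorem applies.
  let B₀ : V →ₗ[ℝ] V →ₗ[ℝ] ℝ := LinearMap.mk₂ ℝ (fun u v => (a u v).im)
    (fun u u' v => by rw [add_left, Complex.add_im])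
    (fun r u v => by rw [hsm, smul_left, Complex.im_ofReal_mul, smul_eq_mul])
    (fun u v v' => by rw [add_right, Complex.add_im])
    (fun r u v => by
      rw [hsm, smul_right, Complex.star_def, Complex.conj_ofReal, Complex.im_ofReal_mul,
        smul_eq_mul])
  let B : V →L[ℝ] V →L[ℝ] ℝ := B₀.mkContinuous₂ M fun u v =>
    (Complex.abs_im_le_norm _).trans (bound u v)
  let l₀ : V →ₗ[ℝ] ℝ :=
    { toFun := fun v => (l v).im
      map_add' := fun v v' => by rw [l_add, Complex.add_im]
      map_smul' := fun r v => by
        rw [hsm, l_smul, Complex.star_def, Complex.conj_ofReal, Complex.im_ofReal_mul,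
          smul_eq_mul, RingHom.id_apply] }
  let l₁ : V →L[ℝ] ℝ := l₀.mkContinuous N fun v => (Complex.abs_im_le_norm _).trans (l_bound v)
  have hB : IsCoercive B := ⟨c, hc, fun u => by
    have := coercive u
    rw [mul_assoc, ← sq]
    exact this⟩
  set u := hB.continuousLinearEquivOfBilin.symm ((InnerProductSpace.toDual ℝ V).symm l₁) with hu
  have him : ∀ v, (a u v).im = (l v).im := by
    intro v
    have h1 := hB.continuousLinearEquivOfBilin_apply u v
    rw [hu, ContinuousLinearEquiv.apply_symm_apply, InnerProductSpace.toDual_symm_apply] at h1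
    exact h1.symm
  refine ⟨u, fun v => Complex.ext ?_ (him v)⟩
  -- Both sides are conjugate linear in the test vector, so the imaginary part at `i • v` is minus
  -- the real part at `v`.
  have h := him (Complex.I • v)
  rw [smul_right, l_smul] at h
  simpa using h

/-! ### `H¹(Ω)` is closed and contains the `C¹` functions -/

/-- The gradient of a `C¹` function. -/
def classicalGrad (φ : Plane → ℂ) (x : Plane) : EuclideanSpace ℂ (Fin 2) :=
  WithLp.toLp 2 fun j => partialDeriv j φ x

lemma continuous_classicalGrad {φ : Plane → ℂ} (hφ : ContDiff ℝ 1 φ) :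
    Continuous (classicalGrad φ) := by
  refine (PiLp.continuous_toLp 2 _).comp (continuous_pi fun j => ?_)
  exact (hφ.continuous_fderiv one_ne_zero).clm_apply continuous_const

lemma norm_partialDeriv_le (φ : Plane → ℂ) (j : Fin 2) (x : Plane) :
    ‖partialDeriv j φ x‖ ≤ ‖fderiv ℝ φ x‖ := by
  refine (ContinuousLinearMap.le_opNorm _ _).trans (le_of_eq ?_)
  simp

lemma norm_classicalGrad_le (φ : Plane → ℂ) (x : Plane) :
    ‖classicalGrad φ x‖ ≤ 2 * ‖fderiv ℝ φ x‖ := by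
  refine (pow_le_pow_iff_left₀ (norm_nonneg _) (by positivity) two_ne_zero).1 ?_
  rw [EuclideanSpace.norm_sq_eq, Fin.sum_univ_two]
  have h0 := norm_partialDeriv_le φ 0 x
  have h1 := norm_partialDeriv_le φ 1 x
  change ‖partialDeriv 0 φ x‖ ^ 2 + ‖partialDeriv 1 φ x‖ ^ 2 ≤ _
  nlinarith [norm_nonneg (partialDeriv 0 φ x), norm_nonneg (partialDeriv 1 φ x)]

lemma norm_fderiv_le (φ : Plane → ℂ) (x : Plane) :
    ‖fderiv ℝ φ x‖ ≤ 2 * ‖classicalGrad φ x‖ := by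
  refine ContinuousLinearMap.opNorm_le_bound _ (by positivity) fun v => ?_
  have hv : v = v 0 • EuclideanSpace.single 0 (1 : ℝ) + v 1 • EuclideanSpace.single 1 (1 : ℝ) := by
    ext i
    fin_cases i <;> simp
  have e : fderiv ℝ φ x v = v 0 • partialDeriv 0 φ x + v 1 • partialDeriv 1 φ x := by
    conv_lhs => rw [hv]
    rw [map_add, map_smul, map_smul]
    rfl
  rw [e]
  refine (norm_add_le _ _).trans ?_
  rw [norm_smul, norm_smul]
  have h0 : ‖partialDeriv 0 φ x‖ ≤ ‖classicalGrad φ x‖ := PiLp.norm_apply_le (classicalGrad φ x) 0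
  have h1 : ‖partialDeriv 1 φ x‖ ≤ ‖classicalGrad φ x‖ := PiLp.norm_apply_le (classicalGrad φ x) 1
  have hv0 := PiLp.norm_apply_le v 0
  have hv1 := PiLp.norm_apply_le v 1
  calc ‖v 0‖ * ‖partialDeriv 0 φ x‖ + ‖v 1‖ * ‖partialDeriv 1 φ x‖
      ≤ ‖v‖ * ‖classicalGrad φ x‖ + ‖v‖ * ‖classicalGrad φ x‖ := by gcongr
    _ = _ := by ring

lemma integral_partialDeriv_smul {Ω : Set Plane} {φ : Plane → ℝ} (hφ : ContDiff ℝ ∞ φ)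
    (hc : HasCompactSupport φ) (hs : tsupport φ ⊆ Ω) {u : Plane → ℂ} (hu : ContDiff ℝ 1 u)
    (j : Fin 2) :
    ∫ x in Ω, partialDeriv j φ x • u x = -∫ x in Ω, φ x • partialDeriv j u x := by
  have hcd : HasCompactSupport (partialDeriv j φ) := hasCompactSupport_partialDeriv hc j
  have hu' : Continuous (partialDeriv j u) :=
    (hu.continuous_fderiv one_ne_zero).clm_apply continuous_const
  have hz : ∀ x ∉ Ω, φ x = 0 := fun x hx => image_eq_zero_of_notMem_tsupport fun h => hx (hs h)
  have hz' : ∀ x ∉ Ω, partialDeriv j φ x = 0 := fun x hx => by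
    have : x ∉ tsupport (fderiv ℝ φ) := fun h => hx (hs (tsupport_fderiv_subset ℝ h))
    rw [partialDeriv, image_eq_zero_of_notMem_tsupport this]
    rfl
  rw [setIntegral_eq_integral_of_forall_compl_eq_zero fun x hx => by rw [hz' x hx, zero_smul],
    setIntegral_eq_integral_of_forall_compl_eq_zero fun x hx => by rw [hz x hx, zero_smul],
    eq_neg_iff_add_eq_zero, add_comm, ← eq_neg_iff_add_eq_zero]
  refine integral_smul_fderiv_eq_neg_fderiv_smul_of_integrable ?_ ?_ ?_ ?_ ?_
  · exact ((continuous_partialDeriv hφ j).smul hu.continuous).integrable_of_hasCompactSupport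
      hcd.smul_right
  · exact (hφ.continuous.smul hu').integrable_of_hasCompactSupport hc.smul_right
  · exact (hφ.continuous.smul hu.continuous).integrable_of_hasCompactSupport hc.smul_right
  · exact fun x _ => hφ.differentiable (by simp) x
  · exact fun x _ => hu.differentiable one_ne_zero x

lemma memLp_two_of_continuous {F : Type*} [NormedAddCommGroup F]
    {ν : Measure Plane} [IsFiniteMeasure ν] {K : Set Plane} (hK : IsCompact K)
    (hν : ∀ᵐ x ∂ν, x ∈ K) {f : Plane → F} (hf : Continuous f) : MemLp f 2 ν := by
  obtain ⟨C, hC⟩ := hK.exists_bound_of_continuousOn hf.continuousOn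
  exact MemLp.of_bound hf.aestronglyMeasurable C (hν.mono hC)

lemma IsPolygonalDomain.isFiniteMeasure_restrict {Ω : Set Plane} (hΩ : IsPolygonalDomain Ω) :
    IsFiniteMeasure ((volume : Measure Plane).restrict Ω) :=
  ⟨by rw [Measure.restrict_apply_univ]; exact hΩ.isBounded.measure_lt_top⟩

lemma IsPolygonalDomain.memLp_restrict {F : Type*} [NormedAddCommGroup F]
    {Ω : Set Plane} (hΩ : IsPolygonalDomain Ω) {f : Plane → F} (hf : Continuous f) :
    MemLp f 2 (volume.restrict Ω) :=
  have := hΩ.isFiniteMeasure_restrict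
  memLp_two_of_continuous hΩ.isBounded.isCompact_closure
    ((ae_restrict_mem hΩ.isOpen.measurableSet).mono fun _ hx => subset_closure hx) hf

lemma IsPolygonalDomain.memLp_arcLength {F : Type*} [NormedAddCommGroup F]
    {Ω : Set Plane} (hΩ : IsPolygonalDomain Ω) {f : Plane → F} (hf : Continuous f) :
    MemLp f 2 (arcLength (frontier Ω)) :=
  have : IsFiniteMeasure (arcLength (frontier Ω)) := ⟨hΩ.arcLength_lt_top⟩
  memLp_two_of_continuous (ν := arcLength (frontier Ω)) hΩ.isCompact_frontier
    (ae_restrict_mem isClosed_frontier.measurableSet) hf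

/-- For each test function the defining identity equates two inner products with fixed `L²`
functions, hence two continuous expressions. -/
lemma isClosed_H1 {Ω : Set Plane} (hΩ : IsPolygonalDomain Ω) :
    IsClosed (H1 Ω : Set (L2Pair Ω)) := by
  have hset : (H1 Ω : Set (L2Pair Ω)) = {p | IsWeakGradient Ω p.fst p.snd} := rfl
  rw [hset]
  simp only [IsWeakGradient, Set.ofPred_forall]
  refine isClosed_iInter fun φ => isClosed_iInter fun h1 => isClosed_iInter fun h2 =>
    isClosed_iInter fun h3 => isClosed_iInter fun j => ?_
  have hψ : MemLp (fun x => ((partialDeriv j φ x : ℝ) : ℂ)) 2 (volume.restrict Ω) :=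
    hΩ.memLp_restrict (Complex.continuous_ofReal.comp (continuous_partialDeriv h1 j))
  have hχ : MemLp (fun x => (EuclideanSpace.single j ((φ x : ℝ) : ℂ) : EuclideanSpace ℂ (Fin 2))) 2
      (volume.restrict Ω) := by
    refine hΩ.memLp_restrict ((PiLp.continuous_toLp 2 _).comp ?_)
    exact (continuous_single j).comp (Complex.continuous_ofReal.comp h1.continuous)
  have e1 : ∀ p : L2Pair Ω, ∫ x in Ω, partialDeriv j φ x • p.fst x =
      inner ℂ (hψ.toLp _) p.fst := fun p => by
    rw [L2.inner_def]
    refine integral_congr_ae ?_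
    filter_upwards [hψ.coeFn_toLp] with x hx
    rw [hx]
    simp [mul_comm]
  have e2 : ∀ p : L2Pair Ω, ∫ x in Ω, φ x • p.snd x j = inner ℂ (hχ.toLp _) p.snd := fun p => by
    rw [L2.inner_def]
    refine integral_congr_ae ?_
    filter_upwards [hχ.coeFn_toLp] with x hx
    rw [hx, EuclideanSpace.inner_single_left]
    simp
  simp only [e1, e2]
  refine isClosed_eq (continuous_const.inner (WithLp.continuous_fst ..)) ?_
  exact (continuous_const.inner (WithLp.continuous_snd ..)).neg

/-! ### The graph of the trace -/

/-- `L²(Ω; ℂ) × L²(Ω; ℂ²) × L²(∂Ω; ℂ)`. -/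
abbrev TraceSpace (Ω : Set Plane) : Type :=
  WithLp 2 (L2Pair Ω × Lp ℂ 2 (arcLength (frontier Ω)))

/-- `x` consists of the restriction of `φ` to `Ω`, its gradient, and its restriction to `∂Ω`. -/
structure Represents {Ω : Set Plane} (φ : Plane → ℂ) (x : TraceSpace Ω) : Prop where
  contDiff : ContDiff ℝ 1 φ
  value : x.fst.fst =ᵐ[volume.restrict Ω] φ
  gradient : x.fst.snd =ᵐ[volume.restrict Ω] classicalGrad φ
  trace : x.snd =ᵐ[arcLength (frontier Ω)] φ

lemma classicalGrad_add {φ ψ : Plane → ℂ} (hφ : ContDiff ℝ 1 φ) (hψ : ContDiff ℝ 1 ψ) :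
    classicalGrad (φ + ψ) = classicalGrad φ + classicalGrad ψ := by
  funext x
  ext j
  change partialDeriv j (φ + ψ) x = partialDeriv j φ x + partialDeriv j ψ x
  rw [partialDeriv, fderiv_add (hφ.differentiable one_ne_zero x) (hψ.differentiable one_ne_zero x)]
  rfl

lemma classicalGrad_smul {φ : Plane → ℂ} (hφ : ContDiff ℝ 1 φ) (c : ℂ) :
    classicalGrad (c • φ) = c • classicalGrad φ := by
  funext x
  ext j
  change partialDeriv j (c • φ) x = c • partialDeriv j φ x
  rw [partialDeriv, fderiv_const_smul (hφ.differentiable one_ne_zero x)]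
  rfl

/-- The triples given by `C¹` functions. -/
def smoothGraph (Ω : Set Plane) : Submodule ℂ (TraceSpace Ω) where
  carrier := {x | ∃ φ, Represents φ x}
  zero_mem' := by
    refine ⟨0, contDiff_const, Lp.coeFn_zero _ _ _, ?_, Lp.coeFn_zero _ _ _⟩
    refine (Lp.coeFn_zero _ _ _).trans (Eventually.of_forall fun x => ?_)
    ext j
    simp [classicalGrad, partialDeriv]
  add_mem' := by
    rintro x y ⟨φ, hφ⟩ ⟨ψ, hψ⟩
    refine ⟨φ + ψ, hφ.contDiff.add hψ.contDiff, ?_, ?_, ?_⟩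
    · exact (Lp.coeFn_add _ _).trans (hφ.value.add hψ.value)
    · rw [classicalGrad_add hφ.contDiff hψ.contDiff]
      exact (Lp.coeFn_add _ _).trans (hφ.gradient.add hψ.gradient)
    · exact (Lp.coeFn_add _ _).trans (hφ.trace.add hψ.trace)
  smul_mem' := by
    rintro c x ⟨φ, hφ⟩
    refine ⟨c • φ, hφ.contDiff.const_smul c, ?_, ?_, ?_⟩
    · exact (Lp.coeFn_smul _ _).trans (hφ.value.const_smul c)
    · rw [classicalGrad_smul hφ.contDiff]
      exact (Lp.coeFn_smul _ _).trans (hφ.gradient.const_smul c)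
    · exact (Lp.coeFn_smul _ _).trans (hφ.trace.const_smul c)

/-- The graph of the trace operator. -/
def traceGraph (Ω : Set Plane) : Submodule ℂ (TraceSpace Ω) := (smoothGraph Ω).topologicalClosure

lemma isClosed_traceGraph (Ω : Set Plane) : IsClosed (traceGraph Ω : Set (TraceSpace Ω)) :=
  Submodule.isClosed_topologicalClosure _

lemma exists_represents {Ω : Set Plane} (hΩ : IsPolygonalDomain Ω) {φ : Plane → ℂ}
    (hφ : ContDiff ℝ 1 φ) : ∃ x : TraceSpace Ω, Represents φ x := by
  have h1 := hΩ.memLp_restrict hφ.continuous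
  have h2 := hΩ.memLp_restrict (continuous_classicalGrad hφ)
  have h3 := hΩ.memLp_arcLength hφ.continuous
  exact ⟨WithLp.toLp 2 (WithLp.toLp 2 (h1.toLp _, h2.toLp _), h3.toLp _),
    hφ, h1.coeFn_toLp, h2.coeFn_toLp, h3.coeFn_toLp⟩

lemma Represents.mem_traceGraph {Ω : Set Plane} {φ : Plane → ℂ} {x : TraceSpace Ω}
    (h : Represents φ x) : x ∈ traceGraph Ω :=
  Submodule.le_topologicalClosure _ ⟨φ, h⟩

lemma fst_mem_H1 {Ω : Set Plane} (hΩ : IsPolygonalDomain Ω) {x : TraceSpace Ω}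
    (hx : x ∈ traceGraph Ω) : x.fst ∈ H1 Ω := by
  have hcl : IsClosed {x : TraceSpace Ω | x.fst ∈ H1 Ω} :=
    (isClosed_H1 hΩ).preimage (WithLp.continuous_fst ..)
  refine closure_minimal ?_ hcl hx
  rintro x ⟨ψ, hψ⟩ φ h1 h2 h3 j
  have e1 : ∫ x' in Ω, partialDeriv j φ x' • x.fst.fst x' =
      ∫ x' in Ω, partialDeriv j φ x' • ψ x' := by
    refine integral_congr_ae ?_
    filter_upwards [hψ.value] with x' hx'
    rw [hx']
  have e2 : ∫ x' in Ω, φ x' • x.fst.snd x' j = ∫ x' in Ω, φ x' • partialDeriv j ψ x' := by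
    refine integral_congr_ae ?_
    filter_upwards [hψ.gradient] with x' hx'
    rw [hx']
    rfl
  rw [e1, e2, integral_partialDeriv_smul h1 h2 h3 hψ.contDiff j]

lemma tendsto_eLpNorm_coord_iff {μ : Measure Plane} {g : ℕ → Plane → EuclideanSpace ℂ (Fin 2)}
    (hg : ∀ n, AEStronglyMeasurable (g n) μ) :
    Tendsto (fun n => eLpNorm (g n) 2 μ) atTop (𝓝 0) ↔
      ∀ j : Fin 2, Tendsto (fun n => eLpNorm (fun x => g n x j) 2 μ) atTop (𝓝 0) := by
  have hgj : ∀ n j, AEStronglyMeasurable (fun x => g n x j) μ := fun n j =>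
    (EuclideanSpace.proj j : EuclideanSpace ℂ (Fin 2) →L[ℂ] ℂ).continuous.comp_aestronglyMeasurable
      (hg n)
  constructor
  · intro h j
    refine tendsto_of_tendsto_of_tendsto_of_le_of_le tendsto_const_nhds h (fun n => zero_le)
      fun n => eLpNorm_mono fun x => PiLp.norm_apply_le (g n x) j
  · intro h
    have hsum := (h 0).add (h 1)
    rw [add_zero] at hsum
    refine tendsto_of_tendsto_of_tendsto_of_le_of_le tendsto_const_nhds hsum (fun n => zero_le)
      fun n => ?_
    calc eLpNorm (g n) 2 μ ≤ eLpNorm ((fun x => ‖g n x 0‖) + fun x => ‖g n x 1‖) 2 μ := by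
          refine eLpNorm_mono_real fun x => ?_
          refine (pow_le_pow_iff_left₀ (norm_nonneg _)
            (by simp only [Pi.add_apply]; positivity) two_ne_zero).1 ?_
          rw [EuclideanSpace.norm_sq_eq, Fin.sum_univ_two, Pi.add_apply]
          nlinarith [norm_nonneg (g n x 0), norm_nonneg (g n x 1)]
      _ ≤ eLpNorm (fun x => ‖g n x 0‖) 2 μ + eLpNorm (fun x => ‖g n x 1‖) 2 μ :=
          eLpNorm_add_le (hgj n 0).norm (hgj n 1).norm one_le_two
      _ = _ := by rw [eLpNorm_norm, eLpNorm_norm]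

/-- Convergence of representatives in `TraceSpace` is the convergence in `IsTrace`. -/
lemma tendsto_iff_of_represents {Ω : Set Plane} {φ : ℕ → Plane → ℂ} {x : ℕ → TraceSpace Ω}
    (h : ∀ n, Represents (φ n) (x n)) (y : TraceSpace Ω) :
    Tendsto x atTop (𝓝 y) ↔
      Tendsto (fun n => eLpNorm (fun z => φ n z - y.fst.fst z) 2 (volume.restrict Ω))
        atTop (𝓝 0) ∧
      (∀ j : Fin 2, Tendsto
        (fun n => eLpNorm (fun z => partialDeriv j (φ n) z - y.fst.snd z j) 2 (volume.restrict Ω))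
        atTop (𝓝 0)) ∧
      Tendsto (fun n => eLpNorm (fun z => φ n z - y.snd z) 2 (arcLength (frontier Ω)))
        atTop (𝓝 0) := by
  have e1 : ∀ n, eLpNorm (⇑(x n).fst.fst - ⇑y.fst.fst) 2 (volume.restrict Ω) =
      eLpNorm (fun z => φ n z - y.fst.fst z) 2 (volume.restrict Ω) := fun n =>
    eLpNorm_congr_ae ((h n).value.sub (EventuallyEq.refl _ _))
  have e2 : ∀ n, eLpNorm (⇑(x n).fst.snd - ⇑y.fst.snd) 2 (volume.restrict Ω) =
      eLpNorm (fun z => classicalGrad (φ n) z - y.fst.snd z) 2 (volume.restrict Ω) := fun n =>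
    eLpNorm_congr_ae ((h n).gradient.sub (EventuallyEq.refl _ _))
  have e3 : ∀ n, eLpNorm (⇑(x n).snd - ⇑y.snd) 2 (arcLength (frontier Ω)) =
      eLpNorm (fun z => φ n z - y.snd z) 2 (arcLength (frontier Ω)) := fun n =>
    eLpNorm_congr_ae ((h n).trace.sub (EventuallyEq.refl _ _))
  have hsplit : Tendsto x atTop (𝓝 y) ↔ Tendsto (fun n => (x n).fst.fst) atTop (𝓝 y.fst.fst) ∧
      Tendsto (fun n => (x n).fst.snd) atTop (𝓝 y.fst.snd) ∧
      Tendsto (fun n => (x n).snd) atTop (𝓝 y.snd) := by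
    constructor
    · intro hx
      have h1 := ((WithLp.continuous_fst 2 (L2Pair Ω) _).tendsto y).comp hx
      exact ⟨((WithLp.continuous_fst 2 _ _).tendsto y.fst).comp h1,
        ((WithLp.continuous_snd 2 _ _).tendsto y.fst).comp h1,
        ((WithLp.continuous_snd 2 (L2Pair Ω) _).tendsto y).comp hx⟩
    · rintro ⟨h1, h2, h3⟩
      have h4 : Tendsto (fun n => (x n).fst) atTop (𝓝 y.fst) :=
        ((WithLp.prod_continuous_toLp 2 _ _).tendsto (y.fst.fst, y.fst.snd)).comp
          (h1.prodMk_nhds h2)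
      exact ((WithLp.prod_continuous_toLp 2 _ _).tendsto (y.fst, y.snd)).comp (h4.prodMk_nhds h3)
  rw [hsplit, Lp.tendsto_Lp_iff_tendsto_eLpNorm', Lp.tendsto_Lp_iff_tendsto_eLpNorm',
    Lp.tendsto_Lp_iff_tendsto_eLpNorm']
  simp only [e1, e2, e3]
  rw [tendsto_eLpNorm_coord_iff (g := fun n z => classicalGrad (φ n) z - y.fst.snd z) fun n =>
    (continuous_classicalGrad (h n).contDiff).aestronglyMeasurable.sub
      (Lp.aestronglyMeasurable _)]
  rfl

/-- `IsTrace` says that `(u, ∇u, w)` lies in `traceGraph Ω`. -/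
theorem isTrace_iff {Ω : Set Plane} (hΩ : IsPolygonalDomain Ω) (u : H1 Ω)
    (w : Lp ℂ 2 (arcLength (frontier Ω))) :
    IsTrace u w ↔ (WithLp.toLp 2 ((u : L2Pair Ω), w) : TraceSpace Ω) ∈ traceGraph Ω := by
  constructor
  · rintro ⟨φ, hφ, h⟩
    choose x hx using fun n => exists_represents hΩ (hφ n)
    refine (isClosed_traceGraph Ω).mem_of_tendsto ((tendsto_iff_of_represents hx _).2 h)
      (Eventually.of_forall fun n => (hx n).mem_traceGraph)
  · intro h
    have h' : (WithLp.toLp 2 ((u : L2Pair Ω), w) : TraceSpace Ω) ∈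
        closure (smoothGraph Ω : Set (TraceSpace Ω)) := h
    obtain ⟨x, hx, hlim⟩ := mem_closure_iff_seq_limit.1 h'
    have hx' : ∀ n, ∃ φ, Represents φ (x n) := hx
    choose φ hφ using hx'
    have h3 := (tendsto_iff_of_represents hφ (WithLp.toLp 2 ((u : L2Pair Ω), w))).1 hlim
    exact ⟨φ, fun n => (hφ n).contDiff, h3.1, h3.2.1, h3.2.2⟩

lemma exists_mem_limit_of_bounded {E F : Type*} [NormedAddCommGroup E] [InnerProductSpace ℂ E]
    [CompleteSpace E] [NormedAddCommGroup F] [NormedSpace ℂ F] {T : Submodule ℂ E}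
    (hT : IsClosed (T : Set E)) {x : ℕ → E} (hx : ∀ n, x n ∈ T) {B : ℝ} (hB : ∀ n, ‖x n‖ ≤ B)
    (l : E →L[ℂ] F) {y : F} (hl : Tendsto (fun n => l (x n)) atTop (𝓝 y)) :
    ∃ v ∈ T, ‖v‖ ≤ B ∧ l v = y := by
  let _ : InnerProductSpace ℝ E := InnerProductSpace.complexToReal
  exact exists_limit_of_bounded hT (T.restrictScalars ℝ).convex hx hB (l.restrictScalars ℝ) hl

/-! ### Norm inequalities on the graph of the trace -/

lemma enorm_Lp_sq {X F : Type*} [MeasurableSpace X] [NormedAddCommGroup F] {μ : Measure X}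
    (f : Lp F 2 μ) : ‖f‖ₑ ^ 2 = ∫⁻ x, ‖f x‖ₑ ^ 2 ∂μ := by
  have h := eLpNorm_nnreal_pow_eq_lintegral (μ := μ) (f := f) (p := 2) two_ne_zero
  rw [Lp.enorm_def]
  simpa using h

lemma norm_sq_le_of_enorm_sq_le {E F G : Type*} [NormedAddCommGroup E] [NormedAddCommGroup F]
    [NormedAddCommGroup G] {C : ℝ≥0} {a : E} {b : F} {c : G}
    (h : ‖a‖ₑ ^ 2 ≤ C * (‖b‖ₑ ^ 2 + ‖c‖ₑ ^ 2)) : ‖a‖ ^ 2 ≤ C * (‖b‖ ^ 2 + ‖c‖ ^ 2) := by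
  simp only [enorm_eq_nnnorm] at h
  have hnn : ‖a‖₊ ^ 2 ≤ C * (‖b‖₊ ^ 2 + ‖c‖₊ ^ 2) := by exact_mod_cast h
  exact_mod_cast hnn

/-- The restriction of `L²` functions to a smaller measure. -/
def restrictLp {X : Type*} [MeasurableSpace X] {ν σ : Measure X} (h : ν ≤ σ) :
    Lp ℂ 2 σ →L[ℂ] Lp ℂ 2 ν :=
  LinearMap.mkContinuous
    { toFun := fun w => ((Lp.memLp w).mono_measure h).toLp w
      map_add' := fun u v => by
        rw [← MemLp.toLp_add, MemLp.toLp_eq_toLp_iff]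
        exact (Measure.absolutelyContinuous_of_le h).ae_le (Lp.coeFn_add u v)
      map_smul' := fun c u => by
        rw [RingHom.id_apply, ← MemLp.toLp_const_smul, MemLp.toLp_eq_toLp_iff]
        exact (Measure.absolutelyContinuous_of_le h).ae_le (Lp.coeFn_smul c u) }
    1 fun w => by
      rw [one_mul, LinearMap.coe_mk, AddHom.coe_mk, Lp.norm_toLp, Lp.norm_def]
      exact ENNReal.toReal_mono (Lp.eLpNorm_ne_top w) (eLpNorm_mono_measure _ h)

lemma coeFn_restrictLp {X : Type*} [MeasurableSpace X] {ν σ : Measure X} (h : ν ≤ σ)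
    (w : Lp ℂ 2 σ) : restrictLp h w =ᵐ[ν] w :=
  ((Lp.memLp w).mono_measure h).coeFn_toLp

lemma norm_restrictLp_le {X : Type*} [MeasurableSpace X] {ν σ : Measure X} (h : ν ≤ σ)
    (w : Lp ℂ 2 σ) : ‖restrictLp h w‖ ≤ ‖w‖ := by
  have := (restrictLp h).le_of_opNorm_le (LinearMap.mkContinuous_norm_le _ zero_le_one _) w
  rwa [one_mul] at this

lemma restrictLp_eq_zero_iff {X : Type*} [MeasurableSpace X] {ν σ : Measure X} (h : ν ≤ σ)
    (w : Lp ℂ 2 σ) : restrictLp h w = 0 ↔ ∀ᵐ x ∂ν, w x = 0 := by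
  rw [Lp.eq_zero_iff_ae_eq_zero]
  have := coeFn_restrictLp h w
  constructor
  · intro h0
    filter_upwards [this, h0] with x hx h0
    rw [← hx, h0]
    rfl
  · intro h0
    filter_upwards [this, h0] with x hx h0
    rw [hx, h0]
    rfl

lemma arcLength_mono {S T : Set Plane} (h : S ⊆ T) : arcLength S ≤ arcLength T :=
  Measure.restrict_mono h le_rfl

section Represents

variable {Ω : Set Plane} {φ : Plane → ℂ} {x : TraceSpace Ω}

lemma Represents.enorm_value_sq (h : Represents φ x) :
    ‖x.fst.fst‖ₑ ^ 2 = ∫⁻ y in Ω, ‖φ y‖ₑ ^ 2 := by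
  rw [enorm_Lp_sq]
  refine lintegral_congr_ae ?_
  filter_upwards [h.value] with y hy
  rw [hy]

lemma Represents.enorm_gradient_sq (h : Represents φ x) :
    ‖x.fst.snd‖ₑ ^ 2 = ∫⁻ y in Ω, ‖classicalGrad φ y‖ₑ ^ 2 := by
  rw [enorm_Lp_sq]
  refine lintegral_congr_ae ?_
  filter_upwards [h.gradient] with y hy
  rw [hy]

lemma Represents.enorm_trace_sq (h : Represents φ x) :
    ‖x.snd‖ₑ ^ 2 = ∫⁻ y, ‖φ y‖ₑ ^ 2 ∂arcLength (frontier Ω) := by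
  rw [enorm_Lp_sq]
  refine lintegral_congr_ae ?_
  filter_upwards [h.trace] with y hy
  rw [hy]

lemma Represents.enorm_restrict_sq (h : Represents φ x) {Γ : Set Plane} (hΓ : Γ ⊆ frontier Ω) :
    ‖restrictLp (arcLength_mono hΓ) x.snd‖ₑ ^ 2 = ∫⁻ y, ‖φ y‖ₑ ^ 2 ∂arcLength Γ := by
  rw [enorm_Lp_sq]
  refine lintegral_congr_ae ?_
  filter_upwards [coeFn_restrictLp (arcLength_mono hΓ) x.snd,
    (Measure.absolutelyContinuous_of_le (arcLength_mono hΓ)).ae_le h.trace] with y hy hy'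
  rw [hy, hy']

lemma enorm_sq_le_four_mul {E F : Type*} [NormedAddCommGroup E] [NormedAddCommGroup F] {a : E}
    {b : F} (h : ‖a‖ ≤ 2 * ‖b‖) : ‖a‖ₑ ^ 2 ≤ 4 * ‖b‖ₑ ^ 2 := by
  simp only [enorm_eq_nnnorm]
  have h' : ‖a‖₊ ≤ 2 * ‖b‖₊ := by exact_mod_cast h
  have h2 : ‖a‖₊ ^ 2 ≤ 4 * ‖b‖₊ ^ 2 := (pow_le_pow_left' h' 2).trans (by rw [mul_pow]; norm_num)
  exact_mod_cast h2

lemma Represents.lintegral_fderiv_le (h : Represents φ x) :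
    ∫⁻ y in Ω, ‖fderiv ℝ φ y‖ₑ ^ 2 ≤ 4 * ‖x.fst.snd‖ₑ ^ 2 := by
  rw [h.enorm_gradient_sq, ← lintegral_const_mul' _ _ (by simp)]
  exact lintegral_mono fun y => enorm_sq_le_four_mul (norm_fderiv_le φ y)

lemma Represents.enorm_gradient_sq_le (h : Represents φ x) :
    ‖x.fst.snd‖ₑ ^ 2 ≤ 4 * ∫⁻ y in Ω, ‖fderiv ℝ φ y‖ₑ ^ 2 := by
  rw [h.enorm_gradient_sq, ← lintegral_const_mul' _ _ (by simp)]
  exact lintegral_mono fun y => enorm_sq_le_four_mul (norm_classicalGrad_le φ y)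

end Represents

/-- The Poincaré and trace inequalities, combined: on the graph of the trace, the norm is controlled
by the trace on `Γ` and the gradient. -/
theorem exists_norm_sq_le {Ω Γ : Set Plane} (hΩ : IsPolygonalDomain Ω) (hΓ : IsClosed Γ)
    (hsub : Γ ⊆ frontier Ω) (hpos : 0 < arcLength Γ Set.univ) :
    ∃ C : ℝ, 0 < C ∧ ∀ x ∈ traceGraph Ω,
      ‖x‖ ^ 2 ≤ C * (‖restrictLp (arcLength_mono hsub) x.snd‖ ^ 2 + ‖x.fst.snd‖ ^ 2) := by
  obtain ⟨C₁, hC₁⟩ := controlled_self hΩ hΓ hsub hpos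
  obtain ⟨C₂, hC₂⟩ := exists_trace_le hΩ
  have key₁ : ∀ x ∈ smoothGraph Ω, ‖x.fst.fst‖ ^ 2 ≤
      (4 * C₁ : ℝ≥0) * (‖restrictLp (arcLength_mono hsub) x.snd‖ ^ 2 + ‖x.fst.snd‖ ^ 2) := by
    rintro x ⟨φ, hφ⟩
    refine norm_sq_le_of_enorm_sq_le ?_
    rw [hφ.enorm_value_sq, hφ.enorm_restrict_sq hsub]
    refine (hC₁ φ hφ.contDiff).trans ?_
    calc C₁ * energy Ω Γ φ
        ≤ C₁ * (4 * (∫⁻ y, ‖φ y‖ₑ ^ 2 ∂arcLength Γ) + 4 * ‖x.fst.snd‖ₑ ^ 2) := by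
          refine mul_le_mul_right (add_le_add ?_ hφ.lintegral_fderiv_le) _
          exact le_mul_of_one_le_left' (by norm_num)
      _ = _ := by push_cast; ring
  have key₂ : ∀ x ∈ smoothGraph Ω, ‖x.snd‖ ^ 2 ≤
      (4 * C₂ : ℝ≥0) * (‖x.fst.fst‖ ^ 2 + ‖x.fst.snd‖ ^ 2) := by
    rintro x ⟨φ, hφ⟩
    refine norm_sq_le_of_enorm_sq_le ?_
    rw [hφ.enorm_trace_sq, hφ.enorm_value_sq]
    refine (hC₂ φ hφ.contDiff).trans ?_
    calc C₂ * ((∫⁻ y in Ω, ‖φ y‖ₑ ^ 2) + ∫⁻ y in Ω, ‖fderiv ℝ φ y‖ₑ ^ 2)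
        ≤ C₂ * (4 * (∫⁻ y in Ω, ‖φ y‖ₑ ^ 2) + 4 * ‖x.fst.snd‖ₑ ^ 2) := by
          refine mul_le_mul_right (add_le_add ?_ hφ.lintegral_fderiv_le) _
          exact le_mul_of_one_le_left' (by norm_num)
      _ = _ := by push_cast; ring
  set a : ℝ := ((4 * C₁ : ℝ≥0) : ℝ) with ha
  set b : ℝ := ((4 * C₂ : ℝ≥0) : ℝ) with hb
  have ha0 : 0 ≤ a := NNReal.coe_nonneg _
  have hb0 : 0 ≤ b := NNReal.coe_nonneg _
  refine ⟨(1 + b) * (a + 1), by positivity, fun x hx => ?_⟩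
  -- All quantities are continuous on the trace space, so the inequality extends from triples of
  -- `C¹` functions to their closure.
  have hcl : IsClosed {x : TraceSpace Ω | ‖x‖ ^ 2 ≤ (1 + b) * (a + 1) *
      (‖restrictLp (arcLength_mono hsub) x.snd‖ ^ 2 + ‖x.fst.snd‖ ^ 2)} := by
    have h1 : Continuous fun x : TraceSpace Ω => x.fst := WithLp.continuous_fst ..
    have h2 : Continuous fun x : TraceSpace Ω => x.snd := WithLp.continuous_snd ..
    have h3 : Continuous fun x : TraceSpace Ω => x.fst.snd := (WithLp.continuous_snd ..).comp h1
    have h4 := (restrictLp (arcLength_mono hsub)).continuous.comp h2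
    exact isClosed_le (continuous_norm.pow 2)
      (continuous_const.mul ((h4.norm.pow 2).add (h3.norm.pow 2)))
  refine closure_minimal (fun x hx => ?_) hcl hx
  have h1 := key₁ x hx
  have h2 := key₂ x hx
  change ‖x‖ ^ 2 ≤ _
  rw [WithLp.prod_norm_sq_eq_of_L2, WithLp.prod_norm_sq_eq_of_L2]
  set r := ‖restrictLp (arcLength_mono hsub) x.snd‖ ^ 2
  have hr : 0 ≤ r := sq_nonneg _
  calc ‖x.fst.fst‖ ^ 2 + ‖x.fst.snd‖ ^ 2 + ‖x.snd‖ ^ 2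
      ≤ (1 + b) * (‖x.fst.fst‖ ^ 2 + ‖x.fst.snd‖ ^ 2) := by linarith
    _ ≤ (1 + b) * (a * (r + ‖x.fst.snd‖ ^ 2) + (r + ‖x.fst.snd‖ ^ 2)) := by
        gcongr
        linarith
    _ = _ := by ring

/-! ### The lifting of boundary data -/

lemma slobodeckijNorm_sq (Ω : Set Plane) (w : Plane → ℝ) :
    slobodeckijNorm Ω w ^ 2 = (∫⁻ x, ‖w x‖ₑ ^ 2 ∂arcLength (frontier Ω)) +
      slobodeckijSq (arcLength (frontier Ω)) w := by
  rw [slobodeckijNorm, ← ENNReal.rpow_natCast, ← ENNReal.rpow_mul]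
  norm_num
  rfl

lemma slobodeckijNorm_congr {Ω : Set Plane} {w w' : Plane → ℝ}
    (h : w =ᵐ[arcLength (frontier Ω)] w') : slobodeckijNorm Ω w = slobodeckijNorm Ω w' := by
  unfold slobodeckijNorm
  congr 2
  · refine lintegral_congr_ae ?_
    filter_upwards [h] with x hx
    rw [hx]
  · refine lintegral_congr_ae ?_
    filter_upwards [h] with x hx
    refine lintegral_congr_ae ?_
    filter_upwards [h] with y hy
    rw [hx, hy]

lemma enorm_fderiv_ofReal_comp_le {φ : Plane → ℝ} (hφ : ContDiff ℝ 1 φ) (x : Plane) :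
    ‖fderiv ℝ (fun y => (φ y : ℂ)) x‖ₑ ≤ ‖fderiv ℝ φ x‖ₑ := by
  have h := (Complex.ofRealCLM.hasFDerivAt.comp x (hφ.differentiable one_ne_zero x).hasFDerivAt)
  have e : fderiv ℝ (fun y => (φ y : ℂ)) x = Complex.ofRealCLM.comp (fderiv ℝ φ x) := h.fderiv
  rw [e, ← ofReal_norm, ← ofReal_norm]
  refine ENNReal.ofReal_le_ofReal ((ContinuousLinearMap.opNorm_comp_le _ _).trans ?_)
  rw [Complex.ofRealCLM_norm, one_mul]

/-- The averages at scale `1 / (n + 1)` are bounded in the graph norm and their traces converge to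
`w`; a limit of convex combinations keeps the bound and has trace exactly `w`. -/
theorem exists_lifting_traceGraph {Ω : Set Plane} (hΩ : IsPolygonalDomain Ω)
    (hpos : 0 < arcLength (frontier Ω) Set.univ) :
    ∃ C : ℝ, 0 < C ∧ ∀ w : Plane → ℝ, AEStronglyMeasurable w (arcLength (frontier Ω)) →
      slobodeckijNorm Ω w ≠ ⊤ → ∃ x ∈ traceGraph Ω,
        (x.snd =ᵐ[arcLength (frontier Ω)] fun y => (w y : ℂ)) ∧
        ‖x‖ ≤ C * (slobodeckijNorm Ω w).toReal := by
  set σ := arcLength (frontier Ω) with hσ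
  have hfin : IsFiniteMeasure σ := ⟨hΩ.arcLength_lt_top⟩
  obtain ⟨C₁, hC₁⟩ := exists_lifting hΩ (Measure.measure_univ_pos.1 hpos)
  obtain ⟨C₂, hC₂0, hC₂⟩ := exists_norm_sq_le hΩ isClosed_frontier subset_rfl hpos
  -- `2 + 2 * C₁` bounds the squared traces and `4 * C₁` the squared gradients of the approximants,
  -- relative to the squared boundary norm; `C₂` converts their sum into the graph norm.
  refine ⟨√(C₂ * (2 + 6 * C₁)), by positivity, ?_⟩
  have main : ∀ w : Plane → ℝ, Measurable w → slobodeckijNorm Ω w ≠ ⊤ → ∃ x ∈ traceGraph Ω,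
      (x.snd =ᵐ[σ] fun y => (w y : ℂ)) ∧
        ‖x‖ ≤ √(C₂ * (2 + 6 * C₁)) * (slobodeckijNorm Ω w).toReal := by
    intro w hwm hw
    have hsq := slobodeckijNorm_sq Ω w
    set N := slobodeckijNorm Ω w with hN
    set I := ∫⁻ x, ‖w x‖ₑ ^ 2 ∂arcLength (frontier Ω) with hI
    set S := slobodeckijSq (arcLength (frontier Ω)) w with hS
    have hsum : I + S ≠ ⊤ := hsq ▸ ENNReal.pow_ne_top hw
    have hIfin : I ≠ ⊤ := (ENNReal.add_ne_top.1 hsum).1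
    have hSfin : S ≠ ⊤ := (ENNReal.add_ne_top.1 hsum).2
    have hIN : I ≤ N ^ 2 := hsq ▸ le_self_add
    have hSN : S ≤ N ^ 2 := hsq ▸ le_add_self
    have hmem : MemLp (fun y => (w y : ℂ)) 2 σ := by
      refine ⟨(Complex.measurable_ofReal.comp hwm).aestronglyMeasurable, ?_⟩
      have h := eLpNorm_nnreal_pow_eq_lintegral (μ := σ) (f := fun y => (w y : ℂ)) (p := 2)
        two_ne_zero
      have h2 : eLpNorm (fun y => (w y : ℂ)) 2 σ ^ 2 = I := by
        have e : ∀ y, ‖(w y : ℂ)‖ₑ = ‖w y‖ₑ := fun y => by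
          rw [← ofReal_norm, Complex.norm_real, ofReal_norm]
        simpa [e] using h
      by_contra htop
      rw [not_lt, top_le_iff] at htop
      rw [htop] at h2
      exact hIfin (by rw [← h2]; rfl)
    have hwint : Integrable w σ := by
      have := (hmem.integrable one_le_two).re
      simpa using this
    set W : Lp ℂ 2 σ := hmem.toLp _ with hW
    have hWcoe : W =ᵐ[σ] fun y => (w y : ℂ) := hmem.coeFn_toLp
    have hWsq : ‖W‖ₑ ^ 2 = I := by
      rw [enorm_Lp_sq]
      refine lintegral_congr_ae ?_
      filter_upwards [hWcoe] with y hy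
      rw [hy, ← ofReal_norm, Complex.norm_real, ofReal_norm]
    have hδ : ∀ n : ℕ, (0 : ℝ) < 1 / ((n : ℝ) + 1) := fun n => by positivity
    have hδ1 : ∀ n : ℕ, 1 / ((n : ℝ) + 1) ≤ 1 := fun n => by
      rw [div_le_one (by positivity)]
      linarith [Nat.cast_nonneg (α := ℝ) n]
    choose φ hφc hφe hφb using fun n : ℕ => hC₁ w hwm hwint _ (hδ n) (hδ1 n)
    have hψ : ∀ n, ContDiff ℝ 1 fun y => (φ n y : ℂ) := fun n =>
      Complex.ofRealCLM.contDiff.comp (hφc n)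
    choose x hx using fun n => exists_represents hΩ (hψ n)
    have hgrad : ∀ n, ‖(x n).fst.snd‖ₑ ^ 2 ≤ 4 * (C₁ * N ^ 2) := fun n => by
      refine (hx n).enorm_gradient_sq_le.trans (mul_le_mul_right ?_ _)
      refine (lintegral_mono fun y => pow_le_pow_left' (enorm_fderiv_ofReal_comp_le (hφc n) y)
        2).trans ((hφe n).trans (mul_le_mul_right hSN _))
    have hdiff : ∀ n : ℕ, ‖W - (x n).snd‖ₑ ^ 2 ≤
        ENNReal.ofReal (1 / ((n : ℝ) + 1)) * (C₁ * S) := fun n => by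
      rw [enorm_Lp_sq]
      refine le_trans (le_of_eq (lintegral_congr_ae ?_)) (hφb n)
      filter_upwards [Lp.coeFn_sub W (x n).snd, hWcoe, (hx n).trace] with y h1 h2 h3
      rw [h1, Pi.sub_apply, h2, h3, ← Complex.ofReal_sub, ← ofReal_norm, Complex.norm_real,
        ofReal_norm]
    have htr : ∀ n, ‖(x n).snd‖ₑ ^ 2 ≤ 2 * N ^ 2 + 2 * (C₁ * N ^ 2) := fun n => by
      refine (enorm_sq_le (x n).snd W).trans (add_le_add (mul_le_mul_right ?_ _)
        (mul_le_mul_right ?_ _))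
      · rw [hWsq]
        exact hIN
      · rw [enorm_sub_rev]
        refine (hdiff n).trans ?_
        calc ENNReal.ofReal (1 / ((n : ℝ) + 1)) * (C₁ * S) ≤ 1 * (C₁ * N ^ 2) := by
              gcongr
              exact ENNReal.ofReal_le_one.2 (hδ1 n)
          _ = _ := one_mul _
    have hbound : ∀ n, ‖x n‖ ≤ √(C₂ * (2 + 6 * C₁)) * N.toReal := fun n => by
      have hreal : ∀ {E : Type} [NormedAddCommGroup E] (a : E) (K : ℝ≥0),
          ‖a‖ₑ ^ 2 ≤ K * N ^ 2 → ‖a‖ ^ 2 ≤ K * N.toReal ^ 2 := by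
        intro E _ a K h
        have := ENNReal.toReal_mono (by finiteness) h
        simpa [ENNReal.toReal_mul, ENNReal.toReal_pow] using this
      have h1 : ‖(x n).fst.snd‖ ^ 2 ≤ (4 * C₁ : ℝ≥0) * N.toReal ^ 2 := by
        refine hreal _ _ ((hgrad n).trans (le_of_eq ?_))
        push_cast
        ring
      have h2 : ‖(x n).snd‖ ^ 2 ≤ (2 + 2 * C₁ : ℝ≥0) * N.toReal ^ 2 := by
        refine hreal _ _ ((htr n).trans (le_of_eq ?_))
        push_cast
        ring
      have h3 := hC₂ (x n) (hx n).mem_traceGraph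
      have h4 : ‖restrictLp (arcLength_mono (subset_refl (frontier Ω))) (x n).snd‖ ^ 2 ≤
          ‖(x n).snd‖ ^ 2 := pow_le_pow_left₀ (norm_nonneg _) (norm_restrictLp_le _ _) 2
      push_cast at h1 h2
      refine (pow_le_pow_iff_left₀ (norm_nonneg _) (by positivity) two_ne_zero).1 ?_
      rw [mul_pow, Real.sq_sqrt (by positivity)]
      calc ‖x n‖ ^ 2 ≤ C₂ * ((2 + 2 * C₁) * N.toReal ^ 2 + 4 * C₁ * N.toReal ^ 2) := by
            refine h3.trans ?_
            gcongr
            exact h4.trans h2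
        _ = _ := by ring
    have hlim : Tendsto (fun n => (x n).snd) atTop (𝓝 W) := by
      rw [tendsto_iff_edist_tendsto_0]
      have h0 : Tendsto (fun n : ℕ => ENNReal.ofReal (1 / ((n : ℝ) + 1)) * (C₁ * S)) atTop
          (𝓝 0) := by
        have h1 : Tendsto (fun n : ℕ => ENNReal.ofReal (1 / ((n : ℝ) + 1))) atTop (𝓝 0) := by
          have := ENNReal.tendsto_ofReal (tendsto_one_div_add_atTop_nhds_zero_nat (𝕜 := ℝ))
          rwa [ENNReal.ofReal_zero] at this
        have := ENNReal.Tendsto.mul_const (b := (C₁ * S : ℝ≥0∞)) h1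
          (Or.inr (ENNReal.mul_ne_top ENNReal.coe_ne_top hSfin))
        rwa [zero_mul] at this
      have h2 : Tendsto (fun n => ‖W - (x n).snd‖ₑ ^ 2) atTop (𝓝 0) :=
        tendsto_of_tendsto_of_tendsto_of_le_of_le tendsto_const_nhds h0 (fun _ => zero_le) hdiff
      have h3 := h2.ennrpow_const (1 / 2)
      rw [ENNReal.zero_rpow_of_pos (by norm_num)] at h3
      refine h3.congr fun n => ?_
      rw [← ENNReal.rpow_natCast, ← ENNReal.rpow_mul, edist_comm, edist_eq_enorm_sub]
      norm_num
    obtain ⟨v, hv, hvB, hvW⟩ := exists_mem_limit_of_bounded (isClosed_traceGraph Ω)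
      (fun n => (hx n).mem_traceGraph) hbound (WithLp.sndL 2 ℂ (L2Pair Ω) (Lp ℂ 2 σ)) hlim
    refine ⟨v, hv, ?_, hvB⟩
    have hvW' : v.snd = W := hvW
    rw [hvW']
    exact hWcoe
  intro w hw hwt
  have hae := hw.ae_eq_mk
  have hcongr := slobodeckijNorm_congr hae
  obtain ⟨x, hx, hxw, hxb⟩ := main (hw.mk w) hw.stronglyMeasurable_mk.measurable (hcongr ▸ hwt)
  refine ⟨x, hx, ?_, by rw [hcongr]; exact hxb⟩
  filter_upwards [hxw, hae] with y h1 h2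
  rw [h1, h2]

/-! ### The sesquilinear form -/

lemma measurable_cutOff {Γ : ℝ → ℝ} (hΓ : Measurable Γ) (ξm ξp : ℝ) :
    Measurable (cutOff ξm ξp Γ) :=
  Measurable.ite measurableSet_Ici measurable_const
    (Measurable.ite measurableSet_Iic measurable_const hΓ)

lemma measurable_Gamma12 (α β : ℝ) : Measurable (Gamma12 α β) := by
  have h : Measurable (mu2 β) := by
    unfold mu2
    fun_prop
  exact ((measurable_deriv (mu1 α)).div h).neg

lemma measurable_Gamma21 (α β : ℝ) : Measurable (Gamma21 α β) := by
  have h : Measurable (mu1 α) := by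
    unfold mu1
    fun_prop
  exact (measurable_deriv (mu2 β)).div h

lemma measurable_Bhat_diag (α β ξm ξp : ℝ) (j : Fin 2) :
    Measurable fun t => Bhat α β ξm ξp t j j := by
  fin_cases j
  · exact (measurable_cutOff (measurable_Gamma21 α β) ξm ξp).neg
  · exact measurable_cutOff (measurable_Gamma12 α β) ξm ξp

/-- The coefficient matrix `B̂(t) + iεI` acting on a vector. -/
def coeffMul (α β ξm ξp ε t : ℝ) (v : EuclideanSpace ℂ (Fin 2)) : EuclideanSpace ℂ (Fin 2) :=
  WithLp.toLp 2 (((Bhat α β ξm ξp t).map Complex.ofReal +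
    (Complex.I * (ε : ℂ)) • (1 : Matrix (Fin 2) (Fin 2) ℂ)) *ᵥ v.ofLp)

lemma coeffMul_apply (α β ξm ξp ε t : ℝ) (v : EuclideanSpace ℂ (Fin 2)) (j : Fin 2) :
    coeffMul α β ξm ξp ε t v j = ((Bhat α β ξm ξp t j j : ℝ) + Complex.I * ε) * v j := by
  fin_cases j <;> simp [coeffMul, Bhat]

lemma coeffMul_add (α β ξm ξp ε t : ℝ) (u v : EuclideanSpace ℂ (Fin 2)) :
    coeffMul α β ξm ξp ε t (u + v) = coeffMul α β ξm ξp ε t u + coeffMul α β ξm ξp ε t v := by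
  ext j
  simp only [coeffMul_apply, PiLp.add_apply, mul_add]

lemma coeffMul_smul (α β ξm ξp ε t : ℝ) (c : ℂ) (v : EuclideanSpace ℂ (Fin 2)) :
    coeffMul α β ξm ξp ε t (c • v) = c • coeffMul α β ξm ξp ε t v := by
  ext j
  simp only [coeffMul_apply, PiLp.smul_apply, smul_eq_mul]
  ring

section Form

variable {α β ξm ξp M : ℝ}

lemma Admissible.norm_coeffMul_le (h : Admissible α β ξm ξp M) (ε t : ℝ)
    (v : EuclideanSpace ℂ (Fin 2)) : ‖coeffMul α β ξm ξp ε t v‖ ≤ (M + |ε|) * ‖v‖ := by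
  have hM := h.M_pos
  have hj : ∀ j, ‖coeffMul α β ξm ξp ε t v j‖ ≤ (M + |ε|) * ‖v j‖ := fun j => by
    rw [coeffMul_apply, norm_mul]
    gcongr
    refine (norm_add_le _ _).trans (add_le_add ?_ ?_)
    · rw [Complex.norm_real]
      exact h.bound t j j
    · simp
  refine (pow_le_pow_iff_left₀ (norm_nonneg _) (by positivity) two_ne_zero).1 ?_
  rw [mul_pow, EuclideanSpace.norm_sq_eq, EuclideanSpace.norm_sq_eq, Fin.sum_univ_two,
    Fin.sum_univ_two, mul_add, ← mul_pow, ← mul_pow]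
  have h0 := hj 0
  have h1 := hj 1
  gcongr

/-- The diagonal entries of `B̂` are real and meet `|v j|²`, so they affect only the real part; this
holds whatever their sign. -/
lemma im_inner_coeffMul (ε t : ℝ) (v : EuclideanSpace ℂ (Fin 2)) :
    (inner ℂ v (coeffMul α β ξm ξp ε t v)).im = ε * ‖v‖ ^ 2 := by
  rw [PiLp.inner_apply, EuclideanSpace.norm_sq_eq, Fin.sum_univ_two, Fin.sum_univ_two]
  simp only [coeffMul_apply, RCLike.inner_apply]
  have key : ∀ (b : ℝ) (z : ℂ), (((b : ℂ) + Complex.I * ε) * z * (starRingEnd ℂ) z).im =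
      ε * ‖z‖ ^ 2 := fun b z => by
    rw [mul_assoc, Complex.mul_conj, Complex.normSq_eq_norm_sq, Complex.im_mul_ofReal]
    simp
  rw [Complex.add_im, key, key]
  ring

variable {Ω : Set Plane}

lemma Admissible.memLp_coeffMul (h : Admissible α β ξm ξp M) (ε : ℝ)
    (ξ : Lp ℝ 2 ((volume : Measure Plane).restrict Ω))
    (G : Lp (EuclideanSpace ℂ (Fin 2)) 2 ((volume : Measure Plane).restrict Ω)) :
    MemLp (fun x => coeffMul α β ξm ξp ε (ξ x) (G x)) 2 (volume.restrict Ω) := by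
  refine MemLp.of_le_mul (c := M + |ε|) (Lp.memLp G) ?_
    (Eventually.of_forall fun x => h.norm_coeffMul_le ε _ _)
  refine AEMeasurable.aestronglyMeasurable ?_
  have hξ : AEMeasurable ξ (volume.restrict Ω) := (Lp.aestronglyMeasurable ξ).aemeasurable
  have hG : ∀ j, AEMeasurable (fun x => G x j) (volume.restrict Ω) := fun j =>
    ((EuclideanSpace.proj j : EuclideanSpace ℂ (Fin 2) →L[ℂ] ℂ).continuous.comp_aestronglyMeasurable
      (Lp.aestronglyMeasurable G)).aemeasurable
  have hcomp : AEMeasurable (fun x j => coeffMul α β ξm ξp ε (ξ x) (G x) j)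
      (volume.restrict Ω) := by
    refine aemeasurable_pi_lambda _ fun j => ?_
    simp only [coeffMul_apply]
    refine AEMeasurable.mul (AEMeasurable.add ?_ aemeasurable_const) (hG j)
    exact Complex.measurable_ofReal.comp_aemeasurable
      ((measurable_Bhat_diag α β ξm ξp j).comp_aemeasurable hξ)
  exact (PiLp.continuous_toLp 2 _).measurable.comp_aemeasurable hcomp

/-- Multiplication by `B̂(ξ) + iεI` on `L²(Ω; ℂ²)`. -/
def Admissible.coeffOp (h : Admissible α β ξm ξp M) (ε : ℝ)
    (ξ : Lp ℝ 2 ((volume : Measure Plane).restrict Ω)) :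
    Lp (EuclideanSpace ℂ (Fin 2)) 2 ((volume : Measure Plane).restrict Ω) →L[ℂ]
      Lp (EuclideanSpace ℂ (Fin 2)) 2 ((volume : Measure Plane).restrict Ω) :=
  LinearMap.mkContinuous
    { toFun := fun G => (h.memLp_coeffMul ε ξ G).toLp _
      map_add' := fun G G' => by
        rw [← MemLp.toLp_add, MemLp.toLp_eq_toLp_iff]
        filter_upwards [Lp.coeFn_add G G'] with x hx
        rw [hx, Pi.add_apply, Pi.add_apply, coeffMul_add]
      map_smul' := fun c G => by
        rw [RingHom.id_apply, ← MemLp.toLp_const_smul, MemLp.toLp_eq_toLp_iff]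
        filter_upwards [Lp.coeFn_smul c G] with x hx
        rw [hx, Pi.smul_apply, Pi.smul_apply, coeffMul_smul] }
    (M + |ε|) fun G => by
      refine Lp.norm_le_mul_norm_of_ae_le_mul ?_
      filter_upwards [(h.memLp_coeffMul ε ξ G).coeFn_toLp] with x hx
      rw [LinearMap.coe_mk, AddHom.coe_mk, hx]
      exact h.norm_coeffMul_le ε _ _

lemma Admissible.norm_coeffOp_le (h : Admissible α β ξm ξp M) (ε : ℝ)
    (ξ : Lp ℝ 2 ((volume : Measure Plane).restrict Ω))
    (G : Lp (EuclideanSpace ℂ (Fin 2)) 2 ((volume : Measure Plane).restrict Ω)) :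
    ‖h.coeffOp ε ξ G‖ ≤ (M + |ε|) * ‖G‖ :=
  (h.coeffOp ε ξ).le_of_opNorm_le (LinearMap.mkContinuous_norm_le _
    (add_nonneg h.M_pos.le (abs_nonneg ε)) _) G

lemma Admissible.coeFn_coeffOp (h : Admissible α β ξm ξp M) (ε : ℝ)
    (ξ : Lp ℝ 2 ((volume : Measure Plane).restrict Ω))
    (G : Lp (EuclideanSpace ℂ (Fin 2)) 2 ((volume : Measure Plane).restrict Ω)) :
    h.coeffOp ε ξ G =ᵐ[volume.restrict Ω] fun x => coeffMul α β ξm ξp ε (ξ x) (G x) :=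
  (h.memLp_coeffMul ε ξ G).coeFn_toLp

lemma Admissible.aEps_eq (h : Admissible α β ξm ξp M) (ε : ℝ)
    (ξ : Lp ℝ 2 ((volume : Measure Plane).restrict Ω)) (ζ η : H1 Ω) :
    aEps α β ξm ξp ε ξ ζ η = inner ℂ (grad η) (h.coeffOp ε ξ (grad ζ)) := by
  rw [L2.inner_def, aEps]
  refine integral_congr_ae ?_
  filter_upwards [h.coeFn_coeffOp ε ξ (grad ζ)] with x hx
  rw [hx, EuclideanSpace.inner_eq_star_dotProduct]
  rfl

lemma Admissible.im_inner_coeffOp (h : Admissible α β ξm ξp M) (ε : ℝ)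
    (ξ : Lp ℝ 2 ((volume : Measure Plane).restrict Ω))
    (G : Lp (EuclideanSpace ℂ (Fin 2)) 2 ((volume : Measure Plane).restrict Ω)) :
    (inner ℂ G (h.coeffOp ε ξ G)).im = ε * ‖G‖ ^ 2 := by
  have h1 : ‖G‖ ^ 2 = ∫ x in Ω, ‖G x‖ ^ 2 := by
    have h2 := inner_self_eq_norm_sq_to_K (𝕜 := ℂ) G
    rw [L2.inner_def] at h2
    have h3 : ∫ x in Ω, inner ℂ (G x) (G x) = ((∫ x in Ω, ‖G x‖ ^ 2 : ℝ) : ℂ) := by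
      rw [← integral_complex_ofReal]
      refine integral_congr_ae (Eventually.of_forall fun x => ?_)
      beta_reduce
      rw [inner_self_eq_norm_sq_to_K]
      simp
    rw [h3] at h2
    have h4 : ((∫ x in Ω, ‖G x‖ ^ 2 : ℝ) : ℂ) = ((‖G‖ ^ 2 : ℝ) : ℂ) := by
      rw [h2]
      simp
    exact (Complex.ofReal_injective h4).symm
  have h5 := integral_im (L2.integrable_inner (𝕜 := ℂ) G (h.coeffOp ε ξ G))
  rw [← L2.inner_def] at h5
  change _ = (inner ℂ G (h.coeffOp ε ξ G)).im at h5
  rw [← h5, h1, ← integral_const_mul]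
  refine integral_congr_ae ?_
  filter_upwards [h.coeFn_coeffOp ε ξ G] with x hx
  rw [hx]
  exact im_inner_coeffMul ε (ξ x) (G x)

end Form

/-! ### The linear form -/

section LinForm

variable {Ω ΓD : Set Plane} (g : Lp ℝ 2 (arcLength (frontier Ω \ ΓD)))

lemma linForm_eq (w : Lp ℂ 2 (arcLength (frontier Ω))) :
    linForm g w = inner ℂ (restrictLp (arcLength_mono Set.sdiff_subset) w)
      ((Lp.memLp g).ofReal (K := ℂ) |>.toLp _) := by
  rw [L2.inner_def, linForm]
  refine integral_congr_ae ?_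
  filter_upwards [coeFn_restrictLp (arcLength_mono Set.sdiff_subset) w,
    ((Lp.memLp g).ofReal (K := ℂ)).coeFn_toLp] with x h1 h2
  rw [h1, h2, RCLike.inner_apply]
  rfl

lemma norm_linForm_le (w : Lp ℂ 2 (arcLength (frontier Ω))) : ‖linForm g w‖ ≤ ‖g‖ * ‖w‖ := by
  rw [linForm_eq]
  refine (norm_inner_le_norm _ _).trans ?_
  rw [mul_comm]
  have h1 : ‖((Lp.memLp g).ofReal (K := ℂ)).toLp _‖ = ‖g‖ := by
    rw [Lp.norm_toLp, Lp.norm_def]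
    congr 1
    exact eLpNorm_congr_norm_ae (Eventually.of_forall fun x => by simp)
  rw [h1]
  exact mul_le_mul_of_nonneg_left (norm_restrictLp_le _ _) (norm_nonneg _)

lemma linForm_add (w w' : Lp ℂ 2 (arcLength (frontier Ω))) :
    linForm g (w + w') = linForm g w + linForm g w' := by
  simp only [linForm_eq, map_add, inner_add_left]

lemma linForm_smul (c : ℂ) (w : Lp ℂ 2 (arcLength (frontier Ω))) :
    linForm g (c • w) = star c * linForm g w := by
  simp only [linForm_eq, map_smul, inner_smul_left]
  rfl

end LinForm

/-! ### Existence, uniqueness and the a priori estimate -/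

/-- The elements of the graph of the trace whose trace vanishes on `Γ`. -/
def vanishingGraph {Ω Γ : Set Plane} (hsub : Γ ⊆ frontier Ω) : Submodule ℂ (TraceSpace Ω) :=
  traceGraph Ω ⊓ ((restrictLp (arcLength_mono hsub)).comp
    (WithLp.sndL 2 ℂ (L2Pair Ω) (Lp ℂ 2 (arcLength (frontier Ω))))).ker

lemma mem_vanishingGraph {Ω Γ : Set Plane} (hsub : Γ ⊆ frontier Ω) {x : TraceSpace Ω} :
    x ∈ vanishingGraph hsub ↔ x ∈ traceGraph Ω ∧ ∀ᵐ y ∂arcLength Γ, x.snd y = 0 := by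
  rw [← restrictLp_eq_zero_iff (arcLength_mono hsub)]
  rfl

lemma isClosed_vanishingGraph {Ω Γ : Set Plane} (hsub : Γ ⊆ frontier Ω) :
    IsClosed (vanishingGraph hsub : Set (TraceSpace Ω)) :=
  (isClosed_traceGraph Ω).inter (ContinuousLinearMap.isClosed_ker _)

/-- The norm on the left includes the trace on all of `∂Ω`, so `S` also bounds the Neumann term.
Adding 2 to the square root forces `S > 1`, which later makes `S ^ 4 - 1` positive. -/
lemma exists_norm_le_of_vanishing {Ω Γ : Set Plane} (hΩ : IsPolygonalDomain Ω) (hΓ : IsClosed Γ)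
    (hsub : Γ ⊆ frontier Ω) (hpos : 0 < arcLength Γ Set.univ) :
    ∃ S : ℝ, 1 < S ∧ ∀ x ∈ vanishingGraph hsub, ‖x‖ ≤ S * ‖x.fst.snd‖ := by
  obtain ⟨C, hC, h⟩ := exists_norm_sq_le hΩ hΓ hsub hpos
  refine ⟨√C + 2, by linarith [Real.sqrt_nonneg C], fun x hx => ?_⟩
  have h1 := h x hx.1
  have h2 : restrictLp (arcLength_mono hsub) x.snd = 0 := hx.2
  rw [h2, norm_zero] at h1
  have h3 : ‖x‖ ≤ √C * ‖x.fst.snd‖ := by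
    refine (pow_le_pow_iff_left₀ (norm_nonneg _) (by positivity) two_ne_zero).1 ?_
    rw [mul_pow, Real.sq_sqrt hC.le]
    simpa using h1
  nlinarith [norm_nonneg x.fst.snd]

section Solve

variable {α β ξm ξp M : ℝ} {Ω ΓD : Set Plane}

/-- The weak formulation in terms of the graph of the trace. -/
lemma isSolution_iff (hΩ : IsPolygonalDomain Ω) (hsub : ΓD ⊆ frontier Ω)
    (h : Admissible α β ξm ξp M) (ε : ℝ) (ξ : Lp ℝ 2 ((volume : Measure Plane).restrict Ω))
    (ξD : Plane → ℝ) (g : Lp ℝ 2 (arcLength (frontier Ω \ ΓD))) (ζ : H1 Ω) :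
    IsSolution α β ξm ξp ε ξ ξD g ζ ↔
      (∃ x ∈ traceGraph Ω, x.fst = ζ ∧ ∀ᵐ y ∂arcLength ΓD, x.snd y = (ξD y : ℂ)) ∧
      ∀ y ∈ vanishingGraph hsub,
        inner ℂ y.fst.snd (h.coeffOp ε ξ (grad ζ)) = linForm g y.snd := by
  have hbc : ∀ (z : ℂ) (r : ℝ), (z.re = r ∧ z.im = 0) ↔ z = (r : ℂ) := fun z r => by
    rw [Complex.ext_iff]
    simp
  refine and_congr ?_ ?_
  · constructor
    · rintro ⟨w, hw, hw'⟩
      refine ⟨_, (isTrace_iff hΩ ζ w).1 hw, rfl, ?_⟩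
      exact hw'.mono fun y hy => (hbc _ _).1 hy
    · rintro ⟨x, hx, hxζ, hx'⟩
      refine ⟨x.snd, (isTrace_iff hΩ ζ x.snd).2 ?_, hx'.mono fun y hy => (hbc _ _).2 hy⟩
      rw [← hxζ]
      exact hx
  · constructor
    · intro H y hy
      rw [mem_vanishingGraph] at hy
      have ht : IsTrace (⟨y.fst, fst_mem_H1 hΩ hy.1⟩ : H1 Ω) y.snd :=
        (isTrace_iff hΩ ⟨y.fst, fst_mem_H1 hΩ hy.1⟩ y.snd).2 hy.1
      have h1 := H _ _ ht hy.2
      rwa [h.aEps_eq] at h1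
    · intro H η w hw hw'
      rw [h.aEps_eq]
      exact H (WithLp.toLp 2 ((η : L2Pair Ω), w))
        ((mem_vanishingGraph hsub).2 ⟨(isTrace_iff hΩ η w).1 hw, hw'⟩)

/-- If two elements of the graph of the trace have the same trace on `Γ`, their difference lies in
`vanishingGraph`. -/
lemma sub_mem_vanishingGraph (hsub : ΓD ⊆ frontier Ω) {x y : TraceSpace Ω} (hx : x ∈ traceGraph Ω)
    (hy : y ∈ traceGraph Ω) (hxy : ∀ᵐ z ∂arcLength ΓD, x.snd z = y.snd z) :
    x - y ∈ vanishingGraph hsub := by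
  refine (mem_vanishingGraph hsub).2 ⟨Submodule.sub_mem _ hx hy, ?_⟩
  have h1 := (Measure.absolutelyContinuous_of_le (arcLength_mono hsub)).ae_le
    (Lp.coeFn_sub x.snd y.snd)
  filter_upwards [h1, hxy] with z hz hz'
  rw [WithLp.sub_snd, hz, Pi.sub_apply, hz', sub_self]

/-- Seek `ζ = u + v` with `u` a lifting of the data and `v` of vanishing trace on `ΓD`; the
contribution of `u` moves to the right-hand side. -/
lemma exists_solution (hΩ : IsPolygonalDomain Ω) (hsub : ΓD ⊆ frontier Ω)
    (h : Admissible α β ξm ξp M) {S : ℝ} (hS : 1 < S)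
    (hSle : ∀ x ∈ vanishingGraph hsub, ‖x‖ ≤ S * ‖x.fst.snd‖) {ε : ℝ} (hε : 0 < ε)
    (ξ : Lp ℝ 2 ((volume : Measure Plane).restrict Ω)) {ξD : Plane → ℝ}
    (g : Lp ℝ 2 (arcLength (frontier Ω \ ΓD))) {u : TraceSpace Ω} (hu : u ∈ traceGraph Ω)
    (hu' : ∀ᵐ y ∂arcLength ΓD, u.snd y = (ξD y : ℂ)) :
    ∃ ζ : H1 Ω, IsSolution α β ξm ξp ε ξ ξD g ζ := by
  have hcs : CompleteSpace (vanishingGraph hsub) :=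
    (isClosed_vanishingGraph hsub).completeSpace_coe
  have hgrad : ∀ v : TraceSpace Ω, ‖v.fst.snd‖ ≤ ‖v‖ := fun v =>
    (WithLp.norm_snd_le _ v.fst).trans (WithLp.norm_fst_le _ v)
  have htr : ∀ v : TraceSpace Ω, ‖v.snd‖ ≤ ‖v‖ := fun v => WithLp.norm_snd_le _ v
  have hform : ∀ u v : TraceSpace Ω,
      ‖inner ℂ v.fst.snd (h.coeffOp ε ξ u.fst.snd)‖ ≤ (M + |ε|) * ‖u‖ * ‖v‖ := fun u v => by
    have hM := h.M_pos
    calc ‖inner ℂ v.fst.snd (h.coeffOp ε ξ u.fst.snd)‖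
        ≤ ‖v.fst.snd‖ * ‖h.coeffOp ε ξ u.fst.snd‖ := norm_inner_le_norm _ _
      _ ≤ ‖v‖ * ((M + |ε|) * ‖u‖) := by
          refine mul_le_mul (hgrad v) ((h.norm_coeffOp_le ε ξ _).trans ?_) (norm_nonneg _)
            (norm_nonneg _)
          exact mul_le_mul_of_nonneg_left (hgrad u) (by positivity)
      _ = _ := by ring
  obtain ⟨v, hv⟩ := exists_of_coercive_im (V := vanishingGraph hsub)
    (fun a b => inner ℂ (b : TraceSpace Ω).fst.snd (h.coeffOp ε ξ (a : TraceSpace Ω).fst.snd))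
    (fun b => linForm g (b : TraceSpace Ω).snd -
      inner ℂ (b : TraceSpace Ω).fst.snd (h.coeffOp ε ξ u.fst.snd))
    (fun a a' b => by
      simp only [Submodule.coe_add, WithLp.add_fst, WithLp.add_snd, map_add, inner_add_right])
    (fun c a b => by
      simp only [Submodule.coe_smul, WithLp.smul_fst, WithLp.smul_snd, map_smul, inner_smul_right])
    (fun a b b' => by
      simp only [Submodule.coe_add, WithLp.add_fst, WithLp.add_snd, inner_add_left])
    (fun c a b => by
      simp only [Submodule.coe_smul, WithLp.smul_fst, WithLp.smul_snd, inner_smul_left]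
      rfl)
    (M := M + |ε|) (fun a b => hform a b)
    -- The imaginary part is `ε` times the squared gradient norm, and the gradient norm is at least
    -- `1 / S` times the full norm.
    (c := ε / S ^ 2) (by positivity)
    (fun a => by
      rw [h.im_inner_coeffOp, div_mul_eq_mul_div, div_le_iff₀ (by positivity), mul_assoc, mul_comm
        (‖(a : TraceSpace Ω).fst.snd‖ ^ 2), ← mul_pow]
      exact mul_le_mul_of_nonneg_left (pow_le_pow_left₀ (norm_nonneg _) (hSle a a.2) 2) hε.le)
    (fun b b' => by
      simp only [Submodule.coe_add, WithLp.add_fst, WithLp.add_snd, inner_add_left, linForm_add]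
      ring)
    (fun c b => by
      simp only [Submodule.coe_smul, WithLp.smul_fst, WithLp.smul_snd, inner_smul_left,
        linForm_smul, mul_sub]
      rfl)
    (N := ‖g‖ + (M + |ε|) * ‖u‖)
    (fun b => by
      refine (norm_sub_le _ _).trans ?_
      rw [add_mul]
      refine add_le_add ((norm_linForm_le g _).trans ?_) (hform u b)
      exact mul_le_mul_of_nonneg_left (htr b) (norm_nonneg _))
  have hv2 := (mem_vanishingGraph hsub).1 v.2
  have hmem : u + v ∈ traceGraph Ω := Submodule.add_mem _ hu hv2.1
  refine ⟨⟨(u + v : TraceSpace Ω).fst, fst_mem_H1 hΩ hmem⟩,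
    (isSolution_iff hΩ hsub h ε ξ ξD g _).2 ⟨⟨u + v, hmem, rfl, ?_⟩, ?_⟩⟩
  · have h1 := (Measure.absolutelyContinuous_of_le (arcLength_mono hsub)).ae_le
      (Lp.coeFn_add u.snd (v : TraceSpace Ω).snd)
    filter_upwards [h1, hu', hv2.2] with z hz hz' hz''
    rw [WithLp.add_snd, hz, Pi.add_apply, hz', hz'', add_zero]
  · intro y hy
    have h1 := hv ⟨y, hy⟩
    have h2 : grad (⟨(u + v : TraceSpace Ω).fst, fst_mem_H1 hΩ hmem⟩ : H1 Ω) =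
        u.fst.snd + (v : TraceSpace Ω).fst.snd := rfl
    rw [h2, map_add, inner_add_right, h1]
    ring

/-- The energy estimate for the difference of a solution and a lifting of the boundary data. -/
lemma norm_sub_lifting_le (hΩ : IsPolygonalDomain Ω) (hsub : ΓD ⊆ frontier Ω)
    (h : Admissible α β ξm ξp M) {S : ℝ} (hS : 1 < S)
    (hSle : ∀ x ∈ vanishingGraph hsub, ‖x‖ ≤ S * ‖x.fst.snd‖) {ε : ℝ} (hε : 0 < ε)
    (ξ : Lp ℝ 2 ((volume : Measure Plane).restrict Ω)) {ξD : Plane → ℝ}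
    (g : Lp ℝ 2 (arcLength (frontier Ω \ ΓD))) {u : TraceSpace Ω} (hu : u ∈ traceGraph Ω)
    (hu' : ∀ᵐ y ∂arcLength ΓD, u.snd y = (ξD y : ℂ)) {ζ : H1 Ω}
    (hζ : IsSolution α β ξm ξp ε ξ ξD g ζ) :
    ‖ζ‖ ≤ ‖u‖ + S * ((‖g‖ * S + (M + ε) * ‖u‖) / ε) := by
  obtain ⟨⟨x, hx, hxζ, hx'⟩, heq⟩ := (isSolution_iff hΩ hsub h ε ξ ξD g ζ).1 hζ
  have hy : x - u ∈ vanishingGraph hsub := by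
    refine sub_mem_vanishingGraph hsub hx hu ?_
    filter_upwards [hx', hu'] with z h1 h2
    rw [h1, h2]
  set y := x - u with hydef
  have hygrad : grad ζ = y.fst.snd + u.fst.snd := by
    have : grad ζ = x.fst.snd := by rw [hxζ]; rfl
    rw [this, hydef]
    simp
  have h1 := heq y hy
  rw [hygrad, map_add, inner_add_right] at h1
  set G := y.fst.snd with hG
  -- The difference `y` is itself a test function; the imaginary part of the tested equation
  -- isolates `ε‖G‖²`.
  have him : ε * ‖G‖ ^ 2 = (linForm g y.snd - inner ℂ G (h.coeffOp ε ξ u.fst.snd)).im := by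
    rw [← h.im_inner_coeffOp ε ξ G, ← h1]
    congr 1
    ring
  have hM := h.M_pos
  have hyS := hSle y hy
  have hug : ‖u.fst.snd‖ ≤ ‖u‖ := (WithLp.norm_snd_le _ u.fst).trans (WithLp.norm_fst_le _ u)
  have hle : ε * ‖G‖ ^ 2 ≤ (‖g‖ * S + (M + ε) * ‖u‖) * ‖G‖ := by
    rw [him]
    refine (Complex.abs_im_le_norm _ |> (le_abs_self _).trans).trans ((norm_sub_le _ _).trans ?_)
    rw [add_mul]
    refine add_le_add ?_ ?_
    · refine (norm_linForm_le g _).trans ?_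
      rw [mul_assoc]
      exact mul_le_mul_of_nonneg_left ((WithLp.norm_snd_le _ y).trans hyS) (norm_nonneg _)
    · refine (norm_inner_le_norm _ _).trans ?_
      rw [mul_comm]
      refine mul_le_mul_of_nonneg_right ((h.norm_coeffOp_le ε ξ _).trans ?_) (norm_nonneg _)
      rw [abs_of_pos hε]
      exact mul_le_mul_of_nonneg_left hug (by positivity)
  have hGle : ‖G‖ ≤ (‖g‖ * S + (M + ε) * ‖u‖) / ε := by
    rw [le_div_iff₀ hε]
    rcases (norm_nonneg G).eq_or_lt with h0 | h0
    · rw [← h0, zero_mul]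
      positivity
    · have : (‖G‖ * ε) * ‖G‖ ≤ (‖g‖ * S + (M + ε) * ‖u‖) * ‖G‖ := by
        calc (‖G‖ * ε) * ‖G‖ = ε * ‖G‖ ^ 2 := by ring
          _ ≤ _ := hle
      exact le_of_mul_le_mul_right this h0
  have hζx : ‖ζ‖ = ‖u.fst + y.fst‖ := by
    have : u.fst + y.fst = (ζ : L2Pair Ω) := by
      rw [← hxζ, hydef]
      simp
    rw [this]
    rfl
  rw [hζx]
  refine (norm_add_le _ _).trans (add_le_add (WithLp.norm_fst_le _ u) ?_)
  refine (WithLp.norm_fst_le _ y).trans (hyS.trans ?_)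
  exact mul_le_mul_of_nonneg_left hGle (by linarith)

/-- The difference of two solutions is an admissible test function, so the imaginary part of the
form forces its gradient to vanish, and the Friedrichs bound then forces the difference to vanish.
-/
lemma IsSolution.unique (hΩ : IsPolygonalDomain Ω) (hsub : ΓD ⊆ frontier Ω)
    (h : Admissible α β ξm ξp M) {S : ℝ}
    (hSle : ∀ x ∈ vanishingGraph hsub, ‖x‖ ≤ S * ‖x.fst.snd‖) {ε : ℝ} (hε : 0 < ε)
    {ξ : Lp ℝ 2 ((volume : Measure Plane).restrict Ω)} {ξD : Plane → ℝ}
    {g : Lp ℝ 2 (arcLength (frontier Ω \ ΓD))} {ζ ζ' : H1 Ω}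
    (hζ : IsSolution α β ξm ξp ε ξ ξD g ζ) (hζ' : IsSolution α β ξm ξp ε ξ ξD g ζ') :
    ζ = ζ' := by
  obtain ⟨⟨x, hx, hxζ, hxb⟩, heq⟩ := (isSolution_iff hΩ hsub h ε ξ ξD g ζ).1 hζ
  obtain ⟨⟨x', hx', hxζ', hxb'⟩, heq'⟩ := (isSolution_iff hΩ hsub h ε ξ ξD g ζ').1 hζ'
  have hy : x - x' ∈ vanishingGraph hsub := by
    refine sub_mem_vanishingGraph hsub hx hx' ?_
    filter_upwards [hxb, hxb'] with z h1 h2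
    rw [h1, h2]
  have hG : (x - x').fst.snd = grad ζ - grad ζ' := by
    rw [WithLp.sub_fst, WithLp.sub_snd, hxζ, hxζ']
    rfl
  have h0 : inner ℂ (x - x').fst.snd (h.coeffOp ε ξ (x - x').fst.snd) = 0 := by
    conv_lhs => rw [hG, map_sub, inner_sub_right, ← hG]
    rw [heq _ hy, heq' _ hy, sub_self]
  have h1 := h.im_inner_coeffOp ε ξ (x - x').fst.snd
  rw [h0, Complex.zero_im, eq_comm, mul_eq_zero, or_iff_right hε.ne', sq_eq_zero_iff] at h1
  have h2 := hSle _ hy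
  rw [h1, mul_zero] at h2
  have h3 : x = x' := sub_eq_zero.1 (norm_le_zero_iff.1 h2)
  exact Subtype.ext (by rw [← hxζ, ← hxζ', h3])

lemma MemHHalf.exists_lifting (hsub : ΓD ⊆ frontier Ω) {C : ℝ}
    (hC : ∀ w : Plane → ℝ, AEStronglyMeasurable w (arcLength (frontier Ω)) →
      slobodeckijNorm Ω w ≠ ⊤ → ∃ x ∈ traceGraph Ω,
        (x.snd =ᵐ[arcLength (frontier Ω)] fun y => (w y : ℂ)) ∧
          ‖x‖ ≤ C * (slobodeckijNorm Ω w).toReal)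
    {ξD : Plane → ℝ} (h : MemHHalf Ω ΓD ξD) :
    ∃ u ∈ traceGraph Ω, ∀ᵐ y ∂arcLength ΓD, u.snd y = (ξD y : ℂ) := by
  obtain ⟨w, h1⟩ := iInf_lt_iff.1 h
  obtain ⟨hw, h2⟩ := iInf_lt_iff.1 h1
  obtain ⟨hwD, h3⟩ := iInf_lt_iff.1 h2
  obtain ⟨u, hu, huw, -⟩ := hC w hw h3.ne
  refine ⟨u, hu, ?_⟩
  filter_upwards [(Measure.absolutelyContinuous_of_le (arcLength_mono hsub)).ae_le huw, hwD]
    with y h4 h5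
  rw [h4, h5]

/-- A bound by the norms of all liftings of the boundary data is a bound by their quotient norm. -/
lemma MemHHalf.le_mul_hHalfNorm (hsub : ΓD ⊆ frontier Ω) {C : ℝ}
    (hC : ∀ w : Plane → ℝ, AEStronglyMeasurable w (arcLength (frontier Ω)) →
      slobodeckijNorm Ω w ≠ ⊤ → ∃ x ∈ traceGraph Ω,
        (x.snd =ᵐ[arcLength (frontier Ω)] fun y => (w y : ℂ)) ∧
          ‖x‖ ≤ C * (slobodeckijNorm Ω w).toReal)
    (hCpos : 0 < C) {ξD : Plane → ℝ} (h : MemHHalf Ω ΓD ξD) {a k : ℝ} (hk : 0 < k)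
    (ha : ∀ u ∈ traceGraph Ω, (∀ᵐ y ∂arcLength ΓD, u.snd y = (ξD y : ℂ)) → a ≤ k * ‖u‖) :
    a ≤ k * C * hHalfNorm Ω ΓD ξD := by
  -- The claim is that `a / (k * C)` is below the norm of every extension, hence below the infimum.
  -- A negative `a`, which can occur, is sent to 0 by `ENNReal.ofReal` and does no harm.
  have key : ENNReal.ofReal (a / (k * C)) ≤ hHalfENorm Ω ΓD ξD := by
    refine le_iInf fun w => le_iInf fun hw => le_iInf fun hwD => ?_
    by_cases htop : slobodeckijNorm Ω w = ⊤
    · rw [htop]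
      exact le_top
    obtain ⟨u, hu, huw, hule⟩ := hC w hw htop
    refine ENNReal.ofReal_le_of_le_toReal ?_
    rw [div_le_iff₀' (mul_pos hk hCpos), mul_assoc]
    refine (ha u hu ?_).trans (mul_le_mul_of_nonneg_left hule hk.le)
    filter_upwards [(Measure.absolutelyContinuous_of_le (arcLength_mono hsub)).ae_le huw, hwD]
      with y h4 h5
    rw [h4, h5]
  rw [← div_le_iff₀' (mul_pos hk hCpos)]
  exact (ENNReal.ofReal_le_iff_le_toReal h.ne).1 key

end Solve

end Kirigami

end

theorem mainTheorem3 (Ω ΓD : Set Kirigami.Plane) (hΩ : Kirigami.IsPolygonalDomain Ω)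
    (hΓD : IsClosed ΓD) (hsub : ΓD ⊆ frontier Ω) (hpos : 0 < Kirigami.arcLength ΓD Set.univ) :
    ∃ C Ctr : ℝ, 0 < C ∧ 0 < Ctr ∧
      ∀ (α β ξm ξp M : ℝ), Kirigami.Admissible α β ξm ξp M →
      ∀ (ξD : Kirigami.Plane → ℝ), Kirigami.MemHHalf Ω ΓD ξD →
      ∀ (g : MeasureTheory.Lp ℝ 2 (Kirigami.arcLength (frontier Ω \ ΓD)))
        (ξ : MeasureTheory.Lp ℝ 2 ((MeasureTheory.volume : MeasureTheory.Measure
          Kirigami.Plane).restrict Ω)) (ε : ℝ), 0 < ε →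
        (∃! ζ : Kirigami.H1 Ω, Kirigami.IsSolution α β ξm ξp ε ξ ξD g ζ) ∧
        ∀ ζ : Kirigami.H1 Ω, Kirigami.IsSolution α β ξm ξp ε ξ ξD g ζ →
          ‖ζ‖ ≤ (M * √(1 + C) / ε + 1) * Ctr * Kirigami.hHalfNorm Ω ΓD ξD +
            √(1 + C) / ε * ‖g‖ := by
  obtain ⟨S, hS, hSle⟩ := Kirigami.exists_norm_le_of_vanishing hΩ hΓD hsub hpos
  obtain ⟨Cl, hCl, hlift⟩ := Kirigami.exists_lifting_traceGraph hΩ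
    (hpos.trans_le (Kirigami.arcLength_mono hsub Set.univ))
  have hsqrt : √(1 + (S ^ 4 - 1)) = S ^ 2 := by
    rw [show 1 + (S ^ 4 - 1) = (S ^ 2) ^ 2 by ring]
    exact Real.sqrt_sq (by positivity)
  -- The choice `C = S⁴ - 1` turns `√(1 + C)` into `S²`: one `S` from the trace of the test function
  -- in the Neumann term, one from recovering the full norm. The factor `1 + S` covers the lifting
  -- itself and the `ε`-part of the form applied to it.
  refine ⟨S ^ 4 - 1, (1 + S) * Cl, sub_pos.2 (one_lt_pow₀ hS (by norm_num)), by positivity, ?_⟩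
  intro α β ξm ξp M h ξD hξD g ξ ε hε
  rw [hsqrt]
  have hM := h.M_pos
  constructor
  · obtain ⟨u, hu, hu'⟩ := hξD.exists_lifting hsub hlift
    obtain ⟨ζ, hζ⟩ := Kirigami.exists_solution hΩ hsub h hS hSle hε ξ g hu hu'
    exact ⟨ζ, hζ, fun ζ' hζ' => Kirigami.IsSolution.unique hΩ hsub h hSle hε hζ' hζ⟩
  · intro ζ hζ
    -- With the Neumann term on the left, the rest is linear in the norm of the lifting, so the
    -- infimum over extensions can be taken.
    rw [← sub_le_iff_le_add, ← mul_assoc]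
    refine hξD.le_mul_hHalfNorm hsub hlift hCl (by positivity) fun u hu hu' => ?_
    have h1 := Kirigami.norm_sub_lifting_le hΩ hsub h hS hSle hε ξ g hu hu' hζ
    have h2 : S * ((‖g‖ * S + (M + ε) * ‖u‖) / ε) =
        S ^ 2 / ε * ‖g‖ + (S * M / ε + S) * ‖u‖ := by
      field_simp
    have h3 : S * M / ε * ‖u‖ ≤ M * S ^ 2 / ε * (1 + S) * ‖u‖ := by
      refine mul_le_mul_of_nonneg_right ?_ (norm_nonneg u)
      rw [div_mul_eq_mul_div, div_le_div_iff_of_pos_right hε]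
      have h4 : S ≤ S ^ 2 * (1 + S) := by nlinarith
      nlinarith
    rw [h2] at h1
    linarith
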